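/- **Setting.** Let $d\ge 3$, $\nu\ge 1$, and let $\mu_1,\dots,\mu_\nu\ge 1$ be integers with $\sum_i\mu_i=d-1$. For a map $f:\mathbb R\to\mathbb R$ let $K_{\mathbb R}(f)$ be the set of points with bounded forward orbit. For a periodic point $p$ let $\mathcal B_f(p)=\{x: p\in\omega_f(x)\}$; $p$ is *attracting* if $\mathcal B_f(p)$ contains a nonempty open set. Let $\mathcal B(f)$ be the union of the basins of the attracting periodic points, and let $\Lambda(f)=K_{\mathbb R}(f)\setminus\mathcal B(f)$ be the repeller. A polynomial $f$ with $f([0,1])\subset[0,1]$ is *virtually unimodal* with dominant turning point $c$ if, writing $T$ for the set of its local extrema in $(0,1)$ and $J$ for the closed interval with end points $f^2(c)$ and $f(c)$: $T\cap\operatorname{int}J=\{c\}$, the orbit of $c$ lies in $J$, and $f^k(T)\subset J$ for some $k\ge0$. Let $P_0$ be a real polynomial of degree $d$ with critical points $c_{1,0}<\dots<c_{\nu,0}$, all real, of multiplicities $\mu_1,\dots,\mu_\nu$, such that all critical orbits are finite, $K_{\mathbb R}(P_0)=[0,1]$, $P_0$ is virtually unimodal with dominant turning point $c_{\nu,0}$,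 $P_0^3(c_{\nu,0})=c_{\nu,0}$, $P_0^2(c_{\nu,0})<c_{\nu,0}<P_0(c_{\nu,0})$, and $c_{\nu,0}$ is the only critical point in $[P_0^2(c_{\nu,0}),P_0(c_{\nu,0})]$. Put $\vec v_0=(P_0(c_{1,0}),\dots,P_0(c_{\nu,0}))$. Let $\mathcal P_0(\mathbb C)$ be the family of complex polynomials $P$ of degree $d$ with $\nu$ distinct critical points of multiplicities $\mu_1,\dots,\mu_\nu$ and with $P(0)=P_0(0)$, $P(1)=P_0(1)$. **Proposition.** There are an $\varepsilon>0$ and, on the open polydisk $W\subset\mathbb C^\nu$ of radius $\varepsilon$ around $\vec v_0$, a holomorphic parametrization $w\mapsto P_w$ of a neighbourhood of $P_0$ in $\mathcal P_0(\mathbb C)$ by critical values: $P_w$ has critical points $c_i(w)$ of multiplicity $\mu_i$, holomorphic in $w$, with $P_w(c_i(w))=w_i$, and $P_{\vec v_0}=P_0$, $c_i(\vec v_0)=c_{i,0}$. Let $\mathcal U$ be the set of real $w$ with $|w_i-v_{i,0}|<\varepsilon$ for all $i$ for which $P_w$ has real coefficients. Then the following hold. 1. For every $w\in\mathcal U$ the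 critical points $c_1(w)<\dots<c_\nu(w)$ are real, $P_w$ is virtually unimodal with dominant turning point $c_\nu(w)$, and $P_w$ has exactly one attracting cycle of minimal period three in $I_{\nu-1,w}\cup I_{\nu,w}=[c_{\nu-1}(w),1]$ (where $c_0(w)=0$). If $I_w$ denotes the convex hull of this cycle, then $c_\nu(w)$ is the only critical point in the interior of $I_w$. 2. For every $w\in\mathcal U$ the set $\Lambda(P_w)\cap I_w$ is a Cantor set, it is forward invariant under $P_w$, and $P_w$ restricted to it is topologically conjugate to the left shift on the Fibonacci shift $\Sigma_{\rm Fib}=\{u\in\{1,2\}^{\mathbb N_0}: u_iu_{i+1}\ne 11\text{ for all }i\}$. 3. Put $E=\Lambda(P_0)\cap(P_0^2(c_{\nu,0}),P_0(c_{\nu,0}))$. There is a holomorphic motion $h:W\times E\to\mathbb C$ of $E$ over $(W,\vec v_0)$, that is, $h(\vec v_0,z)=z$ for $z\in E$, $z\mapsto h(w,z)$ is injective for each $w\in W$, and $w\mapsto h(w,z)$ is holomorphic on $W$ for each $z\in E$, such that $$h(w,E)=\Lambda(P_w)\cap I_w\qquad\text{for every } w\in\mathcal U .$$ -/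

import Mathlib

open Polynomial Set Filter Topology

noncomputable section

namespace FibRepeller

/-! ### Real one-dimensional dynamics -/

/-- The `ω`-limit set of `x`: the accumulation points of the forward orbit of `x`. -/
def omegaSet (f : ℝ → ℝ) (x : ℝ) : Set ℝ :=
  {p | MapClusterPt p atTop fun n : ℕ => f^[n] x}

/-- The basin of a (periodic) point `p`: all `x` with `p ∈ ω(x)`. -/
def basin (f : ℝ → ℝ) (p : ℝ) : Set ℝ := {x | p ∈ omegaSet f x}

/-- An attracting periodic point (one-sided attractors included): a periodic point whose basin
contains a nonempty open set. -/
def IsAttracting (f : ℝ → ℝ) (p : ℝ) : Prop :=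
  p ∈ Function.periodicPts f ∧ (interior (basin f p)).Nonempty

/-- The basin of `f`: the union of the basins of all its attracting periodic points. -/
def totalBasin (f : ℝ → ℝ) : Set ℝ := ⋃ p ∈ {p | IsAttracting f p}, basin f p

/-- The real filled Julia set: the points with bounded forward orbit. -/
def filledJulia (f : ℝ → ℝ) : Set ℝ :=
  {x | Bornology.IsBounded (range fun n : ℕ => f^[n] x)}

/-- The repeller `Λ(f)`. -/
def repeller (f : ℝ → ℝ) : Set ℝ := filledJulia f \ totalBasin f

/-- The turning points of a map of `[0, 1]`: its interior local extrema. -/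
def turningPoints (f : ℝ → ℝ) : Set ℝ := {x ∈ Ioo (0 : ℝ) 1 | IsLocalExtr f x}

/-- The polynomial `P`, as a map of `[0, 1]` into itself, is virtually unimodal with dominant
turning point `c`. Here `uIcc a b` is the closed interval with end points `a` and `b`. -/
structure IsVirtuallyUnimodal (P : ℝ[X]) (c : ℝ) : Prop where
  mapsTo : MapsTo P.eval (Icc 0 1) (Icc 0 1)
  single_turning :
    turningPoints P.eval ∩ interior (uIcc (P.eval^[2] c) (P.eval c)) = {c}
  orbit_subset : ∀ n : ℕ, P.eval^[n] c ∈ uIcc (P.eval^[2] c) (P.eval c)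
  eventually_inside :
    ∃ k : ℕ, ∀ t ∈ turningPoints P.eval, P.eval^[k] t ∈ uIcc (P.eval^[2] c) (P.eval c)

/-- All critical orbits are finite (used for polynomials with only real critical points). -/
def IsPostcriticallyFinite (P : ℝ[X]) : Prop :=
  {y : ℝ | ∃ x : ℝ, P.derivative.eval x = 0 ∧ ∃ n : ℕ, y = P.eval^[n] x}.Finite

/-! ### Polynomials with prescribed critical multiplicities -/

/-- `P` has degree `d`, and the `c i` are distinct critical points of `P` of multiplicity `μ i`.
When the `μ i` are positive with sum `d - 1`, these are all the critical points. -/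
structure HasCriticalData {K : Type*} [Field K] {ν : ℕ} (d : ℕ) (μ : Fin ν → ℕ) (P : K[X])
    (c : Fin ν → K) : Prop where
  natDegree_eq : P.natDegree = d
  injective : Function.Injective c
  rootMultiplicity_eq : ∀ i, P.derivative.rootMultiplicity (c i) = μ i

/-- The base polynomial: a post-critically finite, virtually unimodal real polynomial of degree
`d` with critical points `c 0 < ⋯ < c m` (so `ν = m + 1`) of multiplicities `μ i`, with real
filled Julia set `[0, 1]`, whose dominant turning point is the largest critical point
`c_ν = c m`. This point has period three with `P²(c_ν) < c_ν < P(c_ν)`, and is the only critical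
point in `[P²(c_ν), P(c_ν)]`. -/
structure IsBaseMap {m : ℕ} (d : ℕ) (μ : Fin (m + 1) → ℕ) (P : ℝ[X]) (c : Fin (m + 1) → ℝ) :
    Prop where
  critical : HasCriticalData d μ P c
  strictMono : StrictMono c
  postcriticallyFinite : IsPostcriticallyFinite P
  filledJulia_eq : filledJulia P.eval = Icc 0 1
  virtuallyUnimodal : IsVirtuallyUnimodal P (c (Fin.last m))
  lt_dominant : P.eval^[2] (c (Fin.last m)) < c (Fin.last m)
  dominant_lt : c (Fin.last m) < P.eval (c (Fin.last m))
  period_three : P.eval^[3] (c (Fin.last m)) = c (Fin.last m)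
  single_critical : ∀ x ∈ Icc (P.eval^[2] (c (Fin.last m))) (P.eval (c (Fin.last m))),
    P.derivative.eval x = 0 → x = c (Fin.last m)

/-- `Q` belongs to the family `𝒫₀(ℂ)` of complex polynomials of degree `d` with distinct critical
points `c i` of multiplicities `μ i`, and with the same values as `P₀` at `0` and at `1`. -/
structure IsFamilyMember {ν : ℕ} (d : ℕ) (μ : Fin ν → ℕ) (P₀ : ℝ[X]) (Q : ℂ[X])
    (c : Fin ν → ℂ) : Prop where
  critical : HasCriticalData d μ Q c
  eval_zero : Q.eval 0 = ((P₀.eval 0 : ℝ) : ℂ)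
  eval_one : Q.eval 1 = ((P₀.eval 1 : ℝ) : ℂ)

/-- A real vector regarded as a complex one. -/
def toComplex {ν : ℕ} (w : Fin ν → ℝ) : Fin ν → ℂ := fun i => (w i : ℂ)

/-- The vector of critical values. -/
def critValues {ν : ℕ} (P : ℝ[X]) (c : Fin ν → ℝ) : Fin ν → ℝ := fun i => P.eval (c i)

/-- The open polydisk of radius `ε` in `ℂ^ν` (`Fin ν → ℂ` carries the sup norm) around the real
point `v`. -/
def polydisk {ν : ℕ} (v : Fin ν → ℝ) (ε : ℝ) : Set (Fin ν → ℂ) := Metric.ball (toComplex v) ε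

/-- On the polydisk `W` of radius `ε` around the vector `v₀` of critical values of `P₀`, the map
`w ↦ F w` is the parametrization of a neighbourhood of `P₀` in `𝒫₀(ℂ)` by critical values: it is
holomorphic, `F w` has critical points `c w i`, depending holomorphically on `w`, with critical
values `w i`, so that the inverse of `F` is the critical value map. -/
structure IsCriticalValueChart {ν : ℕ} (d : ℕ) (μ : Fin ν → ℕ) (P₀ : ℝ[X]) (c₀ : Fin ν → ℝ)
    (ε : ℝ) (F : (Fin ν → ℂ) → ℂ[X]) (c : (Fin ν → ℂ) → Fin ν → ℂ) : Prop where
  base : F (toComplex (critValues P₀ c₀)) = P₀.map Complex.ofRealHom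
  base_critical : c (toComplex (critValues P₀ c₀)) = toComplex c₀
  mem : ∀ w ∈ polydisk (critValues P₀ c₀) ε, IsFamilyMember d μ P₀ (F w) (c w)
  value : ∀ w ∈ polydisk (critValues P₀ c₀) ε, ∀ i, (F w).eval (c w i) = w i
  holomorphic : ∀ k : ℕ,
    DifferentiableOn ℂ (fun w => (F w).coeff k) (polydisk (critValues P₀ c₀) ε)
  critical_holomorphic : ∀ i,
    DifferentiableOn ℂ (fun w => c w i) (polydisk (critValues P₀ c₀) ε)
  onto_nhds : ∃ δ > 0, ∀ (Q : ℂ[X]) (b : Fin ν → ℂ), IsFamilyMember d μ P₀ Q b →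
    (∀ k : ℕ, ‖Q.coeff k - ((P₀.coeff k : ℝ) : ℂ)‖ < δ) →
    Q ∈ F '' polydisk (critValues P₀ c₀) ε

/-- `w` belongs to the set `𝒰` of those `w` in the real cube of radius `ε` around `v` for which
`F w` has real coefficients, and `P` is `F w` regarded as a real polynomial. -/
def IsRealParameter {ν : ℕ} (v : Fin ν → ℝ) (ε : ℝ) (F : (Fin ν → ℂ) → ℂ[X]) (w : Fin ν → ℝ)
    (P : ℝ[X]) : Prop :=
  (∀ i, |w i - v i| < ε) ∧ P.map Complex.ofRealHom = F (toComplex w)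

/-! ### The interval spanned by the attracting cycle of period three -/

/-- The points `0, c_1, …, c_ν, 1`. -/
def breakpoints {ν : ℕ} (c : Fin ν → ℝ) : Fin (ν + 2) → ℝ :=
  Fin.cons (α := fun _ => ℝ) 0 (Fin.snoc (α := fun _ => ℝ) c 1)

/-- The interval `I_i = [c_i, c_{i+1}]`, `0 ≤ i ≤ ν`, where `c_0 = 0` and `c_{ν+1} = 1`. -/
def lap {ν : ℕ} (c : Fin ν → ℝ) (i : Fin (ν + 1)) : Set ℝ :=
  Icc (breakpoints c i.castSucc) (breakpoints c i.succ)

/-- The union `I_{ν-1} ∪ I_ν` of the last two laps, where `ν = m + 1`. -/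
def lastLaps {m : ℕ} (c : Fin (m + 1) → ℝ) : Set ℝ :=
  lap c (Fin.last m).castSucc ∪ lap c (Fin.last (m + 1))

/-- The points of the attracting cycles of minimal period three that are contained in `A`. -/
def attractingThreeCycles (f : ℝ → ℝ) (A : Set ℝ) : Set ℝ :=
  {x | IsAttracting f x ∧ Function.minimalPeriod f x = 3 ∧ ∀ n : ℕ, f^[n] x ∈ A}

/-- The interval `I_w`: the convex hull of the attracting cycle of period three of `P` in
`I_{ν-1} ∪ I_ν`, where `c` is the vector of critical points of `P`. -/
def cycleHull {m : ℕ} (P : ℝ[X]) (c : Fin (m + 1) → ℝ) : Set ℝ :=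
  convexHull ℝ (attractingThreeCycles P.eval (lastLaps c))

/-! ### Cantor sets, the Fibonacci shift, conjugacy, holomorphic motions -/

/-- A Cantor set: nonempty, compact, totally disconnected, without isolated points. -/
def IsCantorSet (S : Set ℝ) : Prop :=
  S.Nonempty ∧ IsCompact S ∧ IsTotallyDisconnected S ∧ Preperfect S

/-- The sequences in the symbols `1, 2` without two consecutive `1`s (product topology). -/
def fibShift : Set (ℕ → ℕ) :=
  {u | (∀ i, u i = 1 ∨ u i = 2) ∧ ∀ i, ¬(u i = 1 ∧ u (i + 1) = 1)}

/-- The left shift. -/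
def shift (u : ℕ → ℕ) : ℕ → ℕ := fun i => u (i + 1)

/-- `S` and `T` are forward invariant under `f` and `g`, and `f` on `S` is topologically conjugate
to `g` on `T`. -/
def IsTopConjugate {X Y : Type*} [TopologicalSpace X] [TopologicalSpace Y] (f : X → X) (S : Set X)
    (g : Y → Y) (T : Set Y) : Prop :=
  ∃ (hS : MapsTo f S S) (hT : MapsTo g T T) (φ : S ≃ₜ T),
    Function.Semiconj φ (hS.restrict f S S) (hT.restrict g T T)

/-- `h` is a holomorphic motion of `E ⊆ ℂ` over the open set `W ⊆ ℂ^ν` with base point `v`. Its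
values are required to be finite points of the Riemann sphere. -/
structure IsHolomorphicMotion {ν : ℕ} (W : Set (Fin ν → ℂ)) (v : Fin ν → ℂ) (E : Set ℂ)
    (h : (Fin ν → ℂ) → ℂ → ℂ) : Prop where
  base : ∀ z ∈ E, h v z = z
  injOn : ∀ w ∈ W, InjOn (h w) E
  holomorphic : ∀ z ∈ E, DifferentiableOn ℂ (fun w => h w z) W

end FibRepeller

end

/-! The dominant turning point of `P₀` lies on a superattracting cycle c ↦ b ↦ a ↦ c with a < c < b.
Small intervals about a, c and b form a trap: each is carried well inside the next, and the third
iterate contracts near c. What remains between a and b is a pair of Markov intervals, one on each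
side of c. The image of the left one covers the right one and misses the left one; the image of the
right one covers both. So the points whose orbits never leave the Markov intervals (`Trap.invSet`)
are coded by the sequences without 11. Every other orbit of the dynamical interval falls into the
trap and accumulates exactly on one cycle of period three. Hence that cycle is the only attracting
one, and `Trap.invSet` is the repeller between its points (`exists_attracting_cycle`).

That a point is determined by its itinerary needs expansion. A real polynomial all of whose critical
points are real strictly expands the hyperbolic density 1/(x-α) + 1/(β-x) of an interval (α, β) free
of critical points (`cross_ratio_lt_of_pos`). Applied to the branches of `P₀` over (a, c) and (c, b)
this gives `crossDensity_lt`, and compactness away from the trap turns it into a uniform factor κ >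
1 (`exists_trap`). All conditions on the trap are strict inequalities on compact sets, so they
persist near `P₀` (`eventually_isNear`), and the same argument applies to every nearby real
polynomial of the family.

For the holomorphic motion, each orbit of `P₀` in the Markov intervals is corrected to an orbit of
the perturbed complex polynomial by a Newton-like scheme whose multipliers are frozen along the
unperturbed orbit. Expansion makes the scheme a contraction in the sup norm weighted by the density
(`norm_shadowSeq_sub`). Each approximation is holomorphic in the parameter and the convergence is
uniform, so the limit is holomorphic (`differentiableOn_shadow`). For a real parameter the limit is
real and has the itinerary of the point it comes from, so the motion carries the one invariant set
onto the other (`motion_image`).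

The chart comes from the inverse function theorem for the map sending the critical points and the
leading coefficient of the derivative to the critical values and the value at 1. A vector in the
kernel of its differential would give a nonzero polynomial of degree at most d with too many zeros
(`eq_zero_of_vanishing`). -/

noncomputable section

namespace FibRepeller

/-! ### Polynomials with prescribed critical points -/

/-- The derivative of a polynomial is determined by its critical data and its leading
coefficient. -/
theorem HasCriticalData.derivative_eq {K : Type*} [Field K] [CharZero K] {ν d : ℕ}
    {μ : Fin ν → ℕ} {P : K[X]} {c : Fin ν → K} (h : HasCriticalData d μ P c)
    (hd : 1 ≤ d) (hμd : ∑ i, μ i = d - 1) :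
    P.derivative = C (d * P.coeff d) * ∏ i, (X - C (c i)) ^ μ i := by
  have hmon : (∏ i, (X - C (c i)) ^ μ i : K[X]).Monic :=
    monic_prod_of_monic _ _ fun i _ => (monic_X_sub_C _).pow _
  have hdeg : (∏ i, (X - C (c i)) ^ μ i : K[X]).natDegree = d - 1 := by
    rw [natDegree_prod_of_monic _ _ fun i _ => (monic_X_sub_C _).pow _, ← hμd]
    exact Finset.sum_congr rfl fun i _ => by simp [(monic_X_sub_C (c i)).natDegree_pow]
  have hdvd : (∏ i, (X - C (c i)) ^ μ i : K[X]) ∣ P.derivative := by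
    refine Finset.prod_dvd_of_coprime ?_ fun i _ => ?_
    · intro i _ j _ hij
      exact (pairwise_coprime_X_sub_C h.injective hij).pow
    · rw [← h.rootMultiplicity_eq i]
      exact pow_rootMultiplicity_dvd _ _
  obtain ⟨R, hR⟩ := hdvd
  have hP' : P.derivative.natDegree = d - 1 := by rw [natDegree_derivative, h.natDegree_eq]
  have hc : P.derivative.coeff (d - 1) = d * P.coeff d := by
    rw [coeff_derivative, Nat.sub_add_cancel hd, mul_comm]
    congr 1
    rw [← Nat.cast_succ, Nat.succ_eq_add_one, Nat.sub_add_cancel hd]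
  have hPd : P.coeff d ≠ 0 := by
    rw [← h.natDegree_eq, coeff_natDegree, leadingCoeff_ne_zero]
    rintro rfl
    have := h.natDegree_eq
    simp at this
    omega
  have hR0 : R ≠ 0 := by
    rintro rfl
    rw [mul_zero] at hR
    rw [hR, coeff_zero] at hc
    have : (d : K) ≠ 0 := by exact_mod_cast (by omega : d ≠ 0)
    exact mul_ne_zero this hPd hc.symm
  have hRdeg : R.natDegree = 0 := by
    have := hmon.natDegree_mul' hR0
    rw [← hR, hP', hdeg] at this
    omega
  obtain ⟨r, rfl⟩ := natDegree_eq_zero.1 hRdeg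
  have : r = d * P.coeff d := by
    rw [← hc, hR, coeff_mul_C, ← hdeg, coeff_natDegree, hmon.leadingCoeff, one_mul]
  rw [hR, this, mul_comm]

theorem HasCriticalData.coeff_ne_zero {K : Type*} [Field K] {ν d : ℕ}
    {μ : Fin ν → ℕ} {P : K[X]} {c : Fin ν → K} (h : HasCriticalData d μ P c)
    (hd : 1 ≤ d) : P.coeff d ≠ 0 := by
  rw [← h.natDegree_eq, coeff_natDegree, leadingCoeff_ne_zero]
  rintro rfl
  have := h.natDegree_eq
  simp at this
  omega

/-- The primitive of a polynomial of degree less than `d` that vanishes at `0`. -/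
def primitive (d : ℕ) (q : ℂ[X]) : ℂ[X] :=
  ∑ k ∈ Finset.range d, monomial (k + 1) (q.coeff k / (k + 1))

theorem derivative_primitive {d : ℕ} {q : ℂ[X]} (hq : q.natDegree < d) :
    (primitive d q).derivative = q := by
  conv_rhs => rw [q.as_sum_range' d hq]
  rw [primitive, derivative_sum]
  refine Finset.sum_congr rfl fun k _ => ?_
  rw [derivative_monomial]
  have : (k : ℂ) + 1 ≠ 0 := Nat.cast_add_one_ne_zero k
  simp [this]

theorem eval_primitive (d : ℕ) (q : ℂ[X]) (z : ℂ) :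
    (primitive d q).eval z = ∑ k ∈ Finset.range d, q.coeff k / (k + 1) * z ^ (k + 1) := by
  simp [primitive, eval_finsetSum]

theorem eval_zero_primitive (d : ℕ) (q : ℂ[X]) : (primitive d q).eval 0 = 0 := by
  simp [eval_primitive]

theorem natDegree_primitive_le (d : ℕ) (q : ℂ[X]) : (primitive d q).natDegree ≤ d :=
  natDegree_sum_le_of_forall_le _ _ fun _ hk =>
    (natDegree_monomial_le _).trans (Finset.mem_range.1 hk)

/-- Polynomials agreeing at `0` and having the same derivative are equal. -/
theorem eq_of_derivative_eq {p q : ℂ[X]} (h : p.derivative = q.derivative)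
    (h0 : p.eval 0 = q.eval 0) : p = q := by
  have h1 : (p - q).natDegree = 0 := derivative_eq_zero.1 (by simp [h])
  obtain ⟨r, hr⟩ := natDegree_eq_zero.1 h1
  have : r = 0 := by
    have := congrArg (eval 0) hr
    simpa [h0] using this
  rw [this, C_0] at hr
  exact (sub_eq_zero.1 hr.symm)

/-! ### Families of polynomials depending smoothly on parameters -/

section Families

variable {E : Type*} [NormedAddCommGroup E] [NormedSpace ℂ E]

/-- Families of polynomials are differentiated coefficient by coefficient, so no topology on `ℂ[X]`
is involved. -/
theorem contDiff_coeff_mul {f g : E → ℂ[X]} (hf : ∀ k, ContDiff ℂ 1 fun e => (f e).coeff k)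
    (hg : ∀ k, ContDiff ℂ 1 fun e => (g e).coeff k) (k : ℕ) :
    ContDiff ℂ 1 fun e => (f e * g e).coeff k := by
  simp only [coeff_mul]
  exact ContDiff.sum fun i _ => (hf _).mul (hg _)

theorem contDiff_coeff_pow {f : E → ℂ[X]} (hf : ∀ k, ContDiff ℂ 1 fun e => (f e).coeff k)
    (n : ℕ) : ∀ k, ContDiff ℂ 1 fun e => (f e ^ n).coeff k := by
  induction n with
  | zero => intro k; simp only [pow_zero]; exact contDiff_const
  | succ n ih => intro k; simp only [pow_succ]; exact contDiff_coeff_mul ih hf k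

theorem contDiff_coeff_prod {ι : Type*} (s : Finset ι) {f : ι → E → ℂ[X]}
    (hf : ∀ i, ∀ k, ContDiff ℂ 1 fun e => (f i e).coeff k) :
    ∀ k, ContDiff ℂ 1 fun e => (∏ i ∈ s, f i e).coeff k := by
  classical
  induction s using Finset.induction_on with
  | empty => intro k; simp only [Finset.prod_empty]; exact contDiff_const
  | insert a s ha ih =>
    intro k; simp only [Finset.prod_insert ha]; exact contDiff_coeff_mul (hf a) ih k

theorem contDiff_coeff_C {f : E → ℂ} (hf : ContDiff ℂ 1 f) (k : ℕ) :
    ContDiff ℂ 1 fun e => (C (f e)).coeff k := by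
  simp only [coeff_C]
  split_ifs
  · exact hf
  · exact contDiff_const

theorem contDiff_coeff_X_sub_C {f : E → ℂ} (hf : ContDiff ℂ 1 f) (k : ℕ) :
    ContDiff ℂ 1 fun e => (X - C (f e)).coeff k := by
  simp only [coeff_sub]
  exact contDiff_const.sub (contDiff_coeff_C hf k)

/-- The coefficients of the polynomials `f t` are differentiable at `0`, with the coefficients
of `f'` as derivatives. -/
def HasCoeffDeriv (f : ℂ → ℂ[X]) (f' : ℂ[X]) : Prop :=
  ∀ k, HasDerivAt (fun t => (f t).coeff k) (f'.coeff k) 0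

theorem HasCoeffDeriv.mul {f g : ℂ → ℂ[X]} {f' g' : ℂ[X]} (hf : HasCoeffDeriv f f')
    (hg : HasCoeffDeriv g g') :
    HasCoeffDeriv (fun t => f t * g t) (f' * g 0 + f 0 * g') := by
  intro k
  simp only [coeff_add, coeff_mul, ← Finset.sum_add_distrib]
  exact HasDerivAt.fun_sum fun i _ => (hf _).mul (hg _)

theorem HasCoeffDeriv.pow {f : ℂ → ℂ[X]} {f' : ℂ[X]} (hf : HasCoeffDeriv f f') (n : ℕ) :
    HasCoeffDeriv (fun t => f t ^ n) (n * f 0 ^ (n - 1) * f') := by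
  induction n with
  | zero => intro k; simpa using hasDerivAt_const (0 : ℂ) ((1 : ℂ[X]).coeff k)
  | succ n ih =>
    have := ih.mul hf
    simp only [pow_succ]
    convert! this using 1
    -- The exponent `n - 1` is truncated, so the power 0 is treated apart.
    rcases n with _ | n
    · simp
    · simp only [Nat.add_sub_cancel]; push_cast; ring

theorem HasCoeffDeriv.prod {ι : Type*} [DecidableEq ι] (s : Finset ι) {f : ι → ℂ → ℂ[X]}
    {f' : ι → ℂ[X]} (hf : ∀ i, HasCoeffDeriv (f i) (f' i)) :
    HasCoeffDeriv (fun t => ∏ i ∈ s, f i t) (∑ i ∈ s, (∏ j ∈ s.erase i, f j 0) * f' i) := by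
  induction s using Finset.induction_on with
  | empty => intro k; simpa using hasDerivAt_const (0 : ℂ) ((1 : ℂ[X]).coeff k)
  | insert a s ha ih =>
    have := (hf a).mul ih
    simp only [Finset.prod_insert ha]
    convert! this using 1
    rw [Finset.sum_insert ha, Finset.erase_insert ha, Finset.mul_sum, mul_comm]
    congr 1
    refine Finset.sum_congr rfl fun i hi => ?_
    have hai : a ≠ i := fun h => ha (h ▸ hi)
    rw [Finset.erase_insert_of_ne hai, Finset.prod_insert (by simp [ha]), mul_assoc]

theorem hasCoeffDeriv_C (x y : ℂ) : HasCoeffDeriv (fun t => C (x + t * y)) (C y) := by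
  intro k
  simp only [coeff_C]
  split_ifs
  · simpa using ((hasDerivAt_id (0 : ℂ)).mul_const y).const_add x
  · exact hasDerivAt_const _ _

theorem hasCoeffDeriv_X_sub_C (x y : ℂ) : HasCoeffDeriv (fun t => X - C (x + t * y)) (-C y) := by
  intro k
  simp only [coeff_sub, coeff_neg]
  exact (hasCoeffDeriv_C x y k).const_sub _

end Families

/-! ### The chart by critical values -/

section Chart

variable {ν : ℕ}

/-- The polynomial `l ∏ (X - b i) ^ μ i`. -/
def critPoly (μ : Fin ν → ℕ) (p : (Fin ν → ℂ) × ℂ) : ℂ[X] :=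
  C p.2 * ∏ i, (X - C (p.1 i)) ^ μ i

/-- The polynomial with constant term `A` and derivative `critPoly μ p`. -/
def critFamily (d : ℕ) (μ : Fin ν → ℕ) (A : ℂ) (p : (Fin ν → ℂ) × ℂ) : ℂ[X] :=
  C A + primitive d (critPoly μ p)

theorem natDegree_critPoly_le (μ : Fin ν → ℕ) (p : (Fin ν → ℂ) × ℂ) :
    (critPoly μ p).natDegree ≤ ∑ i, μ i := by
  refine (natDegree_C_mul_le _ _).trans ?_
  rw [natDegree_prod_of_monic _ _ fun i _ => (monic_X_sub_C _).pow _]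
  exact (Finset.sum_congr rfl fun i _ => by
    simp [(monic_X_sub_C (p.1 i)).natDegree_pow]).le

theorem derivative_critFamily {d : ℕ} (hd : 1 ≤ d) {μ : Fin ν → ℕ} (hμd : ∑ i, μ i = d - 1)
    (A : ℂ) (p : (Fin ν → ℂ) × ℂ) : (critFamily d μ A p).derivative = critPoly μ p := by
  rw [critFamily, derivative_add, derivative_C, zero_add, derivative_primitive]
  have := natDegree_critPoly_le μ p
  omega

theorem eval_zero_critFamily (d : ℕ) (μ : Fin ν → ℕ) (A : ℂ) (p : (Fin ν → ℂ) × ℂ) :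
    (critFamily d μ A p).eval 0 = A := by
  simp [critFamily, eval_zero_primitive]

theorem contDiff_coeff_critPoly (μ : Fin ν → ℕ) (k : ℕ) :
    ContDiff ℂ 1 fun p => (critPoly μ p).coeff k := by
  unfold critPoly
  refine contDiff_coeff_mul (contDiff_coeff_C contDiff_snd) (contDiff_coeff_prod _ fun i =>
    contDiff_coeff_pow (contDiff_coeff_X_sub_C ?_) _) k
  fun_prop

theorem eval_critFamily (d : ℕ) (μ : Fin ν → ℕ) (A : ℂ) (p : (Fin ν → ℂ) × ℂ) (z : ℂ) :
    (critFamily d μ A p).eval z =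
      A + ∑ k ∈ Finset.range d, (critPoly μ p).coeff k / (k + 1) * z ^ (k + 1) := by
  simp [critFamily, eval_primitive]

theorem contDiff_coeff_critFamily (d : ℕ) (μ : Fin ν → ℕ) (A : ℂ) (k : ℕ) :
    ContDiff ℂ 1 fun p => (critFamily d μ A p).coeff k := by
  simp only [critFamily, primitive, coeff_add, finsetSum_coeff, coeff_monomial]
  refine contDiff_const.add (ContDiff.sum fun i _ => ?_)
  split_ifs
  · exact (contDiff_coeff_critPoly μ i).div_const _
  · exact contDiff_const

theorem contDiff_eval_critFamily (d : ℕ) (μ : Fin ν → ℕ) (A : ℂ) {z : (Fin ν → ℂ) × ℂ → ℂ}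
    (hz : ContDiff ℂ 1 z) : ContDiff ℂ 1 fun p => (critFamily d μ A p).eval (z p) := by
  simp only [eval_critFamily]
  exact contDiff_const.add (ContDiff.sum fun i _ =>
    ((contDiff_coeff_critPoly μ i).div_const _).mul (hz.pow _))

/-- The critical values of `critFamily`, together with its value at `1`. -/
def critMap (d : ℕ) (μ : Fin ν → ℕ) (A : ℂ) (p : (Fin ν → ℂ) × ℂ) : (Fin ν → ℂ) × ℂ :=
  (fun i => (critFamily d μ A p).eval (p.1 i), (critFamily d μ A p).eval 1)

theorem contDiff_critMap (d : ℕ) (μ : Fin ν → ℕ) (A : ℂ) : ContDiff ℂ 1 (critMap d μ A) := by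
  refine ContDiff.prodMk (contDiff_pi.2 fun i => ?_) ?_
  · exact contDiff_eval_critFamily d μ A (by fun_prop)
  · exact contDiff_eval_critFamily d μ A contDiff_const

/-- The variation of `critPoly μ (b, l)` in the direction `(β, m)`. -/
def critVariation (μ : Fin ν → ℕ) (b : Fin ν → ℂ) (l : ℂ) (β : Fin ν → ℂ) (m : ℂ) : ℂ[X] :=
  (∏ j, (X - C (b j)) ^ (μ j - 1)) *
    (C m * ∏ j, (X - C (b j)) -
      C l * ∑ i, C (μ i * β i) * ∏ j ∈ Finset.univ.erase i, (X - C (b j)))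

/-- Differentiating one factor lowers its exponent by one, so all terms share the product of the `(X
- C (b j)) ^ (μ j - 1)`. Pulling it out shows that the variation vanishes to order `μ j - 1` at `b
j`. -/
theorem hasCoeffDeriv_critPoly {μ : Fin ν → ℕ} (hμ : ∀ i, 1 ≤ μ i) (b : Fin ν → ℂ) (l : ℂ)
    (β : Fin ν → ℂ) (m : ℂ) :
    HasCoeffDeriv (fun t => critPoly μ (b + t • β, l + t * m)) (critVariation μ b l β m) := by
  have h := (hasCoeffDeriv_C l m).mul (HasCoeffDeriv.prod Finset.univ fun i =>
    (hasCoeffDeriv_X_sub_C (b i) (β i)).pow (μ i))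
  convert! h using 1
  simp only [zero_mul, add_zero, critVariation, mul_sub]
  have hpow : ∀ i, (X - C (b i) : ℂ[X]) ^ μ i = (X - C (b i)) ^ (μ i - 1) * (X - C (b i)) := by
    intro i
    rw [← pow_succ, Nat.sub_add_cancel (hμ i)]
  rw [sub_eq_add_neg]
  congr 1
  · simp only [hpow, Finset.prod_mul_distrib]
    ring
  · rw [Finset.mul_sum, Finset.mul_sum, Finset.mul_sum, ← Finset.sum_neg_distrib]
    refine Finset.sum_congr rfl fun i _ => ?_
    rw [← Finset.mul_prod_erase Finset.univ (fun j => (X - C (b j) : ℂ[X]) ^ (μ j - 1))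
      (Finset.mem_univ i)]
    simp only [hpow, Finset.prod_mul_distrib]
    simp only [C_mul, map_natCast]
    ring

/-- Once the common factor is cancelled, evaluation at `b i` kills every term except the one with `β
i`. When all `β i` vanish, only the term with `m` is left. -/
theorem critVariation_eq_zero {μ : Fin ν → ℕ} (hμ : ∀ i, 1 ≤ μ i) {b : Fin ν → ℂ} {l : ℂ}
    (hb : Function.Injective b) (hl : l ≠ 0) {β : Fin ν → ℂ} {m : ℂ}
    (h : critVariation μ b l β m = 0) : β = 0 ∧ m = 0 := by
  have hT : (∏ j, (X - C (b j)) ^ (μ j - 1) : ℂ[X]) ≠ 0 :=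
    Finset.prod_ne_zero_iff.2 fun j _ => pow_ne_zero _ (X_sub_C_ne_zero _)
  have h2 := (mul_eq_zero.1 h).resolve_left hT
  have hβ : ∀ i, β i = 0 := by
    intro i
    have h3 := congrArg (eval (b i)) h2
    simp only [eval_sub, eval_mul, eval_C, eval_prod, eval_X, eval_finsetSum, eval_zero] at h3
    rw [Finset.prod_eq_zero (Finset.mem_univ i) (sub_self _), Finset.sum_eq_single i] at h3
    · have h4 : ∏ j ∈ Finset.univ.erase i, (b i - b j) ≠ 0 :=
        Finset.prod_ne_zero_iff.2 fun j hj =>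
          sub_ne_zero.2 fun e => (Finset.ne_of_mem_erase hj) (hb e).symm
      have h5 : (μ i : ℂ) ≠ 0 := by exact_mod_cast (by have := hμ i; omega : μ i ≠ 0)
      simpa [hl, h4, h5] using h3
    · intro j _ hj
      rw [Finset.prod_eq_zero (i := i) (by simp [hj.symm]) (sub_self _), mul_zero]
    · simp
  refine ⟨funext hβ, ?_⟩
  have h3 : C m * ∏ j, (X - C (b j)) = (0 : ℂ[X]) := by simpa [hβ] using h2
  have h4 : (∏ j, (X - C (b j)) : ℂ[X]) ≠ 0 :=
    Finset.prod_ne_zero_iff.2 fun j _ => X_sub_C_ne_zero _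
  simpa using (mul_eq_zero.1 h3).resolve_right h4

/-- A polynomial of degree at most `d` that vanishes at `0`, at `1` and at the `b i`, and whose
derivative vanishes at `b i` to order `μ i - 1`, is zero. -/
theorem eq_zero_of_vanishing {d : ℕ} {μ : Fin ν → ℕ} (hμ : ∀ i, 1 ≤ μ i)
    (hd : 1 ≤ d) (hμd : ∑ i, μ i = d - 1) {b : Fin ν → ℂ} (hb : Function.Injective b)
    (hb0 : ∀ i, b i ≠ 0) (hb1 : ∀ i, b i ≠ 1) {S : ℂ[X]} (hdeg : S.natDegree ≤ d)
    (h0 : S.eval 0 = 0) (h1 : S.eval 1 = 0) (hS : ∀ i, S.eval (b i) = 0)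
    (hS' : ∀ i, (X - C (b i)) ^ (μ i - 1) ∣ S.derivative) : S = 0 := by
  by_contra hne
  -- Since `S` itself vanishes at `b i`, its order there is one more than that of its derivative.
  have hdvd : (∏ i, (X - C (b i)) ^ μ i : ℂ[X]) ∣ S := by
    refine Finset.prod_dvd_of_coprime ?_ fun i _ => ?_
    · intro i _ j _ hij
      exact (pairwise_coprime_X_sub_C hb hij).pow
    · have hS'0 : S.derivative ≠ 0 := by
        intro h
        refine hne (eq_of_derivative_eq (q := 0) (by simp [h]) (by simp [h0]))
      have h2 : μ i - 1 ≤ S.derivative.rootMultiplicity (b i) :=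
        (le_rootMultiplicity_iff hS'0).2 (hS' i)
      rw [derivative_rootMultiplicity_of_root (hS i)] at h2
      have h3 : 0 < S.rootMultiplicity (b i) := (rootMultiplicity_pos hne).2 (hS i)
      exact (le_rootMultiplicity_iff hne).1 (by have := hμ i; omega)
  obtain ⟨R, rfl⟩ := hdvd
  have hmon : (∏ i, (X - C (b i)) ^ μ i : ℂ[X]).Monic :=
    monic_prod_of_monic _ _ fun i _ => (monic_X_sub_C _).pow _
  have hdeg' : (∏ i, (X - C (b i)) ^ μ i : ℂ[X]).natDegree = d - 1 := by
    rw [natDegree_prod_of_monic _ _ fun i _ => (monic_X_sub_C _).pow _, ← hμd]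
    exact Finset.sum_congr rfl fun i _ => by simp [(monic_X_sub_C (b i)).natDegree_pow]
  have hR0 : R ≠ 0 := right_ne_zero_of_mul hne
  rw [hmon.natDegree_mul' hR0, hdeg'] at hdeg
  have key : ∀ z : ℂ, (∀ i, b i ≠ z) →
      ((∏ i, (X - C (b i)) ^ μ i : ℂ[X]) * R).eval z = 0 → R.eval z = 0 := by
    intro z hz h
    rw [eval_mul] at h
    refine (mul_eq_zero.1 h).resolve_left ?_
    rw [eval_prod]
    refine Finset.prod_ne_zero_iff.2 fun i _ => ?_
    simpa using fun h : z - b i = 0 => absurd (sub_eq_zero.1 h).symm (hz i)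
  -- The divisor has degree d - 1, so the quotient has degree at most 1, yet it vanishes at both 0
  -- and 1.
  refine hR0 (eq_zero_of_natDegree_lt_card_of_eval_eq_zero' R {0, 1} ?_ ?_)
  · intro z hz
    rcases Finset.mem_insert.1 hz with rfl | hz
    · exact key 0 hb0 h0
    · rw [Finset.mem_singleton.1 hz]; exact key 1 hb1 h1
  · rw [Finset.card_pair zero_ne_one]; omega

/-- The two terms come from varying the polynomial and from moving the point. At a moving critical
point the second one vanishes. -/
theorem hasDerivAt_eval_critFamily {μ : Fin ν → ℕ} (hμ : ∀ i, 1 ≤ μ i) (d : ℕ) (A : ℂ)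
    (b : Fin ν → ℂ) (l : ℂ) (β : Fin ν → ℂ) (m : ℂ) {z : ℂ → ℂ} {z' : ℂ}
    (hz : HasDerivAt z z' 0) :
    HasDerivAt (fun t => (critFamily d μ A (b + t • β, l + t * m)).eval (z t))
      ((primitive d (critVariation μ b l β m)).eval (z 0) +
        (primitive d (critPoly μ (b, l))).derivative.eval (z 0) * z') 0 := by
  simp only [eval_critFamily]
  have h : ∀ k ∈ Finset.range d, HasDerivAt
      (fun t => (critPoly μ (b + t • β, l + t * m)).coeff k / (k + 1) * z t ^ (k + 1))
      ((critVariation μ b l β m).coeff k / (k + 1) * z 0 ^ (k + 1) +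
        (critPoly μ (b, l)).coeff k / (k + 1) * ((k + 1) * z 0 ^ k * z')) 0 := by
    intro k _
    have h1 := (hasCoeffDeriv_critPoly hμ b l β m k).div_const ((k : ℂ) + 1)
    have h2 := h1.fun_mul (hz.fun_pow (k + 1))
    simpa using h2
  convert! (HasDerivAt.fun_sum h).const_add A using 1
  rw [Finset.sum_add_distrib, eval_primitive]
  congr 1
  rw [primitive, derivative_sum, eval_finsetSum, Finset.sum_mul]
  refine Finset.sum_congr rfl fun k _ => ?_
  rw [derivative_monomial, eval_monomial]
  simp
  ring

/-- For a kernel vector, the primitive of the variation vanishes at 0, at 1 and at all `b i`, and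
its derivative vanishes to order `μ i - 1` at `b i`. By `eq_zero_of_vanishing` it is zero, so the
variation is zero and with it the vector. -/
theorem fderiv_critMap_injective {d : ℕ} {μ : Fin ν → ℕ} (hμ : ∀ i, 1 ≤ μ i)
    (hd : 1 ≤ d) (hμd : ∑ i, μ i = d - 1) (A : ℂ) {b : Fin ν → ℂ} (hb : Function.Injective b)
    (hb0 : ∀ i, b i ≠ 0) (hb1 : ∀ i, b i ≠ 1) {l : ℂ} (hl : l ≠ 0) :
    Function.Injective (fderiv ℂ (critMap d μ A) (b, l)) := by
  rw [injective_iff_map_eq_zero]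
  rintro ⟨β, m⟩ h
  have hdiff : HasFDerivAt (critMap d μ A) (fderiv ℂ (critMap d μ A) (b, l)) (b, l) :=
    ((contDiff_critMap d μ A).differentiable one_ne_zero _).hasFDerivAt
  have hcurve : HasDerivAt (fun t : ℂ => ((b + t • β, l + t * m) : (Fin ν → ℂ) × ℂ)) (β, m) 0 := by
    refine HasDerivAt.prodMk ?_ ?_
    · simpa using ((hasDerivAt_id (0 : ℂ)).smul_const β).const_add b
    · simpa using ((hasDerivAt_id (0 : ℂ)).mul_const m).const_add l
  have hcomp : HasDerivAt (fun t : ℂ => critMap d μ A (b + t • β, l + t * m)) 0 0 := by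
    have h1 := HasFDerivAt.comp_hasDerivAt (x := (0 : ℂ))
      (f := fun t : ℂ => ((b + t • β, l + t * m) : (Fin ν → ℂ) × ℂ)) (f' := (β, m))
      (l := critMap d μ A) (l' := fderiv ℂ (critMap d μ A) (b, l))
      (by simpa using hdiff) hcurve
    rw [h] at h1
    exact h1
  -- The coefficients of index at least `d` vanish identically along the curve, so their derivatives
  -- vanish.
  have hq : (critVariation μ b l β m).natDegree < d := by
    have : ∀ k, d ≤ k → (critVariation μ b l β m).coeff k = 0 := by
      intro k hk
      refine (hasCoeffDeriv_critPoly hμ b l β m k).unique ?_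
      have : ∀ t : ℂ, (critPoly μ (b + t • β, l + t * m)).coeff k = 0 := fun t =>
        coeff_eq_zero_of_natDegree_lt
          ((natDegree_critPoly_le μ _).trans_lt (by omega))
      simp only [this]
      exact hasDerivAt_const _ _
    by_contra hcon
    rw [not_lt] at hcon
    have h0 := this _ hcon
    rw [coeff_natDegree, leadingCoeff_eq_zero] at h0
    rw [h0, natDegree_zero] at hcon
    omega
  have hP' := derivative_critFamily hd hμd A (b, l)
  rw [critFamily, derivative_add, derivative_C, zero_add] at hP'
  have h1 : (primitive d (critVariation μ b l β m)).eval 1 = 0 := by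
    have e1 := hasDerivAt_eval_critFamily hμ d A b l β m (hasDerivAt_const (0 : ℂ) (1 : ℂ))
    have e2 : HasDerivAt (fun t : ℂ => (critMap d μ A (b + t • β, l + t * m)).2) 0 0 :=
      (ContinuousLinearMap.snd ℂ (Fin ν → ℂ) ℂ).hasFDerivAt.comp_hasDerivAt (0 : ℂ) hcomp
    simpa using e1.unique e2
  have hbi : ∀ i, (primitive d (critVariation μ b l β m)).eval (b i) = 0 := by
    intro i
    have e1 := hasDerivAt_eval_critFamily hμ d A b l β m
      (z := fun t => b i + t * β i) (z' := β i)
      (by simpa using ((hasDerivAt_id (0 : ℂ)).mul_const (β i)).const_add (b i))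
    have e2 : HasDerivAt (fun t : ℂ => (critMap d μ A (b + t • β, l + t * m)).1 i) 0 0 := by
      exact (hasDerivAt_pi.1 ((ContinuousLinearMap.fst ℂ (Fin ν → ℂ) ℂ).hasFDerivAt.comp_hasDerivAt
        (0 : ℂ) hcomp)) i
    have e3 := e1.unique e2
    rw [hP'] at e3
    have e4 : (critPoly μ (b, l)).eval (b i) = 0 := by
      rw [critPoly, eval_mul, eval_prod, Finset.prod_eq_zero (Finset.mem_univ i), mul_zero]
      have := hμ i
      simp
      omega
    simpa [e4] using e3
  have hzero := eq_zero_of_vanishing hμ hd hμd hb hb0 hb1 (natDegree_primitive_le d _)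
    (eval_zero_primitive _ _) h1 hbi fun i => by
      rw [derivative_primitive hq]
      exact (Finset.dvd_prod_of_mem _ (Finset.mem_univ i)).mul_right _
  have hv : critVariation μ b l β m = 0 := by
    rw [← derivative_primitive hq, hzero, derivative_zero]
  obtain ⟨rfl, rfl⟩ := critVariation_eq_zero hμ hb hl hv
  rfl

end Chart

/-! ### Convergence of critical points and the local inverse of the critical value map -/

section Chart

variable {ν : ℕ}

theorem rootMultiplicity_C_mul_prod {K : Type*} [Field K] (μ : Fin ν → ℕ) {b : Fin ν → K} {l : K}
    (hb : Function.Injective b) (hl : l ≠ 0) (i : Fin ν) :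
    (C l * ∏ j, (X - C (b j)) ^ μ j).rootMultiplicity (b i) = μ i := by
  have hne : ∀ j, (X - C (b j)) ^ μ j ≠ 0 := fun j => pow_ne_zero _ (X_sub_C_ne_zero _)
  have h1 : ∏ j ∈ Finset.univ.erase i, (X - C (b j)) ^ μ j ≠ 0 :=
    Finset.prod_ne_zero_iff.2 fun j _ => hne j
  have hC : (C l : K[X]) ≠ 0 := C_ne_zero.2 hl
  rw [← Finset.mul_prod_erase _ _ (Finset.mem_univ i), rootMultiplicity_mul
    (mul_ne_zero hC (mul_ne_zero (hne i) h1)), rootMultiplicity_mul (mul_ne_zero (hne i) h1),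
    rootMultiplicity_X_sub_C_pow, rootMultiplicity_C, rootMultiplicity_eq_zero, zero_add, add_zero]
  rw [IsRoot, eval_prod]
  refine Finset.prod_ne_zero_iff.2 fun j hj => ?_
  rw [eval_pow, eval_sub, eval_X, eval_C]
  exact pow_ne_zero _ (sub_ne_zero.2 fun e => (Finset.ne_of_mem_erase hj) (hb e).symm)

theorem hasCriticalData_critFamily {d : ℕ} (hd : 2 ≤ d) {μ : Fin ν → ℕ}
    (hμd : ∑ i, μ i = d - 1) (A : ℂ) {b : Fin ν → ℂ} {l : ℂ} (hb : Function.Injective b)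
    (hl : l ≠ 0) : HasCriticalData d μ (critFamily d μ A (b, l)) b := by
  have hder := derivative_critFamily (by omega) hμd A (b, l)
  refine ⟨?_, hb, fun i => ?_⟩
  · have h1 : (critFamily d μ A (b, l)).derivative.natDegree = d - 1 := by
      rw [hder, critPoly, natDegree_C_mul hl,
        natDegree_prod_of_monic _ _ fun i _ => (monic_X_sub_C _).pow _, ← hμd]
      exact Finset.sum_congr rfl fun i _ => by simp [(monic_X_sub_C (b i)).natDegree_pow]
    rw [natDegree_derivative] at h1
    omega
  · rw [hder, critPoly]
    exact rootMultiplicity_C_mul_prod μ hb hl i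

theorem IsFamilyMember.eq_critFamily {d : ℕ} (hd : 2 ≤ d) {μ : Fin ν → ℕ}
    (hμd : ∑ i, μ i = d - 1) {P₀ : ℝ[X]} {Q : ℂ[X]} {b : Fin ν → ℂ}
    (h : IsFamilyMember d μ P₀ Q b) :
    Q = critFamily d μ ((P₀.eval 0 : ℝ) : ℂ) (b, d * Q.coeff d) := by
  refine eq_of_derivative_eq ?_ ?_
  · rw [derivative_critFamily (by omega) hμd, h.critical.derivative_eq (by omega) hμd, critPoly]
  · rw [eval_zero_critFamily, h.eval_zero]

/-- Convergence of the coefficients of polynomials of bounded degree implies convergence of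
their values. -/
theorem tendsto_eval_of_coeff {ι : Type*} {l : Filter ι} {Q : ι → ℂ[X]} {P : ℂ[X]} {d : ℕ}
    (hQ : ∀ᶠ n in l, (Q n).natDegree ≤ d) (hP : P.natDegree ≤ d)
    (h : ∀ k, Tendsto (fun n => (Q n).coeff k) l (𝓝 (P.coeff k))) {z : ι → ℂ} {z₀ : ℂ}
    (hz : Tendsto z l (𝓝 z₀)) : Tendsto (fun n => (Q n).eval (z n)) l (𝓝 (P.eval z₀)) := by
  have e : ∀ᶠ n in l, ∑ k ∈ Finset.range (d + 1), (Q n).coeff k * z n ^ k = (Q n).eval (z n) := by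
    filter_upwards [hQ] with n hn using (eval_eq_sum_range' (Nat.lt_succ_of_le hn) _).symm
  rw [eval_eq_sum_range' (Nat.lt_succ_of_le hP)]
  exact (tendsto_finsetSum _ fun k _ => (h k).mul (hz.pow k)).congr' e

/-- If polynomials with critical data converge, then so do, after passing to a subsequence and
permuting them, the critical points. -/
theorem exists_perm_tendsto_critical {d : ℕ} (hd : 2 ≤ d) {μ : Fin ν → ℕ} (hμ : ∀ i, 1 ≤ μ i)
    (hμd : ∑ i, μ i = d - 1) {P : ℂ[X]} {c : Fin ν → ℂ} (hP : HasCriticalData d μ P c)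
    {Q : ℕ → ℂ[X]} {b : ℕ → Fin ν → ℂ} (hQ : ∀ n, HasCriticalData d μ (Q n) (b n))
    (h : ∀ k, Tendsto (fun n => (Q n).coeff k) atTop (𝓝 (P.coeff k))) :
    ∃ (l : Filter ℕ) (_ : l.NeBot) (_ : l ≤ atTop) (σ : Equiv.Perm (Fin ν)),
      (∀ i, μ (σ i) = μ i) ∧ ∀ i, Tendsto (fun n => b n (σ i)) l (𝓝 (c i)) := by
  have hd1 : 1 ≤ d := by omega
  have hL : ∀ {l : Filter ℕ}, l ≤ atTop →
      Tendsto (fun n => (d : ℂ) * (Q n).coeff d) l (𝓝 (d * P.coeff d)) := fun hl =>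
    ((h d).mono_left hl).const_mul _
  have hL0 : (d : ℂ) * P.coeff d ≠ 0 :=
    mul_ne_zero (by exact_mod_cast (by omega : d ≠ 0)) (hP.coeff_ne_zero hd1)
  have hν : 0 < ν := by
    rcases Nat.eq_zero_or_pos ν with rfl | h
    · simp at hμd; omega
    · exact h
  have hev : ∀ {l : Filter ℕ}, l ≤ atTop → ∀ z,
      Tendsto (fun n => (Q n).derivative.eval z) l (𝓝 (P.derivative.eval z)) := by
    intro l hl z
    refine tendsto_eval_of_coeff (d := d) (Eventually.of_forall fun n => ?_) ?_ (fun k => ?_) tendsto_const_nhds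
    · exact (natDegree_derivative_le _).trans (by rw [(hQ n).natDegree_eq]; omega)
    · exact (natDegree_derivative_le _).trans (by rw [hP.natDegree_eq]; omega)
    · simp only [coeff_derivative]
      exact ((h _).mono_left hl).mul_const _
  have hQ' : ∀ n z, (Q n).derivative.eval z =
      d * (Q n).coeff d * ∏ j, (z - b n j) ^ μ j := by
    intro n z
    rw [(hQ n).derivative_eq hd1 hμd, eval_mul, eval_C, eval_prod]
    simp
  have hP' : ∀ z, P.derivative.eval z = d * P.coeff d * ∏ j, (z - c j) ^ μ j := by
    intro z
    rw [hP.derivative_eq hd1 hμd, eval_mul, eval_C, eval_prod]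
    simp
  -- the nearest critical point
  have hmin : ∀ n i, ∃ j, ∀ k, ‖c i - b n j‖ ≤ ‖c i - b n k‖ := by
    intro n i
    obtain ⟨j, _, hj⟩ := Finset.exists_min_image Finset.univ (fun j => ‖c i - b n j‖)
      ⟨⟨0, hν⟩, Finset.mem_univ _⟩
    exact ⟨j, fun k => hj k (Finset.mem_univ k)⟩
  choose s hs using hmin
  have hprod : ∀ i, Tendsto (fun n => ∏ j, (c i - b n j) ^ μ j) atTop (𝓝 0) := by
    intro i
    have h1 := (hev le_rfl (c i)).div (hL le_rfl) hL0
    have h2 : P.derivative.eval (c i) = 0 := by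
      rw [hP', Finset.prod_eq_zero (Finset.mem_univ i), mul_zero]
      have := hμ i
      simp
      omega
    rw [h2, zero_div] at h1
    refine h1.congr' ?_
    filter_upwards [(hL le_rfl).eventually_ne hL0] with n hn
    simp only [Pi.div_apply]
    rw [hQ', mul_div_cancel_left₀ _ hn]
  have hnear : ∀ i, Tendsto (fun n => b n (s n i)) atTop (𝓝 (c i)) := by
    intro i
    -- The smallest distance, raised to the total multiplicity d - 1, is at most the product of all
    -- distances, which tends to zero.
    have h1 : Tendsto (fun n => ‖c i - b n (s n i)‖ ^ (d - 1)) atTop (𝓝 0) := by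
      refine squeeze_zero (fun n => by positivity) (fun n => ?_)
        (tendsto_zero_iff_norm_tendsto_zero.1 (hprod i))
      rw [norm_prod, ← hμd, ← Finset.prod_pow_eq_pow_sum]
      refine Finset.prod_le_prod (fun _ _ => by positivity) fun j _ => ?_
      rw [norm_pow]
      exact pow_le_pow_left₀ (norm_nonneg _) (hs n i j) _
    have h2 : Tendsto (fun n => ‖c i - b n (s n i)‖) atTop (𝓝 0) := by
      rw [Metric.tendsto_atTop] at h1 ⊢
      intro ε hε
      obtain ⟨N, hN⟩ := h1 (ε ^ (d - 1)) (by positivity)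
      refine ⟨N, fun n hn => ?_⟩
      have h3 := hN n hn
      rw [Real.dist_0_eq_abs, abs_of_nonneg (by positivity)] at h3 ⊢
      exact lt_of_pow_lt_pow_left₀ _ hε.le h3
    rw [tendsto_iff_norm_sub_tendsto_zero]
    simpa only [norm_sub_rev] using h2
  -- the choice is constant along a subsequence
  obtain ⟨σ, hσ⟩ : ∃ σ, ∃ᶠ n in atTop, s n = σ := by
    by_contra hcon
    simp only [not_exists, not_frequently] at hcon
    obtain ⟨n, hn⟩ := (eventually_all.2 hcon).exists
    exact hn (s n) rfl
  -- This filter plays the role of a subsequence along which the choice of nearest points is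
  -- constant.
  let l : Filter ℕ := atTop ⊓ 𝓟 {n | s n = σ}
  have hl : l ≤ atTop := inf_le_left
  have : l.NeBot := frequently_mem_iff_neBot.1 hσ
  have hlσ : ∀ᶠ n in l, s n = σ := mem_inf_of_right (mem_principal_self _)
  have hlim : ∀ i, Tendsto (fun n => b n (σ i)) l (𝓝 (c i)) := by
    intro i
    refine ((hnear i).mono_left hl).congr' ?_
    filter_upwards [hlσ] with n hn
    rw [hn]
  have hσi : Function.Injective σ := by
    intro i j hij
    have h1 := hlim j
    rw [← hij] at h1
    exact hP.injective (tendsto_nhds_unique (hlim i) h1)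
  let τ : Equiv.Perm (Fin ν) := Equiv.ofBijective σ (Finite.injective_iff_bijective.1 hσi)
  refine ⟨l, inferInstance, hl, τ, fun i => ?_, hlim⟩
  -- Passing to the limit in the factored derivatives gives a second factorization; comparing
  -- multiplicities shows that the permutation preserves `μ`.
  have hpoly : P.derivative = C (d * P.coeff d) * ∏ j, (X - C (c j)) ^ μ (τ j) := by
    refine Polynomial.funext fun z => ?_
    refine tendsto_nhds_unique (hev hl z) ?_
    rw [eval_mul, eval_C, eval_prod]
    simp only [hQ', eval_pow, eval_sub, eval_X, eval_C]
    refine (hL hl).mul ?_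
    have : ∀ n, ∏ j, (z - b n j) ^ μ j = ∏ j, (z - b n (τ j)) ^ μ (τ j) := fun n =>
      (Equiv.prod_comp τ fun j => (z - b n j) ^ μ j).symm
    simp only [this]
    exact tendsto_finsetProd _ fun j _ => (tendsto_const_nhds.sub (hlim j)).pow _
  rw [← hP.rootMultiplicity_eq i, hpoly,
    rootMultiplicity_C_mul_prod (fun j => μ (τ j)) hP.injective hL0]

theorem HasCriticalData.map {d : ℕ} {μ : Fin ν → ℕ} {P : ℝ[X]} {c : Fin ν → ℝ}
    (h : HasCriticalData d μ P c) :
    HasCriticalData d μ (P.map Complex.ofRealHom) (toComplex c) := by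
  refine ⟨?_, Complex.ofReal_injective.comp h.injective, fun i => ?_⟩
  · rw [natDegree_map, h.natDegree_eq]
  · rw [derivative_map, ← h.rootMultiplicity_eq i]
    exact (eq_rootMultiplicity_map Complex.ofReal_injective _).symm

theorem eval_map_ofReal (P : ℝ[X]) (x : ℝ) :
    (P.map Complex.ofRealHom).eval (x : ℂ) = ((P.eval x : ℝ) : ℂ) := by
  rw [eval_map]
  exact eval₂_hom Complex.ofRealHom x

theorem IsFamilyMember.base {d : ℕ} {μ : Fin ν → ℕ} {P : ℝ[X]} {c : Fin ν → ℝ}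
    (h : HasCriticalData d μ P c) :
    IsFamilyMember d μ P (P.map Complex.ofRealHom) (toComplex c) := by
  refine ⟨h.map, ?_, ?_⟩
  · simp
  · simp

theorem IsFamilyMember.perm {d : ℕ} {μ : Fin ν → ℕ} {P : ℝ[X]} {Q : ℂ[X]} {b : Fin ν → ℂ}
    (h : IsFamilyMember d μ P Q b) (σ : Equiv.Perm (Fin ν)) (hσ : ∀ i, μ (σ i) = μ i) :
    IsFamilyMember d μ P Q (b ∘ σ) :=
  ⟨⟨h.critical.natDegree_eq, h.critical.injective.comp σ.injective, fun i => by
    rw [Function.comp_apply, h.critical.rootMultiplicity_eq, hσ]⟩, h.eval_zero, h.eval_one⟩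

/-- The local parametrization of the family by critical values. -/
theorem exists_chart {d : ℕ} (hd : 2 ≤ d) {μ : Fin ν → ℕ} (hμ : ∀ i, 1 ≤ μ i)
    (hμd : ∑ i, μ i = d - 1) {P₀ : ℝ[X]} {c₀ : Fin ν → ℝ} (h₀ : HasCriticalData d μ P₀ c₀)
    (h0 : ∀ i, c₀ i ≠ 0) (h1 : ∀ i, c₀ i ≠ 1) :
    ∃ ε₀ > 0, ∃ (F : (Fin ν → ℂ) → ℂ[X]) (c : (Fin ν → ℂ) → Fin ν → ℂ),
      ∀ ε, 0 < ε → ε ≤ ε₀ → IsCriticalValueChart d μ P₀ c₀ ε F c := by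
  set A : ℂ := ((P₀.eval 0 : ℝ) : ℂ) with hA
  set B : ℂ := ((P₀.eval 1 : ℝ) : ℂ) with hB
  set P : ℂ[X] := P₀.map Complex.ofRealHom with hPdef
  have hP := IsFamilyMember.base h₀
  rw [← hPdef] at hP
  set l₀ : ℂ := d * P.coeff d with hl₀def
  have hl₀ : l₀ ≠ 0 := mul_ne_zero (by exact_mod_cast (by omega : d ≠ 0))
    (hP.critical.coeff_ne_zero (by omega))
  set x₀ : (Fin ν → ℂ) × ℂ := (toComplex c₀, l₀) with hx₀
  have hPx₀ : critFamily d μ A x₀ = P := (hP.eq_critFamily hd hμd).symm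
  have hG₀ : critMap d μ A x₀ = (toComplex (critValues P₀ c₀), B) := by
    rw [critMap, hPx₀]
    refine Prod.ext (funext fun i => ?_) hP.eval_one
    exact eval_map_ofReal P₀ (c₀ i)
  have hinj := fderiv_critMap_injective hμ (by omega : 1 ≤ d) hμd A hP.critical.injective
    (fun i => by simpa [toComplex] using h0 i)
    (fun i => by simpa [toComplex] using fun h => h1 i (by exact_mod_cast h)) hl₀
  -- An injective endomorphism of a finite-dimensional space is an isomorphism.
  let D : ((Fin ν → ℂ) × ℂ) ≃L[ℂ] ((Fin ν → ℂ) × ℂ) :=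
    (LinearEquiv.ofInjectiveEndo (fderiv ℂ (critMap d μ A) x₀ :
      ((Fin ν → ℂ) × ℂ) →ₗ[ℂ] ((Fin ν → ℂ) × ℂ)) hinj).toContinuousLinearEquiv
  have hC : ContDiffAt ℂ 1 (critMap d μ A) x₀ := (contDiff_critMap d μ A).contDiffAt
  have hDf : HasFDerivAt (critMap d μ A) (D : ((Fin ν → ℂ) × ℂ) →L[ℂ] ((Fin ν → ℂ) × ℂ)) x₀ := by
    convert! ((contDiff_critMap d μ A).differentiable one_ne_zero x₀).hasFDerivAt using 1
  let Φ := hC.toOpenPartialHomeomorph (critMap d μ A) hDf one_ne_zero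
  have hΦ : ∀ x, Φ x = critMap d μ A x := fun x => rfl
  have hx₀s : x₀ ∈ Φ.source := hC.mem_toOpenPartialHomeomorph_source hDf one_ne_zero
  have hψ₀ : Φ.symm (toComplex (critValues P₀ c₀), B) = x₀ := by
    rw [← hG₀, ← hΦ, Φ.left_inv hx₀s]
  have ht₀ : (toComplex (critValues P₀ c₀), B) ∈ Φ.target := by
    rw [← hG₀, ← hΦ]; exact Φ.map_source hx₀s
  have hCψ : ContDiffAt ℂ 1 Φ.symm (toComplex (critValues P₀ c₀), B) := by
    refine Φ.contDiffAt_symm (f₀' := D) ht₀ ?_ ?_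
    · rw [hψ₀]; exact hDf
    · rw [hψ₀]; exact hC
  have hgood : ∀ᶠ x in 𝓝 x₀, Function.Injective x.1 ∧ x.2 ≠ 0 := by
    have hi : ∀ i j, i ≠ j → ∀ᶠ x : (Fin ν → ℂ) × ℂ in 𝓝 x₀, x.1 i ≠ x.1 j := by
      intro i j hij
      have hc : Continuous fun x : (Fin ν → ℂ) × ℂ => x.1 i - x.1 j := by fun_prop
      have := hc.continuousAt.eventually_ne (x := x₀) (y := 0)
        (sub_ne_zero.2 (hP.critical.injective.ne hij))
      filter_upwards [this] with x hx
      exact sub_ne_zero.1 hx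
    have hall : ∀ᶠ x : (Fin ν → ℂ) × ℂ in 𝓝 x₀, ∀ i j, i ≠ j → x.1 i ≠ x.1 j :=
      eventually_all.2 fun i => eventually_all.2 fun j => by
        by_cases hij : i = j
        · simp [hij]
        · filter_upwards [hi i j hij] with x hx _ using hx
    filter_upwards [hall, continuous_snd.continuousAt.eventually_ne (x := x₀) (y := 0) hl₀]
      with x hx hx2
    exact ⟨fun i j hij => by by_contra hne; exact hx i j hne hij, hx2⟩
  have hev : ∀ᶠ y in 𝓝 (toComplex (critValues P₀ c₀), B), y ∈ Φ.target ∧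
      DifferentiableAt ℂ Φ.symm y ∧ Function.Injective (Φ.symm y).1 ∧ (Φ.symm y).2 ≠ 0 := by
    have e1 := Φ.open_target.eventually_mem ht₀
    have e2 := hCψ.eventually (by simp)
    have e3 : Tendsto Φ.symm (𝓝 (toComplex (critValues P₀ c₀), B)) (𝓝 x₀) := by
      have := hCψ.continuousAt
      rwa [ContinuousAt, hψ₀] at this
    filter_upwards [e1, e2, e3.eventually hgood] with y h1 h2 h3
    exact ⟨h1, h2.differentiableAt one_ne_zero, h3⟩
  obtain ⟨ε₀, hε₀, hball⟩ := Metric.eventually_nhds_iff_ball.1 hev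
  have hW : ∀ w ∈ polydisk (critValues P₀ c₀) ε₀, (w, B) ∈
      Metric.ball (toComplex (critValues P₀ c₀), B) ε₀ := by
    intro w hw
    rw [← ball_prod_same]
    exact ⟨hw, Metric.mem_ball_self hε₀⟩
  -- Freezing the last coordinate at `B` keeps the value at 1 fixed, and the constant term `A` fixes
  -- the value at 0.
  refine ⟨ε₀, hε₀, fun w => critFamily d μ A (Φ.symm (w, B)), fun w => (Φ.symm (w, B)).1,
    fun ε hε hle => ?_⟩
  have hsub : polydisk (critValues P₀ c₀) ε ⊆ polydisk (critValues P₀ c₀) ε₀ :=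
    Metric.ball_subset_ball hle
  have hinv : ∀ w ∈ polydisk (critValues P₀ c₀) ε, critMap d μ A (Φ.symm (w, B)) = (w, B) :=
    fun w hw => Φ.right_inv (hball _ (hW w (hsub hw))).1
  have hdψ : ∀ w ∈ polydisk (critValues P₀ c₀) ε,
      DifferentiableAt ℂ (fun w => Φ.symm (w, B)) w := by
    intro w hw
    have h2 := (hball _ (hW w (hsub hw))).2.1
    exact h2.comp w (differentiableAt_id.prodMk (differentiableAt_const B))
  refine ⟨?_, ?_, fun w hw => ⟨?_, ?_, ?_⟩, fun w hw i => ?_, fun k w hw => ?_, fun i w hw => ?_, ?_⟩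
  · simp only [hψ₀, hPx₀, hPdef]
  · simp only [hψ₀, hx₀]
  · exact hasCriticalData_critFamily hd hμd A (hball _ (hW w (hsub hw))).2.2.1
      (hball _ (hW w (hsub hw))).2.2.2
  · exact eval_zero_critFamily _ _ _ _
  · exact congrArg Prod.snd (hinv w hw)
  · exact congrFun (congrArg Prod.fst (hinv w hw)) i
  · exact (((contDiff_coeff_critFamily d μ A k).differentiable one_ne_zero _).comp w
      (hdψ w hw)).differentiableWithinAt
  · exact (differentiableAt_pi.1 (hdψ w hw).fst i).differentiableWithinAt
  -- Otherwise there are members of the family converging to `P₀` outside the image. After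
  -- relabelling, their critical points converge to those of `P₀`, so their data eventually lie
  -- where the critical value map is inverted, which puts them in the image.
  · by_contra hcon
    push Not at hcon
    choose Q b hQb hQc hQn using fun n : ℕ => hcon (1 / ((n : ℝ) + 1)) (by positivity)
    have hcoef : ∀ k, Tendsto (fun n => (Q n).coeff k) atTop (𝓝 (P.coeff k)) := by
      intro k
      rw [tendsto_iff_norm_sub_tendsto_zero]
      refine squeeze_zero (fun n => norm_nonneg _) (fun n => ?_)
        tendsto_one_div_add_atTop_nhds_zero_nat
      have := (hQc n k).le
      rwa [hPdef, coeff_map]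
    obtain ⟨l, hl, hlt, σ, hσ, hlim⟩ := exists_perm_tendsto_critical hd hμ hμd hP.critical
      (fun n => (hQb n).critical) hcoef
    have hmem := fun n => (hQb n).perm σ hσ
    have hx : Tendsto (fun n => ((b n ∘ σ, (d : ℂ) * (Q n).coeff d) : (Fin ν → ℂ) × ℂ)) l
        (𝓝 x₀) := by
      refine Tendsto.prodMk_nhds (tendsto_pi_nhds.2 hlim) ?_
      exact ((hcoef d).mono_left hlt).const_mul _
    have hy : Tendsto (fun n => critMap d μ A (b n ∘ σ, (d : ℂ) * (Q n).coeff d)) l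
        (𝓝 (toComplex (critValues P₀ c₀), B)) := by
      rw [← hG₀]
      exact ((contDiff_critMap d μ A).continuous.tendsto x₀).comp hx
    have hy1 := (continuous_fst.tendsto _).comp hy
    have ev1 := hx.eventually (Φ.open_source.eventually_mem hx₀s)
    have ev2 := hy1.eventually (Metric.isOpen_ball.eventually_mem (Metric.mem_ball_self hε))
    obtain ⟨n, hn1, hn2⟩ := (ev1.and ev2).exists
    have hQeq := (hmem n).eq_critFamily hd hμd
    refine hQn n ⟨(critMap d μ A (b n ∘ σ, (d : ℂ) * (Q n).coeff d)).1, hn2, ?_⟩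
    have hval : ((critMap d μ A (b n ∘ σ, (d : ℂ) * (Q n).coeff d)).1, B) =
        Φ (b n ∘ σ, (d : ℂ) * (Q n).coeff d) := by
      rw [hΦ]
      refine Prod.ext rfl ?_
      simp only [critMap]
      rw [← hQeq, (hQb n).eval_one]
    simp only [hval, Φ.left_inv hn1]
    exact hQeq.symm

end Chart

/-! ### Expansion of cross ratios by polynomials with real critical points -/

section CrossRatio

variable {ν : ℕ} {μ : Fin ν → ℕ} {P : ℝ[X]} {c : Fin ν → ℝ} {l α β : ℝ}

/-- In the product of the derivatives at m - r and m + r, each critical point contributes a power of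
(m - c i)² - r². This is positive, as c i lies outside the interval, and decreases as r grows. -/
theorem derivative_mul_lt (hμ : ∀ i, 1 ≤ μ i) (hν : 0 < ν)
    (hP : P.derivative = C l * ∏ i, (X - C (c i)) ^ μ i) (hl : l ≠ 0)
    (hc : ∀ i, c i ∉ Ioo α β) {m s S : ℝ} (hs : 0 ≤ s) (hsS : s < S) (h1 : α < m - S)
    (h2 : m + S < β) :
    P.derivative.eval (m - S) * P.derivative.eval (m + S) <
      P.derivative.eval (m - s) * P.derivative.eval (m + s) := by
  have e : ∀ r, P.derivative.eval (m - r) * P.derivative.eval (m + r) =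
      l ^ 2 * ∏ i, ((m - c i) ^ 2 - r ^ 2) ^ μ i := by
    intro r
    rw [hP]
    simp only [eval_mul, eval_C, eval_prod, eval_pow, eval_sub, eval_X]
    rw [mul_mul_mul_comm, ← Finset.prod_mul_distrib, ← sq]
    congr 1
    refine Finset.prod_congr rfl fun i _ => ?_
    rw [← mul_pow]
    congr 1
    ring
  have hpos : ∀ i, 0 < (m - c i) ^ 2 - S ^ 2 := by
    intro i
    have := hc i
    rw [mem_Ioo, not_and_or, not_lt, not_lt] at this
    rcases this with h | h
    · nlinarith
    · nlinarith
  rw [e, e]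
  refine mul_lt_mul_of_pos_left ?_ (by positivity)
  refine Finset.prod_lt_prod_of_nonempty (fun i _ => pow_pos (hpos i) _) (fun i _ => ?_)
    ⟨⟨0, hν⟩, Finset.mem_univ _⟩
  refine pow_lt_pow_left₀ ?_ (hpos i).le (by have := hμ i; omega)
  nlinarith

/-- The geometric mean of the derivatives at the ends is less than the mean slope. By
`derivative_mul_lt` and the inequality between arithmetic and geometric means, the derivatives at
two points m ± s strictly inside sum to more than twice the geometric mean `g` at the ends, and this
is integrated over s. -/
theorem derivative_mul_lt_sq (hμ : ∀ i, 1 ≤ μ i) (hν : 0 < ν)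
    (hP : P.derivative = C l * ∏ i, (X - C (c i)) ^ μ i) (hl : l ≠ 0)
    (hc : ∀ i, c i ∉ Ioo α β) (hpos : ∀ x ∈ Ioo α β, 0 < P.derivative.eval x) {x t : ℝ}
    (hx : α < x) (hxt : x < t) (ht : t < β) :
    P.derivative.eval x * P.derivative.eval t * (t - x) ^ 2 < (P.eval t - P.eval x) ^ 2 := by
  set m := (x + t) / 2 with hm
  set S := (t - x) / 2 with hS
  have hS0 : 0 < S := by rw [hS]; linarith
  have hx' : x = m - S := by rw [hm, hS]; ring
  have ht' : t = m + S := by rw [hm, hS]; ring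
  set g := Real.sqrt (P.derivative.eval x * P.derivative.eval t) with hg
  have hprod : 0 < P.derivative.eval x * P.derivative.eval t :=
    mul_pos (hpos x ⟨hx, by linarith⟩) (hpos t ⟨by linarith, ht⟩)
  have hg0 : 0 < g := Real.sqrt_pos.2 hprod
  have hg2 : g ^ 2 = P.derivative.eval x * P.derivative.eval t := Real.sq_sqrt hprod.le
  let D : ℝ → ℝ := fun s => P.eval (m + s) - P.eval (m - s) - 2 * g * s
  have hD : ∀ s, HasDerivAt D
      (P.derivative.eval (m + s) + P.derivative.eval (m - s) - 2 * g) s := by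
    intro s
    have h1 : HasDerivAt (fun s => P.eval (m + s)) (P.derivative.eval (m + s)) s :=
      HasDerivAt.comp_const_add m s (P.hasDerivAt (m + s))
    have h2 : HasDerivAt (fun s => P.eval (m - s)) (-P.derivative.eval (m - s)) s :=
      HasDerivAt.comp_const_sub m s (P.hasDerivAt (m - s))
    have h3 : HasDerivAt (fun s => 2 * g * s) (2 * g) s := by
      simpa using (hasDerivAt_id s).const_mul (2 * g)
    convert! (h1.sub h2).sub h3 using 1
    ring
  have hmono : StrictMonoOn D (Icc 0 S) := by
    refine strictMonoOn_of_deriv_pos (convex_Icc _ _)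
      (fun s _ => (hD s).continuousAt.continuousWithinAt) fun s hs => ?_
    rw [interior_Icc] at hs
    rw [(hD s).deriv]
    have h1 := derivative_mul_lt hμ hν hP hl hc hs.1.le hs.2 (m := m) (by rw [← hx']; exact hx)
      (by rw [← ht']; exact ht)
    rw [← hx', ← ht', ← hg2] at h1
    have h2 := hpos (m - s) ⟨by linarith [hs.2], by linarith [hs.1]⟩
    have h3 := hpos (m + s) ⟨by linarith [hs.1], by linarith [hs.2]⟩
    nlinarith [sq_nonneg (P.derivative.eval (m - s) - P.derivative.eval (m + s))]
  have h := hmono (left_mem_Icc.2 hS0.le) (right_mem_Icc.2 hS0.le) hS0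
  simp only [D, add_zero, sub_zero, sub_self, mul_zero, ← hx', ← ht'] at h
  have h4 : g * (t - x) < P.eval t - P.eval x := by
    have : 2 * g * S = g * (t - x) := by rw [hS]; ring
    linarith
  rw [← hg2, ← mul_pow]
  exact pow_lt_pow_left₀ h4 (mul_nonneg hg0.le (by linarith)) two_ne_zero

/-- The function P'(x)/(P(t) - P(x)) - 1/(t - x) of t has derivative 1/(t - x)² - P'(x)P'(t)/(P(t) -
P(x))², positive by `derivative_mul_lt_sq`. The claim compares its values at α and β. -/
theorem cross_ratio_lt_of_pos (hμ : ∀ i, 1 ≤ μ i) (hν : 0 < ν)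
    (hP : P.derivative = C l * ∏ i, (X - C (c i)) ^ μ i) (hl : l ≠ 0)
    (hc : ∀ i, c i ∉ Ioo α β) (hpos : ∀ x ∈ Ioo α β, 0 < P.derivative.eval x) {x : ℝ}
    (hx : x ∈ Ioo α β) :
    1 / (x - α) + 1 / (β - x) < P.derivative.eval x *
      (1 / (P.eval x - P.eval α) + 1 / (P.eval β - P.eval x)) := by
  obtain ⟨hαx, hxβ⟩ := hx
  have hmono : StrictMonoOn P.eval (Icc α β) :=
    strictMonoOn_of_deriv_pos (convex_Icc _ _) P.continuous.continuousOn fun y hy => by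
      rw [interior_Icc] at hy
      rw [P.deriv]
      exact hpos y hy
  have hPx := hpos x ⟨hαx, hxβ⟩
  have hxI : x ∈ Icc α β := ⟨hαx.le, hxβ.le⟩
  -- The singularity at t = x is removable. With `k` the difference quotient of `P` at `x`, and `r`
  -- minus that of `k`, the function is `r / k`, which is continuous on the whole interval.
  set k := (P - C (P.eval x)) /ₘ (X - C x) with hk
  have hkmul : (X - C x) * k = P - C (P.eval x) :=
    mul_divByMonic_eq_iff_isRoot.2 (by simp)
  have hkev : ∀ t, (t - x) * k.eval t = P.eval t - P.eval x := fun t => by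
    simpa using congrArg (eval t) hkmul
  have hkx : k.eval x = P.derivative.eval x := by
    have := congrArg (fun q => eval x (derivative q)) hkmul
    simpa using this
  set r := (C (k.eval x) - k) /ₘ (X - C x) with hr
  have hrmul : (X - C x) * r = C (k.eval x) - k :=
    mul_divByMonic_eq_iff_isRoot.2 (by simp)
  have hrev : ∀ t, (t - x) * r.eval t = P.derivative.eval x - k.eval t := fun t => by
    have := congrArg (eval t) hrmul
    simpa [hkx] using this
  have hkpos : ∀ t ∈ Icc α β, 0 < k.eval t := by
    intro t ht
    rcases lt_trichotomy t x with h | h | h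
    · have := hmono ht hxI h
      have h2 := hkev t
      by_contra hn
      nlinarith
    · rw [h, hkx]; exact hPx
    · have := hmono hxI ht h
      have h2 := hkev t
      by_contra hn
      nlinarith
  let φ : ℝ → ℝ := fun t => r.eval t / k.eval t
  have hφ : ∀ t ∈ Icc α β, t ≠ x →
      φ t = P.derivative.eval x / (P.eval t - P.eval x) - 1 / (t - x) := by
    intro t ht htx
    have h1 : t - x ≠ 0 := sub_ne_zero.2 htx
    have h2 := (hkpos t ht).ne'
    rw [← hkev t]
    simp only [φ]
    have h3 := hrev t
    field_simp
    linarith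
  have hcont : ContinuousOn φ (Icc α β) :=
    r.continuous.continuousOn.div k.continuous.continuousOn fun t ht => (hkpos t ht).ne'
  have hderiv : ∀ t ∈ Ioo α β, t ≠ x → 0 < deriv φ t := by
    intro t ht htx
    have h1 : t - x ≠ 0 := sub_ne_zero.2 htx
    have h2 : P.eval t - P.eval x ≠ 0 := by
      rw [← hkev t]
      exact mul_ne_zero h1 (hkpos t (Ioo_subset_Icc_self ht)).ne'
    have heq : φ =ᶠ[𝓝 t] fun t => P.derivative.eval x / (P.eval t - P.eval x) - 1 / (t - x) := by
      filter_upwards [Ioo_mem_nhds ht.1 ht.2, isOpen_ne.eventually_mem htx] with s hs hsx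
      exact hφ s (Ioo_subset_Icc_self hs) hsx
    have hd : HasDerivAt (fun t => P.derivative.eval x / (P.eval t - P.eval x) - 1 / (t - x))
        (-(P.derivative.eval x * P.derivative.eval t) / (P.eval t - P.eval x) ^ 2 +
          1 / (t - x) ^ 2) t := by
      have d1 := (hasDerivAt_const t (P.derivative.eval x)).fun_div
        ((P.hasDerivAt t).sub_const (P.eval x)) h2
      have d2 := (hasDerivAt_const t (1 : ℝ)).fun_div ((hasDerivAt_id t).sub_const x) h1
      convert! d1.fun_sub d2 using 1
      simp
      ring
    rw [heq.deriv_eq, hd.deriv]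
    have key : P.derivative.eval x * P.derivative.eval t * (t - x) ^ 2 <
        (P.eval t - P.eval x) ^ 2 := by
      rcases lt_or_gt_of_ne htx with h | h
      · have := derivative_mul_lt_sq hμ hν hP hl hc hpos ht.1 h hxβ
        nlinarith
      · exact derivative_mul_lt_sq hμ hν hP hl hc hpos hαx h ht.2
    have h3 : 0 < (t - x) ^ 2 := by positivity
    have h4 : 0 < (P.eval t - P.eval x) ^ 2 := by positivity
    rw [neg_div, neg_add_eq_sub, sub_pos, div_lt_div_iff₀ h4 h3]
    linarith
  have m1 : StrictMonoOn φ (Icc α x) :=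
    strictMonoOn_of_deriv_pos (convex_Icc _ _) (hcont.mono (Icc_subset_Icc_right hxβ.le))
      fun t ht => by
        rw [interior_Icc] at ht
        exact hderiv t ⟨ht.1, ht.2.trans hxβ⟩ ht.2.ne
  have m2 : StrictMonoOn φ (Icc x β) :=
    strictMonoOn_of_deriv_pos (convex_Icc _ _) (hcont.mono (Icc_subset_Icc_left hαx.le))
      fun t ht => by
        rw [interior_Icc] at ht
        exact hderiv t ⟨hαx.trans ht.1, ht.2⟩ ht.1.ne'
  have hfin := (m1 (left_mem_Icc.2 hαx.le) (right_mem_Icc.2 hαx.le) hαx).trans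
    (m2 (left_mem_Icc.2 hxβ.le) (right_mem_Icc.2 hxβ.le) hxβ)
  have hαβ := hαx.trans hxβ
  rw [hφ α (left_mem_Icc.2 hαβ.le) hαx.ne, hφ β (right_mem_Icc.2 hαβ.le) hxβ.ne'] at hfin
  have e1 : P.derivative.eval x / (P.eval α - P.eval x) =
      -(P.derivative.eval x * (1 / (P.eval x - P.eval α))) := by
    rw [← neg_sub (P.eval x), div_neg, mul_one_div]
  have e2 : 1 / (α - x) = -(1 / (x - α)) := by rw [← neg_sub x, div_neg]
  rw [e1, e2, ← mul_one_div (P.derivative.eval x) (P.eval β - P.eval x)] at hfin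
  linarith

theorem cross_ratio_lt_of_neg (hμ : ∀ i, 1 ≤ μ i) (hν : 0 < ν)
    (hP : P.derivative = C l * ∏ i, (X - C (c i)) ^ μ i) (hl : l ≠ 0)
    (hc : ∀ i, c i ∉ Ioo α β) (hneg : ∀ x ∈ Ioo α β, P.derivative.eval x < 0) {x : ℝ}
    (hx : x ∈ Ioo α β) :
    1 / (x - α) + 1 / (β - x) < |P.derivative.eval x| *
      (1 / (P.eval α - P.eval x) + 1 / (P.eval x - P.eval β)) := by
  have h := cross_ratio_lt_of_pos (P := -P) (l := -l) hμ hν (by rw [derivative_neg, hP]; simp)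
    (neg_ne_zero.2 hl) hc (fun y hy => by simpa using hneg y hy) hx
  rw [abs_of_neg (hneg x hx)]
  simp only [derivative_neg, eval_neg, neg_sub_neg] at h
  exact h

end CrossRatio

/-! ### Limit sets of orbits attracted to a cycle of period three -/

theorem omegaSet_iterate (f : ℝ → ℝ) (x : ℝ) (i : ℕ) : omegaSet f (f^[i] x) = omegaSet f x := by
  ext q
  simp only [omegaSet, mem_ofPred_eq, MapClusterPt, ← Function.iterate_add_apply]
  conv_rhs => rw [← map_add_atTop_eq_nat i, map_map]
  rfl

theorem omegaSet_eq_cycle {f : ℝ → ℝ} (hf : Continuous f) {x p : ℝ}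
    (h : Tendsto (fun n => f^[3 * n] x) atTop (𝓝 p)) : omegaSet f x = {p, f p, f (f p)} := by
  have h0 : ∀ n, f^[3 * n + 1] x = f (f^[3 * n] x) := fun n => Function.iterate_succ_apply' _ _ _
  have h0' : ∀ n, f^[3 * n + 2] x = f (f (f^[3 * n] x)) := fun n => by
    rw [Function.iterate_succ_apply', h0]
  have h1 : Tendsto (fun n => f^[3 * n + 1] x) atTop (𝓝 (f p)) := by
    simp only [h0]; exact (hf.tendsto p).comp h
  have h2 : Tendsto (fun n => f^[3 * n + 2] x) atTop (𝓝 (f (f p))) := by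
    simp only [h0']; exact ((hf.comp hf).tendsto p).comp h
  have ht : ∀ i : ℕ, Tendsto (fun n : ℕ => 3 * n + i) atTop atTop := fun i =>
    tendsto_atTop_mono (fun n => by simp only [id]; omega) tendsto_id
  apply Subset.antisymm
  · intro q hq
    by_contra hcon
    simp only [mem_insert_iff, mem_singleton_iff, not_or] at hcon
    obtain ⟨hp0, hp1, hp2⟩ := hcon
    obtain ⟨ε, hε, e0, e1, e2⟩ : ∃ ε > 0, ε < dist q p / 2 ∧ ε < dist q (f p) / 2 ∧
        ε < dist q (f (f p)) / 2 := by
      have d0 := dist_pos.2 hp0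
      have d1 := dist_pos.2 hp1
      have d2 := dist_pos.2 hp2
      refine ⟨min (dist q p) (min (dist q (f p)) (dist q (f (f p)))) / 4, by positivity, ?_, ?_, ?_⟩
      · have := min_le_left (dist q p) (min (dist q (f p)) (dist q (f (f p)))); linarith
      · have := (min_le_right (dist q p) (min (dist q (f p)) (dist q (f (f p))))).trans
          (min_le_left _ _); linarith
      · have := (min_le_right (dist q p) (min (dist q (f p)) (dist q (f (f p))))).trans
          (min_le_right _ _); linarith
    have hfr : ∃ᶠ n in atTop, f^[n] x ∈ Metric.ball q ε :=
      (mapClusterPt_iff_frequently.1 hq) _ (Metric.ball_mem_nhds q hε)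
    have hdiv : Tendsto (fun n : ℕ => n / 3) atTop atTop :=
      Nat.tendsto_div_const_atTop (by norm_num)
    have ev0 := hdiv.eventually (h.eventually (Metric.ball_mem_nhds p hε))
    have ev1 := hdiv.eventually (h1.eventually (Metric.ball_mem_nhds _ hε))
    have ev2 := hdiv.eventually (h2.eventually (Metric.ball_mem_nhds _ hε))
    obtain ⟨n, hn, hn0, hn1, hn2⟩ := (hfr.and_eventually (ev0.and (ev1.and ev2))).exists
    have key : ∀ r, ε < dist q r / 2 → f^[n] x ∈ Metric.ball r ε → False := by
      intro r hr hm
      rw [Metric.mem_ball] at hm hn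
      have := dist_triangle_left q r (f^[n] x)
      linarith
    have hmod : n % 3 = 0 ∨ n % 3 = 1 ∨ n % 3 = 2 := by omega
    rcases hmod with hm | hm | hm
    · have e : 3 * (n / 3) = n := by omega
      have hm' : f^[3 * (n / 3)] x ∈ Metric.ball p ε := hn0
      exact key _ e0 (e ▸ hm')
    · have e : 3 * (n / 3) + 1 = n := by omega
      have hm' : f^[3 * (n / 3) + 1] x ∈ Metric.ball (f p) ε := hn1
      exact key _ e1 (e ▸ hm')
    · have e : 3 * (n / 3) + 2 = n := by omega
      have hm' : f^[3 * (n / 3) + 2] x ∈ Metric.ball (f (f p)) ε := hn2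
      exact key _ e2 (e ▸ hm')
  · have key : ∀ (i : ℕ) (r : ℝ), Tendsto (fun n => f^[3 * n + i] x) atTop (𝓝 r) →
        r ∈ omegaSet f x := fun i r hr =>
      MapClusterPt.of_comp (ht i) (u := fun n => f^[n] x) hr.mapClusterPt
    rintro q (rfl | rfl | rfl)
    · exact key 0 _ h
    · exact key 1 _ h1
    · exact key 2 _ h2

theorem mem_omegaSet_self {f : ℝ → ℝ} {q : ℝ} (hq : q ∈ Function.periodicPts f) :
    q ∈ omegaSet f q := by
  obtain ⟨n, hn, hq⟩ := hq
  refine mapClusterPt_iff_frequently.2 fun s hs => ?_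
  rw [frequently_atTop]
  intro N
  refine ⟨n * N, Nat.le_mul_of_pos_left N hn, ?_⟩
  have : f^[n * N] q = q := (hq.mul_const N)
  rw [this]
  exact mem_of_mem_nhds hs

theorem omegaSet_subset {f : ℝ → ℝ} {x : ℝ} {S : Set ℝ} (hS : IsClosed S)
    (h : ∀ n, f^[n] x ∈ S) : omegaSet f x ⊆ S := by
  intro q hq
  by_contra hcon
  obtain ⟨n, hn⟩ := ((mapClusterPt_iff_frequently.1 hq) _ (hS.isOpen_compl.mem_nhds hcon)).exists
  exact hn (h n)

/-- This prevents an iterate from collapsing an open set to a point. -/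
theorem finite_fiber_iterate {f : ℝ → ℝ} (hf : ∀ y, (f ⁻¹' {y}).Finite) (n : ℕ) (y : ℝ) :
    (f^[n] ⁻¹' {y}).Finite := by
  induction n generalizing y with
  | zero => simp
  | succ n ih =>
    rw [Function.iterate_succ', preimage_comp]
    exact (hf y).preimage' fun z _ => ih z

/-! ### Markov maps with a trap around a cycle of period three -/

/-- The numerical data of a trap: neighbourhoods of radii `ra`, `rc`, `rb` of three points
`a < c < b`, to the right of a point `l`, and a coordinate `H` in which a map is to expand by the
factor `κ`. -/
structure Trap where
  (l a c b ra rc rb κ : ℝ)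
  H : ℝ → ℝ

namespace Trap

variable (T : Trap)

/-- The left Markov interval. -/
def left : Set ℝ := Icc (T.a + T.ra) (T.c - T.rc)

/-- The right Markov interval. -/
def right : Set ℝ := Icc (T.c + T.rc) (T.b - T.rb)

/-- The union of the two Markov intervals. -/
def core : Set ℝ := T.left ∪ T.right

/-- The trap itself. -/
def near (x : ℝ) : Prop := |x - T.a| ≤ T.ra ∨ |x - T.c| ≤ T.rc ∨ |x - T.b| ≤ T.rb

/-- The set of points whose orbits stay in the Markov intervals. -/
def invSet (f : ℝ → ℝ) : Set ℝ := {x | ∀ n : ℕ, f^[n] x ∈ T.core}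

/-- The map `f` of `[l, 1]`, with turning point `γ`, permutes the three parts of the trap
cyclically, contracts them, and expands on the Markov intervals. -/
structure IsFor (f : ℝ → ℝ) (γ : ℝ) : Prop where
  ra_pos : 0 < T.ra
  rc_pos : 0 < T.rc
  rb_pos : 0 < T.rb
  l_le : T.l ≤ T.a - T.ra
  le_one : T.b + T.rb ≤ 1
  a_lt_c : T.a + T.ra < T.c - T.rc
  c_lt_b : T.c + T.rc < T.b - T.rb
  cont : Continuous f
  fiber : ∀ y, (f ⁻¹' {y}).Finite
  -- The images have half the radius of the next part, so they keep a definite distance from the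
  -- Markov intervals.
  maps_a : ∀ x, |x - T.a| ≤ T.ra → |f x - T.c| ≤ T.rc / 2
  maps_c : ∀ x, |x - T.c| ≤ T.rc → |f x - T.b| ≤ T.rb / 2
  maps_b : ∀ x, |x - T.b| ≤ T.rb → |f x - T.a| ≤ T.ra / 2
  contr : ∀ x y, |x - T.c| ≤ T.rc → |y - T.c| ≤ T.rc →
    |f (f (f x)) - f (f (f y))| ≤ |x - y| / 2
  near_c : |γ - T.c| ≤ T.rc
  mono : StrictMonoOn f (Icc T.l γ)
  anti : StrictAntiOn f (Icc γ 1)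
  one_lt : 1 < T.κ
  expand : ∀ S ∈ ({T.left, T.right} : Set (Set ℝ)), ∀ S' ∈ ({T.left, T.right} : Set (Set ℝ)),
    ∀ x ∈ S, ∀ y ∈ S, f x ∈ S' → f y ∈ S' →
      T.κ * |T.H x - T.H y| ≤ |T.H (f x) - T.H (f y)|
  bdd : ∃ B, ∀ x ∈ T.core, |T.H x| ≤ B
  inj : ∀ S ∈ ({T.left, T.right} : Set (Set ℝ)), InjOn T.H S

variable {T} {f : ℝ → ℝ} {γ : ℝ}

namespace IsFor

variable (h : T.IsFor f γ)
include h

theorem not_mem_core {x : ℝ}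
    (hx : |x - T.a| ≤ T.ra / 2 ∨ |x - T.c| ≤ T.rc / 2 ∨ |x - T.b| ≤ T.rb / 2) : x ∉ T.core := by
  have := h.ra_pos; have := h.rc_pos; have := h.rb_pos; have := h.a_lt_c; have := h.c_lt_b
  simp only [core, left, right, mem_union, mem_Icc, not_or, not_and_or, not_le]
  simp only [abs_le] at hx
  rcases hx with ⟨h1, h2⟩ | ⟨h1, h2⟩ | ⟨h1, h2⟩
  · exact ⟨Or.inl (by linarith), Or.inl (by linarith)⟩
  · exact ⟨Or.inr (by linarith), Or.inl (by linarith)⟩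
  · exact ⟨Or.inr (by linarith), Or.inr (by linarith)⟩

theorem map_near {x : ℝ} (hx : T.near x) :
    |f x - T.a| ≤ T.ra / 2 ∨ |f x - T.c| ≤ T.rc / 2 ∨ |f x - T.b| ≤ T.rb / 2 := by
  rcases hx with hx | hx | hx
  · exact Or.inr (Or.inl (h.maps_a x hx))
  · exact Or.inr (Or.inr (h.maps_c x hx))
  · exact Or.inl (h.maps_b x hx)

theorem near_or_core {x : ℝ} (h1 : T.a - T.ra ≤ x) (h2 : x ≤ T.b + T.rb) :
    T.near x ∨ x ∈ T.core := by
  have := h.ra_pos; have := h.rc_pos; have := h.rb_pos; have := h.a_lt_c; have := h.c_lt_b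
  simp only [near, core, left, right, mem_union, mem_Icc, abs_le]
  by_cases e1 : x ≤ T.a + T.ra
  · left; left; constructor <;> linarith
  by_cases e2 : x < T.c - T.rc
  · right; left; constructor <;> linarith
  by_cases e3 : x ≤ T.c + T.rc
  · left; right; left; constructor <;> linarith
  by_cases e4 : x < T.b - T.rb
  · right; right; constructor <;> linarith
  · left; right; right; constructor <;> linarith

theorem image_turning : |f γ - T.b| ≤ T.rb / 2 := h.maps_c γ h.near_c

theorem image_turning_two : |f (f γ) - T.a| ≤ T.ra / 2 :=
  h.maps_b _ (by have := h.image_turning; have := h.rb_pos; linarith)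

theorem image_turning_three : |f (f (f γ)) - T.c| ≤ T.rc / 2 :=
  h.maps_a _ (by have := h.image_turning_two; have := h.ra_pos; linarith)

theorem turning_lt : f (f γ) < γ ∧ γ < f γ := by
  have := h.ra_pos; have := h.rc_pos; have := h.rb_pos; have := h.a_lt_c; have := h.c_lt_b
  have h1 := abs_le.1 h.image_turning
  have h2 := abs_le.1 h.image_turning_two
  have h3 := abs_le.1 h.near_c
  constructor <;> linarith

theorem bounds : T.l ≤ f (f γ) ∧ f γ ≤ 1 ∧ T.a - T.ra ≤ f (f γ) ∧ f γ ≤ T.b + T.rb := by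
  have := h.ra_pos; have := h.rc_pos; have := h.rb_pos; have := h.l_le; have := h.le_one
  have h1 := abs_le.1 h.image_turning
  have h2 := abs_le.1 h.image_turning_two
  refine ⟨?_, ?_, ?_, ?_⟩ <;> linarith

theorem core_subset : T.core ⊆ Ioo (f (f γ)) (f γ) := by
  have := h.ra_pos; have := h.rc_pos; have := h.rb_pos; have := h.a_lt_c; have := h.c_lt_b
  have h1 := abs_le.1 h.image_turning
  have h2 := abs_le.1 h.image_turning_two
  rintro x (hx | hx)
  · exact ⟨by linarith [hx.1], by linarith [hx.2]⟩
  · exact ⟨by linarith [hx.1], by linarith [hx.2]⟩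

theorem le_max {x : ℝ} (hx : x ∈ Icc T.l 1) : f x ≤ f γ := by
  have h3 := h.turning_lt
  have h4 := h.bounds
  rcases le_total x γ with hxγ | hxγ
  · exact h.mono.monotoneOn ⟨hx.1, hxγ⟩ ⟨by linarith, le_rfl⟩ hxγ
  · exact h.anti.antitoneOn ⟨le_rfl, by linarith⟩ ⟨hxγ, hx.2⟩ hxγ

/-- The smallest value on the decreasing branch is `f (f γ)`. On the increasing branch it is `f (f
(f γ))`, which is close to `T.c` and therefore larger. -/
theorem mapsTo : MapsTo f (Icc (f (f γ)) (f γ)) (Icc (f (f γ)) (f γ)) := by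
  intro x hx
  have h3 := h.turning_lt
  have h4 := h.bounds
  refine ⟨?_, h.le_max ⟨by linarith [hx.1], by linarith [hx.2]⟩⟩
  rcases le_total x γ with hxγ | hxγ
  · have h5 : f (f (f γ)) ≤ f x :=
      h.mono.monotoneOn ⟨h4.1, h3.1.le⟩ ⟨by linarith [hx.1], hxγ⟩ hx.1
    have h6 := abs_le.1 h.image_turning_three
    have h7 := abs_le.1 h.image_turning_two
    have := h.ra_pos; have := h.rc_pos; have := h.a_lt_c
    linarith
  · exact h.anti.antitoneOn ⟨hxγ, by linarith [hx.2]⟩ ⟨h3.2.le, h4.2.1⟩ hx.2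

theorem iterate_mem {x : ℝ} (hx : x ∈ Icc (f (f γ)) (f γ)) (n : ℕ) :
    f^[n] x ∈ Icc (f (f γ)) (f γ) := h.mapsTo.iterate n hx

/-- There is a cycle of period three that attracts the trap. -/
theorem exists_cycle : ∃ p, |p - T.c| ≤ T.rc / 2 ∧ |f p - T.b| ≤ T.rb / 2 ∧
    |f (f p) - T.a| ≤ T.ra / 2 ∧ f (f (f p)) = p ∧
      ∀ x, T.near x → omegaSet f x = {p, f p, f (f p)} := by
  have hra := h.ra_pos; have hrc := h.rc_pos; have hrb := h.rb_pos
  have hstep : ∀ x, |x - T.c| ≤ T.rc → |f x - T.b| ≤ T.rb / 2 ∧ |f (f x) - T.a| ≤ T.ra / 2 ∧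
      |f (f (f x)) - T.c| ≤ T.rc / 2 := by
    intro x hx
    have h1 := h.maps_c x hx
    have h2 := h.maps_b (f x) (by linarith)
    exact ⟨h1, h2, h.maps_a _ (by linarith)⟩
  -- The third iterate maps this interval into itself, so the intermediate value theorem gives a
  -- fixed point.
  obtain ⟨p, hpI, hp⟩ : ∃ p ∈ Icc (T.c - T.rc) (T.c + T.rc), f (f (f p)) = p := by
    have hle : T.c - T.rc ≤ T.c + T.rc := by linarith
    have e1 := abs_le.1 (hstep (T.c - T.rc) (by simp [abs_of_pos hrc])).2.2
    have e2 := abs_le.1 (hstep (T.c + T.rc) (by simp [abs_of_pos hrc])).2.2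
    have hc : ContinuousOn (fun x => f (f (f x)) - x) (Icc (T.c - T.rc) (T.c + T.rc)) :=
      ((h.cont.comp (h.cont.comp h.cont)).sub continuous_id).continuousOn
    obtain ⟨p, hp, hp2⟩ := intermediate_value_Icc' hle hc (show (0 : ℝ) ∈ _ from
      ⟨by linarith, by linarith⟩)
    exact ⟨p, hp, by linarith [sub_eq_zero.1 hp2]⟩
  have hpc : |p - T.c| ≤ T.rc := abs_le.2 ⟨by linarith [hpI.1], by linarith [hpI.2]⟩
  obtain ⟨s1, s2, s3⟩ := hstep p hpc
  rw [hp] at s3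
  refine ⟨p, s3, s1, s2, hp, ?_⟩
  have main : ∀ x, |x - T.c| ≤ T.rc → omegaSet f x = {p, f p, f (f p)} := by
    intro x hx
    refine omegaSet_eq_cycle h.cont ?_
    have hrec : ∀ n, |f^[3 * n] x - T.c| ≤ T.rc ∧ |f^[3 * n] x - p| ≤ (1 / 2) ^ n * |x - p| := by
      intro n
      induction n with
      | zero => simpa using hx
      | succ n ih =>
        have e : f^[3 * (n + 1)] x = f (f (f (f^[3 * n] x))) := by
          rw [show 3 * (n + 1) = 3 * n + 1 + 1 + 1 by ring]
          simp only [Function.iterate_succ_apply']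
        rw [e]
        refine ⟨by linarith [(hstep _ ih.1).2.2], ?_⟩
        have := h.contr _ p ih.1 hpc
        rw [hp] at this
        rw [pow_succ]
        linarith [ih.2]
    rw [tendsto_iff_norm_sub_tendsto_zero]
    refine squeeze_zero (fun n => norm_nonneg _) (fun n => (hrec n).2) ?_
    have := (tendsto_pow_atTop_nhds_zero_of_lt_one (by norm_num : (0 : ℝ) ≤ 1 / 2)
      (by norm_num)).mul_const |x - p|
    simpa using this
  -- The parts about `T.a` and `T.b` reach the part about `T.c` after one and two steps, and limit
  -- sets ignore finitely many steps.
  rintro x (hx | hx | hx)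
  · rw [← omegaSet_iterate f x 1]
    exact main _ (by have := h.maps_a x hx; rw [Function.iterate_one]; linarith)
  · exact main x hx
  · rw [← omegaSet_iterate f x 2]
    have h1 := h.maps_b x hx
    have h2 := h.maps_a (f x) (by linarith)
    exact main _ (by show |f (f x) - T.c| ≤ T.rc; linarith)

end IsFor

end Trap

/-! ### Symbolic dynamics on the Markov intervals -/

namespace Trap

variable {T : Trap} {f : ℝ → ℝ} {γ : ℝ}

variable (T) in
/-- The symbol of a point of the Markov intervals. -/
def code (x : ℝ) : ℕ := if x ≤ T.c then 1 else 2

variable (T) in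
/-- The itinerary of a point. -/
def itin (f : ℝ → ℝ) (x : ℝ) : ℕ → ℕ := fun n => T.code (f^[n] x)

variable (T) in
/-- The Markov interval of a symbol. -/
def piece (i : ℕ) : Set ℝ := if i = 1 then T.left else T.right

theorem code_eq_one_or_two (x : ℝ) : T.code x = 1 ∨ T.code x = 2 := by
  unfold code; split_ifs <;> simp

theorem piece_mem (i : ℕ) : T.piece i ∈ ({T.left, T.right} : Set (Set ℝ)) := by
  unfold piece; split_ifs <;> simp

theorem piece_subset (i : ℕ) : T.piece i ⊆ T.core := by
  unfold piece; split_ifs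
  · exact subset_union_left
  · exact subset_union_right

theorem isClosed_piece (i : ℕ) : IsClosed (T.piece i) := by
  unfold piece; split_ifs <;> exact isClosed_Icc

theorem isCompact_piece (i : ℕ) : IsCompact (T.piece i) := by
  unfold piece; split_ifs <;> exact isCompact_Icc

variable (T) in
theorem isCompact_core : IsCompact T.core := isCompact_Icc.union isCompact_Icc

theorem mapsTo_invSet : MapsTo f (T.invSet f) (T.invSet f) := fun x hx n => by
  rw [← Function.iterate_succ_apply]; exact hx (n + 1)

theorem shift_itin (x : ℝ) : shift (T.itin f x) = T.itin f (f x) := by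
  funext n
  simp only [shift, itin, Function.iterate_succ_apply]

namespace IsFor

variable (h : T.IsFor f γ)
include h

theorem code_of_mem_left {x : ℝ} (hx : x ∈ T.left) : x < T.c ∧ T.code x = 1 := by
  have := h.rc_pos
  have : x < T.c := by linarith [hx.2]
  exact ⟨this, if_pos this.le⟩

theorem code_of_mem_right {x : ℝ} (hx : x ∈ T.right) : T.c < x ∧ T.code x = 2 := by
  have := h.rc_pos
  have : T.c < x := by linarith [hx.1]
  exact ⟨this, if_neg this.not_ge⟩

theorem mem_piece_code {x : ℝ} (hx : x ∈ T.core) : x ∈ T.piece (T.code x) := by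
  rcases hx with hx | hx
  · rw [(h.code_of_mem_left hx).2]; simpa [piece] using hx
  · rw [(h.code_of_mem_right hx).2]; simpa [piece] using hx

theorem code_of_mem_piece {x : ℝ} {i : ℕ} (hi : i = 1 ∨ i = 2) (hx : x ∈ T.piece i) :
    T.code x = i := by
  rcases hi with rfl | rfl
  · exact (h.code_of_mem_left (by simpa [piece] using hx)).2
  · exact (h.code_of_mem_right (by simpa [piece] using hx)).2

theorem left_subset : T.left ⊆ Icc T.l γ := by
  intro x hx
  have := h.l_le; have := h.ra_pos
  have := abs_le.1 h.near_c
  exact ⟨by linarith [hx.1], by linarith [hx.2]⟩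

/-- The left end point belongs to the trap, so its image is within `T.rc / 2` of `T.c`. By
monotonicity the whole image lies to the right of that point. This is what forbids the word 11. -/
theorem map_left_not_mem {x : ℝ} (hx : x ∈ T.left) : f x ∉ T.left := by
  intro hfx
  have hne : T.a + T.ra ∈ T.left := ⟨le_rfl, h.a_lt_c.le⟩
  have h1 : f (T.a + T.ra) ≤ f x :=
    h.mono.monotoneOn (h.left_subset hne) (h.left_subset hx) hx.1
  have h2 := abs_le.1 (h.maps_a (T.a + T.ra) (by simp [abs_of_pos h.ra_pos]))
  have := h.rc_pos
  linarith [hfx.2]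

theorem itin_mem {x : ℝ} (hx : x ∈ T.invSet f) : T.itin f x ∈ fibShift := by
  refine ⟨fun i => code_eq_one_or_two _, fun i hi => ?_⟩
  have h1 : f^[i] x ∈ T.left := by
    have := h.mem_piece_code (hx i)
    rwa [show T.code (f^[i] x) = 1 from hi.1, piece, if_pos rfl] at this
  have h2 : f^[i + 1] x ∈ T.left := by
    have := h.mem_piece_code (hx (i + 1))
    rwa [show T.code (f^[i + 1] x) = 1 from hi.2, piece, if_pos rfl] at this
  rw [Function.iterate_succ_apply'] at h2
  exact h.map_left_not_mem h1 h2

/-- While two orbits share their symbols, their distance in the coordinate `T.H` grows at least by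
the factor `T.κ` at each step. As `T.H` is bounded, the distance is zero, and `T.H` is injective on
each Markov interval. -/
theorem itin_injOn : InjOn (T.itin f) (T.invSet f) := by
  intro x hx y hy hxy
  have hcode : ∀ n, T.code (f^[n] x) = T.code (f^[n] y) := fun n => congrFun hxy n
  have hxp := fun n => h.mem_piece_code (hx n)
  have hyp : ∀ n, f^[n] y ∈ T.piece (T.code (f^[n] x)) := fun n => by
    rw [hcode n]; exact h.mem_piece_code (hy n)
  have hexp : ∀ n, T.κ ^ n * |T.H x - T.H y| ≤ |T.H (f^[n] x) - T.H (f^[n] y)| := by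
    intro n
    induction n with
    | zero => simp
    | succ n ih =>
      have hx1 : f (f^[n] x) ∈ T.piece (T.code (f^[n + 1] x)) := by
        rw [← Function.iterate_succ_apply' f]; exact hxp (n + 1)
      have hy1 : f (f^[n] y) ∈ T.piece (T.code (f^[n + 1] x)) := by
        rw [← Function.iterate_succ_apply' f]; exact hyp (n + 1)
      have := h.expand _ (piece_mem _) _ (piece_mem _) _ (hxp n) _ (hyp n) hx1 hy1
      rw [Function.iterate_succ_apply', Function.iterate_succ_apply']
      have hκ := h.one_lt
      calc T.κ ^ (n + 1) * |T.H x - T.H y| = T.κ * (T.κ ^ n * |T.H x - T.H y|) := by ring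
        _ ≤ T.κ * |T.H (f^[n] x) - T.H (f^[n] y)| := by gcongr
        _ ≤ _ := this
  obtain ⟨B, hB⟩ := h.bdd
  have hzero : |T.H x - T.H y| = 0 := by
    by_contra hne
    have hpos : 0 < |T.H x - T.H y| := lt_of_le_of_ne (abs_nonneg _) (Ne.symm hne)
    obtain ⟨n, hn⟩ := pow_unbounded_of_one_lt ((B + B) / |T.H x - T.H y|) h.one_lt
    rw [div_lt_iff₀ hpos] at hn
    have h1 := hexp n
    have h2 := abs_sub (T.H (f^[n] x)) (T.H (f^[n] y))
    have h3 := hB _ (hx n)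
    have h4 := hB _ (hy n)
    linarith
  exact h.inj _ (piece_mem _) (hxp 0) (hyp 0) (sub_eq_zero.1 (abs_eq_zero.1 hzero))

/-- The end points of a Markov interval lie in the trap, so their images are known up to half a
radius; the rest is the intermediate value theorem. -/
theorem right_subset_image_left : T.right ⊆ f '' T.left := by
  have hra := h.ra_pos; have hrc := h.rc_pos; have hrb := h.rb_pos
  have h1 := abs_le.1 (h.maps_a (T.a + T.ra) (by simp [abs_of_pos h.ra_pos]))
  have h2 := abs_le.1 (h.maps_c (T.c - T.rc) (by simp [abs_of_pos h.rc_pos]))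
  refine Subset.trans ?_ (intermediate_value_Icc h.a_lt_c.le h.cont.continuousOn)
  exact Icc_subset_Icc (by linarith) (by linarith)

theorem core_subset_image_right : T.core ⊆ f '' T.right := by
  have hra := h.ra_pos; have hrc := h.rc_pos; have hrb := h.rb_pos
  have := h.a_lt_c; have := h.c_lt_b
  have h1 := abs_le.1 (h.maps_c (T.c + T.rc) (by simp [abs_of_pos h.rc_pos]))
  have h2 := abs_le.1 (h.maps_b (T.b - T.rb) (by simp [abs_of_pos h.rb_pos]))
  refine Subset.trans ?_ (intermediate_value_Icc' h.c_lt_b.le h.cont.continuousOn)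
  rintro x (hx | hx)
  · exact ⟨by linarith [hx.1], by linarith [hx.2]⟩
  · exact ⟨by linarith [hx.1], by linarith [hx.2]⟩

/-- A point realizing the shifted word is pulled back by one step. The covering relations allow this
for every transition except 11. -/
theorem exists_finite_itin (n : ℕ) : ∀ u ∈ fibShift, ∃ x, ∀ k ≤ n, f^[k] x ∈ T.piece (u k) := by
  have hl : (T.a + T.ra) ∈ T.left := ⟨le_rfl, h.a_lt_c.le⟩
  have hr : (T.c + T.rc) ∈ T.right := ⟨le_rfl, h.c_lt_b.le⟩
  induction n with
  | zero =>
    intro u hu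
    rcases hu.1 0 with h0 | h0
    · exact ⟨_, fun k hk => by rw [Nat.le_zero.1 hk, h0]; simpa [piece] using hl⟩
    · exact ⟨_, fun k hk => by rw [Nat.le_zero.1 hk, h0]; simpa [piece] using hr⟩
  | succ n ih =>
    intro u hu
    obtain ⟨y, hy⟩ := ih (shift u) ⟨fun i => hu.1 (i + 1), fun i => hu.2 (i + 1)⟩
    have hy0 : y ∈ T.piece (u 1) := hy 0 n.zero_le
    obtain ⟨x, hx, rfl⟩ : ∃ x ∈ T.piece (u 0), f x = y := by
      rcases hu.1 0 with h0 | h0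
      · have h1 : u 1 = 2 := (hu.1 1).resolve_left fun h1 => hu.2 0 ⟨h0, h1⟩
        rw [h1] at hy0
        rw [h0]
        simpa [piece] using h.right_subset_image_left (by simpa [piece] using hy0)
      · rw [h0]
        simpa [piece] using h.core_subset_image_right (piece_subset _ hy0)
    refine ⟨x, fun k hk => ?_⟩
    rcases k with _ | k
    · exact hx
    · rw [Function.iterate_succ_apply]; exact hy k (by omega)

theorem exists_itin {u : ℕ → ℕ} (hu : u ∈ fibShift) : ∃ x ∈ T.invSet f, T.itin f x = u := by
  let A : ℕ → Set ℝ := fun n => {x | ∀ k ≤ n, f^[k] x ∈ T.piece (u k)}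
  have hclosed : ∀ n, IsClosed (A n) := fun n => by
    simp only [A, ofPred_forall]
    exact isClosed_iInter fun k => isClosed_iInter fun _ =>
      (isClosed_piece _).preimage (h.cont.iterate k)
  have hcomp : IsCompact (A 0) := (isCompact_piece (T := T) (u 0)).of_isClosed_subset (hclosed 0)
    fun _ hx => hx 0 le_rfl
  obtain ⟨x, hx⟩ := IsCompact.nonempty_iInter_of_sequence_nonempty_isCompact_isClosed A
    (fun n x hx k hk => hx k (hk.trans n.le_succ)) (fun n => h.exists_finite_itin n u hu)
    hcomp hclosed
  have hx' : ∀ k, f^[k] x ∈ T.piece (u k) := fun k => mem_iInter.1 hx k k le_rfl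
  exact ⟨x, fun k => piece_subset _ (hx' k), funext fun k => h.code_of_mem_piece (hu.1 k) (hx' k)⟩

theorem isClosed_invSet : IsClosed (T.invSet f) := by
  simp only [invSet, ofPred_forall]
  exact isClosed_iInter fun k => T.isCompact_core.isClosed.preimage (h.cont.iterate k)

theorem isCompact_invSet : IsCompact (T.invSet f) :=
  T.isCompact_core.of_isClosed_subset h.isClosed_invSet fun _ hx => hx 0

theorem continuousAt_code {x : ℝ} (hx : x ∈ T.core) : ContinuousAt T.code x := by
  rcases hx with hx | hx
  · have := (h.code_of_mem_left hx).1
    refine (continuousAt_const (y := 1)).congr ?_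
    filter_upwards [Iio_mem_nhds this] with y hy
    exact (if_pos (le_of_lt hy)).symm
  · have := (h.code_of_mem_right hx).1
    refine (continuousAt_const (y := 2)).congr ?_
    filter_upwards [Ioi_mem_nhds this] with y hy
    exact (if_neg (not_le.2 hy)).symm

theorem continuousOn_itin : ContinuousOn (T.itin f) (T.invSet f) :=
  continuousOn_pi.2 fun n _ hx => ((h.continuousAt_code (hx n)).comp
    (h.cont.iterate n).continuousAt).continuousWithinAt

theorem exists_homeo : ∃ φ : T.invSet f ≃ₜ fibShift, ∀ x, (φ x : ℕ → ℕ) = T.itin f x := by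
  let g : T.invSet f → fibShift := fun x => ⟨T.itin f x, h.itin_mem x.2⟩
  have hg : Continuous g := (continuousOn_iff_continuous_domRestrict.1 h.continuousOn_itin).subtype_mk _
  have hinj : Function.Injective g := fun x y hxy =>
    Subtype.ext (h.itin_injOn x.2 y.2 (congrArg Subtype.val hxy))
  have hsurj : Function.Surjective g := fun u => by
    obtain ⟨x, hx, hxu⟩ := h.exists_itin u.2
    exact ⟨⟨x, hx⟩, Subtype.ext hxu⟩
  have := isCompact_iff_compactSpace.1 h.isCompact_invSet
  exact ⟨Continuous.homeoOfEquivCompactToT2 (f := Equiv.ofBijective g ⟨hinj, hsurj⟩) hg,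
    fun _ => rfl⟩

theorem isTopConjugate : IsTopConjugate f (T.invSet f) shift fibShift := by
  obtain ⟨φ, hφ⟩ := h.exists_homeo
  refine ⟨mapsTo_invSet, fun u hu => ⟨fun i => hu.1 (i + 1), fun i => hu.2 (i + 1)⟩, φ, fun x => ?_⟩
  refine Subtype.ext ?_
  refine (hφ _).trans ?_
  show T.itin f (f x) = shift (φ x)
  rw [hφ, shift_itin]

/-- Each symbol is a continuous function with discrete values, hence constant on a connected subset,
and the itinerary determines the point. -/
theorem isTotallyDisconnected_invSet : IsTotallyDisconnected (T.invSet f) := by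
  intro S hS hpre x hx y hy
  refine h.itin_injOn (hS hx) (hS hy) (funext fun n => ?_)
  have h1 : IsPreconnected ((fun x => T.itin f x n) '' S) :=
    hpre.image _ ((continuousOn_pi.1 h.continuousOn_itin n).mono hS)
  exact h1.subsingleton (mem_image_of_mem _ hx) (mem_image_of_mem _ hy)

theorem isCantorSet_invSet : IsCantorSet (T.invSet f) := by
  refine ⟨?_, h.isCompact_invSet, h.isTotallyDisconnected_invSet, fun x hx => ?_⟩
  · obtain ⟨x, hx, -⟩ := h.exists_itin (u := fun _ => 2) ⟨fun i => Or.inr rfl, fun i => by simp⟩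
    exact ⟨x, hx⟩
  · obtain ⟨φ, hφ⟩ := h.exists_homeo
    set u := T.itin f x with hu
    have hum := h.itin_mem hx
    -- An admissible sequence that agrees with `u` up to `N` and differs from it at `N + 2`, where
    -- `3 - ·` swaps the symbols. The 2s at `N + 1` and from `N + 3` on exclude the word 11.
    let v : ℕ → ℕ → ℕ := fun N k =>
      if k ≤ N then u k else if k = N + 2 then 3 - u (N + 2) else 2
    have hv : ∀ N, v N ∈ fibShift := by
      intro N
      refine ⟨fun i => ?_, fun i hi => ?_⟩
      · have h1 := hum.1 i
        have h2 := hum.1 (N + 2)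
        simp only [v, ← hu] at h1 h2 ⊢
        split_ifs <;> omega
      · have h1 := hum.2 i
        have h2 := hum.1 (N + 2)
        simp only [v, ← hu] at h1 h2 hi
        split_ifs at hi <;> omega
    have hvne : ∀ N, v N ≠ u := by
      intro N hN
      have h1 := congrFun hN (N + 2)
      have h2 := hum.1 (N + 2)
      simp only [v, ← hu] at h1 h2
      rw [if_neg (by omega), if_pos trivial] at h1
      omega
    have hvlim : Tendsto (fun N => (⟨v N, hv N⟩ : fibShift)) atTop (𝓝 (φ ⟨x, hx⟩)) := by
      rw [tendsto_subtype_rng, hφ]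
      refine tendsto_pi_nhds.2 fun k => ?_
      refine tendsto_const_nhds.congr' ?_
      filter_upwards [eventually_ge_atTop k] with N hN
      simp only [v, if_pos hN, ← hu]
    have hlim := (φ.symm.continuous.tendsto _).comp hvlim
    rw [φ.symm_apply_apply] at hlim
    have hlim' := (continuous_subtype_val.tendsto _).comp hlim
    rw [accPt_iff_frequently]
    refine hlim'.frequently (Frequently.of_forall fun N => ⟨fun he => hvne N ?_, ?_⟩)
    · have h1 : φ.symm ⟨v N, hv N⟩ = ⟨x, hx⟩ := Subtype.ext he
      have h2 := congrArg (fun z => ((φ z : fibShift) : ℕ → ℕ)) h1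
      simpa only [φ.apply_symm_apply, hφ] using h2
    · exact (φ.symm ⟨v N, hv N⟩).2

/-! #### Attracting cycles and the repeller -/

theorem exists_near {x : ℝ} (hx : x ∈ Icc (f (f γ)) (f γ)) (hn : x ∉ T.invSet f) :
    ∃ n, T.near (f^[n] x) := by
  simp only [invSet, mem_ofPred_eq, not_forall] at hn
  obtain ⟨n, hn⟩ := hn
  have h1 := h.iterate_mem hx n
  have h2 := h.bounds
  exact ⟨n, (h.near_or_core (by linarith [h1.1]) (by linarith [h1.2])).resolve_right hn⟩

/-- No point of the invariant set is an attracting periodic point. -/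
theorem not_isAttracting {q : ℝ} (hq : q ∈ T.invSet f) : ¬ IsAttracting f q := by
  rintro ⟨-, y, hy⟩
  obtain ⟨p, hp1, hp2, hp3, -, hp⟩ := h.exists_cycle
  obtain ⟨U, hU, hUo, hyU⟩ := mem_interior.1 hy
  have hqJ := h.core_subset (hq 0)
  obtain ⟨n, hn⟩ := ((mapClusterPt_iff_frequently.1 (hU hyU)) _
    (isOpen_Ioo.mem_nhds hqJ)).exists
  have hV : U ∩ f^[n] ⁻¹' (Ioo (f (f γ)) (f γ)) ∈ 𝓝 y :=
    (hUo.inter (isOpen_Ioo.preimage (h.cont.iterate n))).mem_nhds ⟨hyU, hn⟩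
  obtain ⟨δ, hδ, hball⟩ := Metric.mem_nhds_iff.1 hV
  -- Otherwise the image, being connected, would be one point, against the finiteness of fibers. So
  -- some point of the ball enters the trap; its limit set is the attracting cycle, which misses the
  -- Markov intervals and cannot contain `q`.
  have hsub : ¬ f^[n] '' Metric.ball y δ ⊆ T.invSet f := by
    intro hs
    have h1 := h.isTotallyDisconnected_invSet _ hs
      ((convex_ball y δ).isPreconnected.image _ (h.cont.iterate n).continuousOn)
    have h2 : Metric.ball y δ ⊆ f^[n] ⁻¹' {f^[n] y} := fun z hz =>
      h1 (mem_image_of_mem _ hz) (mem_image_of_mem _ (Metric.mem_ball_self hδ))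
    have h3 := (finite_fiber_iterate h.fiber n (f^[n] y)).subset h2
    exact (infinite_of_mem_nhds y (Metric.ball_mem_nhds y hδ)) h3
  obtain ⟨_, ⟨z, hz, rfl⟩, hzn⟩ := not_subset.1 hsub
  obtain ⟨k, hk⟩ := h.exists_near (Ioo_subset_Icc_self (hball hz).2) hzn
  have h1 : q ∈ omegaSet f z := hU (hball hz).1
  rw [← omegaSet_iterate f z n, ← omegaSet_iterate f _ k, hp _ hk] at h1
  refine h.not_mem_core ?_ (hq 0)
  rcases h1 with rfl | rfl | rfl
  · exact Or.inr (Or.inl hp1)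
  · exact Or.inr (Or.inr hp2)
  · exact Or.inl hp3

/-- The attracting cycle of period three, and the repeller between its points. -/
theorem exists_attracting_cycle : ∃ p, |p - T.c| ≤ T.rc / 2 ∧ |f p - T.b| ≤ T.rb / 2 ∧
    |f (f p) - T.a| ≤ T.ra / 2 ∧
    attractingThreeCycles f (Icc T.l γ ∪ Icc γ 1) = {p, f p, f (f p)} ∧
    repeller f ∩ Icc (f (f p)) (f p) = T.invSet f := by
  obtain ⟨p, hp1, hp2, hp3, hfix, hp⟩ := h.exists_cycle
  have hra := h.ra_pos; have hrc := h.rc_pos; have hrb := h.rb_pos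
  have hac := h.a_lt_c; have hcb := h.c_lt_b; have hbd := h.bounds; have hturn := h.turning_lt
  have hl := h.l_le; have hone := h.le_one
  have b1 := abs_le.1 hp1
  have b2 := abs_le.1 hp2
  have b3 := abs_le.1 hp3
  have hper : Function.IsPeriodicPt f 3 p := hfix
  have hcyc : ∀ q ∈ ({p, f p, f (f p)} : Set ℝ), q ∈ Function.periodicPts f ∧
      Function.minimalPeriod f q = 3 ∧ IsAttracting f q := by
    have hmin : Function.minimalPeriod f p = 3 := by
      have hdvd := hper.minimalPeriod_dvd
      rcases (Nat.dvd_prime Nat.prime_three).1 hdvd with h1 | h1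
      · rw [Function.minimalPeriod_eq_one_iff_isFixedPt] at h1
        have : f p = p := h1
        linarith
      · exact h1
    have hpp : p ∈ Function.periodicPts f := ⟨3, by norm_num, hper⟩
    have hmin1 : Function.minimalPeriod f (f p) = 3 := by
      rw [Function.minimalPeriod_apply hpp, hmin]
    have hpp1 : f p ∈ Function.periodicPts f :=
      Function.minimalPeriod_pos_iff_mem_periodicPts.1 (by omega)
    have hmin2 : Function.minimalPeriod f (f (f p)) = 3 := by
      rw [Function.minimalPeriod_apply hpp1, hmin1]
    have hpp2 : f (f p) ∈ Function.periodicPts f :=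
      Function.minimalPeriod_pos_iff_mem_periodicPts.1 (by omega)
    have hint : ∀ q ∈ ({p, f p, f (f p)} : Set ℝ), (interior (basin f q)).Nonempty := by
      intro q hq
      refine ⟨T.c, mem_interior.2 ⟨Ioo (T.c - T.rc) (T.c + T.rc), fun x hx => ?_, isOpen_Ioo,
        ⟨by linarith, by linarith⟩⟩⟩
      show q ∈ omegaSet f x
      rw [hp x (Or.inr (Or.inl (abs_le.2 ⟨by linarith [hx.1], by linarith [hx.2]⟩)))]
      exact hq
    intro q hq
    have := hint q hq
    rcases hq with rfl | rfl | rfl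
    · exact ⟨hpp, hmin, hpp, this⟩
    · exact ⟨hpp1, hmin1, hpp1, this⟩
    · exact ⟨hpp2, hmin2, hpp2, this⟩
  -- an attracting periodic point in the dynamical interval lies on the cycle
  have huniq : ∀ q ∈ Icc (f (f γ)) (f γ), IsAttracting f q → q ∈ ({p, f p, f (f p)} : Set ℝ) := by
    intro q hq hatt
    by_cases hqi : q ∈ T.invSet f
    · exact absurd hatt (h.not_isAttracting hqi)
    · obtain ⟨n, hn⟩ := h.exists_near hq hqi
      rw [← hp _ hn, omegaSet_iterate]
      exact mem_omegaSet_self hatt.1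
  have hlaps : Icc T.l γ ∪ Icc γ 1 = Icc T.l 1 :=
    Icc_union_Icc_eq_Icc (by linarith) (by linarith)
  refine ⟨p, hp1, hp2, hp3, ?_, ?_⟩
  · rw [hlaps]
    apply Subset.antisymm
    · rintro x ⟨hatt, hmin, horb⟩
      have hx3 : f (f (f x)) = x := by
        have := Function.isPeriodicPt_minimalPeriod f x
        rw [hmin] at this
        exact this
      have hnfix : ∀ y, f y = y → y ∈ ({x, f x, f (f x)} : Set ℝ) → False := by
        intro y hy hm
        have hfx : f x = x := by
          rcases hm with rfl | rfl | rfl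
          · exact hy
          · rw [hy, hy] at hx3; exact hx3
          · rw [hy] at hx3; rw [hx3] at hy; exact hy
        have := Function.minimalPeriod_eq_one_iff_isFixedPt.2 (show Function.IsFixedPt f x from hfx)
        omega
      have hJ : ∀ y ∈ ({x, f x, f (f x)} : Set ℝ), y ∈ Icc T.l 1 := by
        rintro y (rfl | rfl | rfl)
        · exact horb 0
        · exact horb 1
        · exact horb 2
      have hfin : ({x, f x, f (f x)} : Set ℝ).Finite := toFinite _
      -- To place the cycle in the dynamical interval, consider its least point `m` and the preimage
      -- `z` of `m` in the cycle. If `z` were left of the turning point, monotonicity would give `f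
      -- m ≤ f z = m`, making `m` a fixed point. So `z` is on the decreasing branch and at most `f
      -- γ`, whence `f (f γ) ≤ m`.
      obtain ⟨m, hm, hmle⟩ := Set.exists_min_image _ id hfin ⟨x, Or.inl rfl⟩
      have hpre : ∀ y ∈ ({x, f x, f (f x)} : Set ℝ), ∃ z ∈ ({x, f x, f (f x)} : Set ℝ), f z = y := by
        rintro y (rfl | rfl | rfl)
        · exact ⟨_, Or.inr (Or.inr rfl), hx3⟩
        · exact ⟨_, Or.inl rfl, rfl⟩
        · exact ⟨_, Or.inr (Or.inl rfl), rfl⟩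
      have himg : ∀ y ∈ ({x, f x, f (f x)} : Set ℝ), f y ∈ ({x, f x, f (f x)} : Set ℝ) := by
        rintro y (rfl | rfl | rfl)
        · exact Or.inr (Or.inl rfl)
        · exact Or.inr (Or.inr rfl)
        · exact Or.inl hx3
      obtain ⟨z, hz, hzm⟩ := hpre m hm
      have hzγ : γ ≤ z := by
        by_contra hlt
        rw [not_le] at hlt
        have hmz : m ≤ z := hmle z hz
        have hle : f m ≤ f z := h.mono.monotoneOn ⟨(hJ m hm).1, by linarith⟩
          ⟨(hJ z hz).1, hlt.le⟩ hmz
        rw [hzm] at hle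
        exact hnfix m (le_antisymm hle (hmle _ (himg m hm))) hm
      have hzb : z ≤ f γ := by
        obtain ⟨y, hy, rfl⟩ := hpre z hz
        exact h.le_max (hJ y hy)
      have hma : f (f γ) ≤ m := by
        rw [← hzm]
        exact h.anti.antitoneOn ⟨hzγ, by linarith⟩ ⟨hturn.2.le, hbd.2.1⟩ hzb
      refine huniq x ⟨hma.trans (hmle x (Or.inl rfl)), ?_⟩ hatt
      rw [← hx3]
      exact h.le_max (hJ _ (Or.inr (Or.inr rfl)))
    · intro q hq
      obtain ⟨-, hmin, hatt⟩ := hcyc q hq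
      refine ⟨hatt, hmin, fun n => ?_⟩
      have hmem : ∀ n, f^[n] q ∈ ({p, f p, f (f p)} : Set ℝ) := by
        intro n
        induction n with
        | zero => exact hq
        | succ n ih =>
          rw [Function.iterate_succ_apply']
          rcases ih with h1 | h1 | h1 <;> rw [h1]
          · exact Or.inr (Or.inl rfl)
          · exact Or.inr (Or.inr rfl)
          · exact Or.inl hfix
      rcases hmem n with h1 | h1 | h1 <;> rw [h1]
      · exact ⟨by linarith, by linarith⟩
      · exact ⟨by linarith, by linarith⟩
      · exact ⟨by linarith, by linarith⟩
  · have hpJ : p ∈ Icc (f (f γ)) (f γ) := by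
      have h1 := abs_le.1 h.image_turning
      have h2 := abs_le.1 h.image_turning_two
      exact ⟨by linarith, by linarith⟩
    have hIJ : Icc (f (f p)) (f p) ⊆ Icc (f (f γ)) (f γ) :=
      Icc_subset_Icc (h.iterate_mem hpJ 2).1 (h.iterate_mem hpJ 1).2
    apply Subset.antisymm
    · rintro x ⟨⟨-, hx⟩, hxI⟩
      by_contra hxn
      obtain ⟨n, hn⟩ := h.exists_near (hIJ hxI) hxn
      refine hx (mem_iUnion₂.2 ⟨p, (hcyc p (Or.inl rfl)).2.2, ?_⟩)
      show p ∈ omegaSet f x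
      rw [← omegaSet_iterate f x n, hp _ hn]
      exact Or.inl rfl
    · intro x hx
      have hxc : x ∈ T.core := hx 0
      have hxI : x ∈ Icc (f (f p)) (f p) := by
        rcases hxc with hxc | hxc
        · exact ⟨by linarith [hxc.1], by linarith [hxc.2]⟩
        · exact ⟨by linarith [hxc.1], by linarith [hxc.2]⟩
      refine ⟨⟨?_, fun hb => ?_⟩, hxI⟩
      -- The orbit stays in the compact Markov intervals. So do all its limit points, whereas an
      -- attracting periodic point there would have to lie on the cycle in the trap.
      · exact T.isCompact_core.isBounded.subset (range_subset_iff.2 hx)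
      · obtain ⟨q, hq, hxq⟩ := mem_iUnion₂.1 hb
        have hqc := omegaSet_subset T.isCompact_core.isClosed hx hxq
        have hqJ := huniq q (Ioo_subset_Icc_self (h.core_subset hqc)) hq
        refine h.not_mem_core ?_ hqc
        rcases hqJ with rfl | rfl | rfl
        · exact Or.inr (Or.inl hp1)
        · exact Or.inr (Or.inr hp2)
        · exact Or.inl hp3

end IsFor

end Trap

/-! ### Monotonicity of polynomials with real critical points -/

section Sign

variable {ν : ℕ} {μ : Fin ν → ℕ} {P : ℝ[X]} {c : Fin ν → ℝ} {l : ℝ}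

theorem eval_derivative_eq (hP : P.derivative = C l * ∏ i, (X - C (c i)) ^ μ i) (x : ℝ) :
    P.derivative.eval x = l * ∏ i, (x - c i) ^ μ i := by
  rw [hP]
  simp [eval_prod]

theorem eval_derivative_eq_zero_iff (hμ : ∀ i, 1 ≤ μ i)
    (hP : P.derivative = C l * ∏ i, (X - C (c i)) ^ μ i) (hl : l ≠ 0) {x : ℝ} :
    P.derivative.eval x = 0 ↔ ∃ i, x = c i := by
  rw [eval_derivative_eq hP, mul_eq_zero, or_iff_right hl, Finset.prod_eq_zero_iff]
  constructor
  · rintro ⟨i, -, hi⟩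
    exact ⟨i, sub_eq_zero.1 (eq_zero_of_pow_eq_zero hi)⟩
  · rintro ⟨i, rfl⟩
    exact ⟨i, Finset.mem_univ i, by rw [sub_self, zero_pow]; have := hμ i; omega⟩

theorem eval_derivative_erase (hP : P.derivative = C l * ∏ i, (X - C (c i)) ^ μ i) (k : Fin ν)
    (x : ℝ) : P.derivative.eval x =
      (x - c k) ^ μ k * (l * ∏ i ∈ Finset.univ.erase k, (x - c i) ^ μ i) := by
  rw [eval_derivative_eq hP, ← Finset.mul_prod_erase _ _ (Finset.mem_univ k)]
  ring

theorem strictAntiOn_Ici (hP : P.derivative = C l * ∏ i, (X - C (c i)) ^ μ i) (hl : l < 0) {k : Fin ν}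
    (hk : ∀ i, c i ≤ c k) : StrictAntiOn P.eval (Ici (c k)) := by
  refine strictAntiOn_of_deriv_neg (convex_Ici _) P.continuous.continuousOn fun x hx => ?_
  rw [interior_Ici] at hx
  rw [P.deriv, eval_derivative_eq hP]
  exact mul_neg_of_neg_of_pos hl (Finset.prod_pos fun i _ => pow_pos (sub_pos.2 ((hk i).trans_lt hx)) _)

theorem eval_derivative_pos (hP : P.derivative = C l * ∏ i, (X - C (c i)) ^ μ i) (hl : l < 0)
    {k : Fin ν} (hodd : Odd (μ k)) {x : ℝ} (hk : ∀ i, i ≠ k → c i < x) (hx : x < c k) :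
    0 < P.derivative.eval x := by
  rw [eval_derivative_erase hP k]
  refine mul_pos_of_neg_of_neg (hodd.pow_neg (sub_neg.2 hx)) (mul_neg_of_neg_of_pos hl
    (Finset.prod_pos fun i hi => pow_pos (sub_pos.2 (hk i (Finset.ne_of_mem_erase hi))) _))

theorem strictMonoOn_Icc (hP : P.derivative = C l * ∏ i, (X - C (c i)) ^ μ i) (hl : l < 0) {k : Fin ν}
    (hodd : Odd (μ k)) {L : ℝ} (hk : ∀ i, i ≠ k → c i ≤ L) : StrictMonoOn P.eval (Icc L (c k)) := by
  refine strictMonoOn_of_deriv_pos (convex_Icc _ _) P.continuous.continuousOn fun x hx => ?_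
  rw [interior_Icc] at hx
  rw [P.deriv]
  exact eval_derivative_pos hP hl hodd (fun i hi => (hk i hi).trans_lt hx.1) hx.2

/-- Near `γ` the derivative has the sign of `(x - γ) ^ n`. The opposite sign of `g` is reduced to
this case by passing to `-P`. -/
theorem isLocalMin_and_not_isLocalExtr {γ : ℝ} {n : ℕ} {g : ℝ → ℝ} (hg : Continuous g)
    (hgγ : 0 < g γ) (hP : ∀ x, P.derivative.eval x = (x - γ) ^ n * g x) :
    (Odd n → IsLocalMin P.eval γ) ∧ (Even n → ¬ IsLocalExtr P.eval γ) := by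
  obtain ⟨δ, hδ, hball⟩ := Metric.eventually_nhds_iff.1 ((hg.tendsto γ).eventually (lt_mem_nhds hgγ))
  have hgp : ∀ x, |x - γ| < δ → 0 < g x := fun x hx => hball hx
  have hR : StrictMonoOn P.eval (Ico γ (γ + δ)) := by
    refine strictMonoOn_of_deriv_pos (convex_Ico _ _) P.continuous.continuousOn fun x hx => ?_
    rw [interior_Ico] at hx
    rw [P.deriv, hP]
    exact mul_pos (pow_pos (sub_pos.2 hx.1) _)
      (hgp x (abs_lt.2 ⟨by linarith [hx.1], by linarith [hx.2]⟩))
  have hγR : γ ∈ Ico γ (γ + δ) := ⟨le_rfl, by linarith⟩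
  have hγL : γ ∈ Ioc (γ - δ) γ := ⟨by linarith, le_rfl⟩
  constructor
  · intro hn
    have hL : StrictAntiOn P.eval (Ioc (γ - δ) γ) := by
      refine strictAntiOn_of_deriv_neg (convex_Ioc _ _) P.continuous.continuousOn fun x hx => ?_
      rw [interior_Ioc] at hx
      rw [P.deriv, hP]
      exact mul_neg_of_neg_of_pos (hn.pow_neg (sub_neg.2 hx.2))
        (hgp x (abs_lt.2 ⟨by linarith [hx.1], by linarith [hx.2]⟩))
    filter_upwards [Ioo_mem_nhds (show γ - δ < γ by linarith) (show γ < γ + δ by linarith)] with x hx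
    rcases le_total x γ with h | h
    · exact hL.antitoneOn ⟨hx.1, h⟩ hγL h
    · exact hR.monotoneOn hγR ⟨h, hx.2⟩ h
  · intro hn
    have hL : StrictMonoOn P.eval (Ioc (γ - δ) γ) := by
      refine strictMonoOn_of_deriv_pos (convex_Ioc _ _) P.continuous.continuousOn fun x hx => ?_
      rw [interior_Ioc] at hx
      rw [P.deriv, hP]
      exact mul_pos (hn.pow_pos (sub_neg.2 hx.2).ne)
        (hgp x (abs_lt.2 ⟨by linarith [hx.1], by linarith [hx.2]⟩))
    rintro (h | h)
    · obtain ⟨s, hs, hball⟩ := Metric.eventually_nhds_iff.1 h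
      have hm : γ - min s δ / 2 ∈ Ioc (γ - δ) γ := by
        have h1 := min_le_right s δ
        have h2 : 0 < min s δ := lt_min hs hδ
        exact ⟨by linarith, by linarith⟩
      have h2 : 0 < min s δ := lt_min hs hδ
      have h3 := hball (y := γ - min s δ / 2) (by
        rw [Real.dist_eq, sub_sub_cancel_left, abs_neg, abs_of_pos (by linarith)]
        linarith [min_le_left s δ])
      have h4 := hL hm hγL (by linarith)
      exact absurd h3 (not_le.2 h4)
    · obtain ⟨s, hs, hball⟩ := Metric.eventually_nhds_iff.1 h
      have hm : γ + min s δ / 2 ∈ Ico γ (γ + δ) := by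
        have h1 := min_le_right s δ
        have h2 : 0 < min s δ := lt_min hs hδ
        exact ⟨by linarith, by linarith⟩
      have h2 : 0 < min s δ := lt_min hs hδ
      have h3 := hball (y := γ + min s δ / 2) (by
        rw [Real.dist_eq, add_sub_cancel_left, abs_of_pos (by linarith)]
        linarith [min_le_left s δ])
      have h4 := hR hγR hm (by linarith)
      exact absurd h3 (not_le.2 h4)

/-- A critical point is a local extremum exactly if its multiplicity is odd. -/
theorem isLocalExtr_iff_odd (hP : P.derivative = C l * ∏ i, (X - C (c i)) ^ μ i) (hl : l ≠ 0)
    (hc : Function.Injective c) (k : Fin ν) : IsLocalExtr P.eval (c k) ↔ Odd (μ k) := by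
  set g : ℝ → ℝ := fun x => l * ∏ i ∈ Finset.univ.erase k, (x - c i) ^ μ i with hg
  have hgc : Continuous g := by fun_prop
  have hg0 : g (c k) ≠ 0 := mul_ne_zero hl (Finset.prod_ne_zero_iff.2 fun i hi =>
    pow_ne_zero _ (sub_ne_zero.2 fun e => (Finset.ne_of_mem_erase hi) (hc e).symm))
  have hPg : ∀ x, P.derivative.eval x = (x - c k) ^ μ k * g x := eval_derivative_erase hP k
  rcases lt_or_gt_of_ne hg0 with hneg | hpos
  · have h := isLocalMin_and_not_isLocalExtr (P := -P) (g := fun x => -g x) (n := μ k)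
      hgc.neg (neg_pos.2 hneg) fun x => by
        rw [derivative_neg, eval_neg, hPg]; ring
    have hfun : (fun x => (-P).eval x) = fun x => -P.eval x := by simp
    rw [hfun] at h
    constructor
    · intro he
      by_contra hn
      exact h.2 (Nat.not_odd_iff_even.1 hn) he.neg
    · intro hn
      have h1 := (h.1 hn).neg
      simp only [neg_neg] at h1
      exact Or.inr h1
  · have h := isLocalMin_and_not_isLocalExtr hgc hpos hPg
    constructor
    · intro he
      by_contra hn
      exact h.2 (Nat.not_odd_iff_even.1 hn) he
    · exact fun hn => Or.inl (h.1 hn)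

theorem finite_fiber_eval (hP : 1 ≤ P.natDegree) (y : ℝ) : (P.eval ⁻¹' {y}).Finite := by
  have h : P - C y ≠ 0 := by
    intro h0
    rw [sub_eq_zero.1 h0, natDegree_C] at hP
    omega
  refine ((P - C y).roots.toFinset.finite_toSet).subset fun x hx => ?_
  have hx' : P.eval x = y := hx
  simp [h, hx']

end Sign

/-! ### The last two laps -/

/-- The left end point of the last two laps. -/
def lowPoint {m : ℕ} (γ : Fin (m + 1) → ℝ) : ℝ := breakpoints γ (Fin.last m).castSucc.castSucc

theorem lowPoint_eq {m : ℕ} (γ : Fin (m + 1) → ℝ) :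
    (m = 0 ∧ lowPoint γ = 0) ∨ ∃ i : Fin (m + 1), (i : ℕ) + 1 = m ∧ lowPoint γ = γ i := by
  rcases m with _ | m
  · left
    refine ⟨rfl, ?_⟩
    rfl
  · right
    refine ⟨(Fin.last m).castSucc, by simp, ?_⟩
    have e : ((Fin.last (m + 1)).castSucc.castSucc : Fin (m + 2 + 2)) =
        Fin.succ (Fin.castSucc (Fin.castSucc (Fin.last m))) := by
      ext; simp
    rw [lowPoint, breakpoints, e, Fin.cons_succ, Fin.snoc_castSucc]

theorem lastLaps_eq {m : ℕ} (γ : Fin (m + 1) → ℝ) :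
    lastLaps γ = Icc (lowPoint γ) (γ (Fin.last m)) ∪ Icc (γ (Fin.last m)) 1 := by
  have e1 : breakpoints γ (Fin.last m).castSucc.succ = γ (Fin.last m) := by
    rw [breakpoints, Fin.cons_succ, Fin.snoc_castSucc]
  have e2 : breakpoints γ (Fin.last (m + 1)).castSucc = γ (Fin.last m) := by
    have : (Fin.last (m + 1)).castSucc = (Fin.last m).castSucc.succ := by ext; simp
    rw [this, e1]
  have e3 : breakpoints γ (Fin.last (m + 1)).succ = 1 := by
    rw [breakpoints, Fin.cons_succ, Fin.snoc_last]
  rw [lastLaps, lap, lap, e1, e2, e3]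
  rfl

theorem le_lowPoint {m : ℕ} {γ : Fin (m + 1) → ℝ} (hγ : StrictMono γ) {i : Fin (m + 1)}
    (hi : i ≠ Fin.last m) : γ i ≤ lowPoint γ := by
  have hi' : (i : ℕ) < m := by
    have := Fin.val_lt_last hi
    simpa using this
  rcases lowPoint_eq γ with ⟨h0, -⟩ | ⟨j, hj, h⟩
  · omega
  · rw [h]
    exact hγ.monotone (Fin.le_def.2 (by omega))

/-! ### The base map -/

/-- The two orbits differ by one point. For the base map this says that `[0, 1]` is completely
invariant. -/
theorem mem_filledJulia_iff (f : ℝ → ℝ) (x : ℝ) : f x ∈ filledJulia f ↔ x ∈ filledJulia f := by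
  have e : range (fun n : ℕ => f^[n] x) = insert x (range fun n : ℕ => f^[n] (f x)) := by
    ext y
    constructor
    · rintro ⟨n, rfl⟩
      rcases n with _ | n
      · exact Or.inl rfl
      · exact Or.inr ⟨n, (Function.iterate_succ_apply f n x).symm⟩
    · rintro (rfl | ⟨n, rfl⟩)
      · exact ⟨0, rfl⟩
      · exact ⟨n + 1, Function.iterate_succ_apply f n x⟩
  simp only [filledJulia, mem_ofPred_eq]
  rw [e, Bornology.isBounded_insert]

theorem HasCriticalData.derivative_eval_eq_zero {d ν : ℕ} {μ : Fin ν → ℕ} {P : ℝ[X]}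
    {c : Fin ν → ℝ} (hc : HasCriticalData d μ P c) {i : Fin ν} (hi : 1 ≤ μ i) :
    P.derivative.eval (c i) = 0 := by
  have h2 := hc.rootMultiplicity_eq i
  by_contra hne
  rw [rootMultiplicity_eq_zero hne] at h2
  omega

namespace IsBaseMap

variable {d m : ℕ} {μ : Fin (m + 1) → ℕ} {P : ℝ[X]} {c : Fin (m + 1) → ℝ}
  (h : IsBaseMap d μ P c)
include h

theorem mem_Icc_iff (x : ℝ) : P.eval x ∈ Icc (0 : ℝ) 1 ↔ x ∈ Icc (0 : ℝ) 1 := by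
  rw [← h.filledJulia_eq]; exact mem_filledJulia_iff _ _

/-- A point at which nearby points have values in `[0, 1]` is an interior point of `[0, 1]`. -/
theorem not_eventually_mem {x : ℝ} (hx : x = 0 ∨ x = 1) {n : ℕ} :
    ¬ ∀ᶠ y in 𝓝 x, P.eval^[n] y ∈ Icc (0 : ℝ) 1 := by
  intro hev
  have hev' : ∀ᶠ y in 𝓝 x, y ∈ Icc (0 : ℝ) 1 := by
    filter_upwards [hev] with y hy
    induction n with
    | zero => exact hy
    | succ n ih =>
      rw [Function.iterate_succ_apply', h.mem_Icc_iff] at hy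
      exact ih (by filter_upwards [hev] with z hz; rwa [Function.iterate_succ_apply', h.mem_Icc_iff] at hz) hy
  have hi : x ∈ interior (Icc (0 : ℝ) 1) := mem_interior_iff_mem_nhds.2 hev'
  rw [interior_Icc] at hi
  rcases hx with rfl | rfl
  · exact lt_irrefl _ hi.1
  · exact lt_irrefl _ hi.2

/-- If the value were interior, a neighbourhood of the end point would be mapped into `[0, 1]`,
against complete invariance. -/
theorem eval_endpoint {x : ℝ} (hx : x = 0 ∨ x = 1) : P.eval x = 0 ∨ P.eval x = 1 := by
  have hx' : x ∈ Icc (0 : ℝ) 1 := by rcases hx with rfl | rfl <;> simp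
  obtain ⟨h0, h1⟩ := (h.mem_Icc_iff x).2 hx'
  by_contra hcon
  rw [not_or] at hcon
  refine h.not_eventually_mem hx (n := 1) ?_
  have : P.eval x ∈ Ioo (0 : ℝ) 1 := ⟨lt_of_le_of_ne h0 (Ne.symm hcon.1), lt_of_le_of_ne h1 hcon.2⟩
  filter_upwards [P.continuous.continuousAt (isOpen_Ioo.mem_nhds this)] with y hy
  exact Ioo_subset_Icc_self hy

variable (hd : 3 ≤ d) (hμ : ∀ i, 1 ≤ μ i) (hμd : ∑ i, μ i = d - 1)

include hμ in
theorem critical_mem (i : Fin (m + 1)) : c i ∈ Icc (0 : ℝ) 1 := by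
  rw [← h.filledJulia_eq]
  refine (h.postcriticallyFinite.subset ?_).isBounded
  rintro _ ⟨n, rfl⟩
  exact ⟨c i, h.critical.derivative_eval_eq_zero (hμ i), n, rfl⟩

theorem dominant_mem : c (Fin.last m) ∈ turningPoints P.eval := by
  have := h.virtuallyUnimodal.single_turning.ge (mem_singleton _)
  exact this.1

theorem leadingCoeff_ne (hd : 3 ≤ d) : (d : ℝ) * P.coeff d ≠ 0 :=
  mul_ne_zero (by exact_mod_cast (by omega : d ≠ 0)) (h.critical.coeff_ne_zero (by omega))

include hd hμd in
theorem derivative_eq :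
    P.derivative = C (d * P.coeff d) * ∏ i, (X - C (c i)) ^ μ i :=
  h.critical.derivative_eq (by omega) hμd

include hd hμd in
-- With a positive leading coefficient `P` would increase to the right of its last critical point c,
-- so c < P(c) would give P(P(c)) > P(c) > c.
theorem leadingCoeff_neg : (d : ℝ) * P.coeff d < 0 := by
  refine lt_of_le_of_ne ?_ (h.leadingCoeff_ne hd)
  by_contra hpos
  rw [not_le] at hpos
  have hanti : StrictAntiOn (-P).eval (Ici (c (Fin.last m))) := by
    refine strictAntiOn_Ici (μ := μ) (l := -(d * P.coeff d)) ?_ (by linarith) fun i =>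
      h.strictMono.monotone (Fin.le_last i)
    rw [derivative_neg, h.derivative_eq hd hμd]; simp
  have h1 := hanti (mem_Ici.2 le_rfl) (mem_Ici.2 h.dominant_lt.le) h.dominant_lt
  have h2 : P.eval (P.eval (c (Fin.last m))) < c (Fin.last m) := h.lt_dominant
  have h3 := h.dominant_lt
  simp only [eval_neg, neg_lt_neg_iff] at h1
  linarith

include hd hμd in
theorem strictAntiOn : StrictAntiOn P.eval (Ici (c (Fin.last m))) :=
  FibRepeller.strictAntiOn_Ici (h.derivative_eq hd hμd) (h.leadingCoeff_neg hd hμd) fun i =>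
    h.strictMono.monotone (Fin.le_last i)

include hd hμd in
theorem eval_one : P.eval 1 = 0 := by
  refine (h.eval_endpoint (Or.inr rfl)).resolve_right fun h1 => ?_
  have hc := h.dominant_mem.1
  have h2 := h.strictAntiOn hd hμd (mem_Ici.2 le_rfl) (mem_Ici.2 hc.2.le) hc.2
  have h3 := (h.mem_Icc_iff (c (Fin.last m))).2 ⟨hc.1.le, hc.2.le⟩
  simp only [h1] at h2
  linarith [h3.2]

include hd hμd in
-- The second iterate fixes 0. If the derivative vanished there, 0 would attract small negative
-- numbers under it, and these would have bounded orbits outside `[0, 1]`. Hence no critical point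
-- is 0, as the chart requires.
theorem derivative_zero_ne : P.derivative.eval 0 ≠ 0 := by
  intro hP0
  set g : ℝ[X] := P.comp P with hg
  have hg0 : g.eval 0 = 0 := by
    rw [hg, eval_comp]
    rcases h.eval_endpoint (Or.inl rfl) with h0 | h0
    · rw [h0, h0]
    · rw [h0, h.eval_one hd hμd]
  have hgd : g.derivative.eval 0 = 0 := by
    rw [hg, derivative_comp, eval_mul, hP0, zero_mul]
  have hsmall : ∀ᶠ y in 𝓝 (0 : ℝ), |g.eval y| ≤ 1 / 2 * |y| := by
    have hD := g.hasDerivAt 0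
    rw [hgd] at hD
    have := hD.isLittleO.def (show (0 : ℝ) < 1 / 2 by norm_num)
    simpa [hg0] using this
  obtain ⟨δ, hδ, hball⟩ := Metric.eventually_nhds_iff.1 hsmall
  have horb : ∀ y, |y| < δ → ∀ n, |P.eval^[2 * n] y| < δ := by
    intro y hy n
    induction n with
    | zero => exact hy
    | succ n ih =>
      have e : P.eval^[2 * (n + 1)] y = g.eval (P.eval^[2 * n] y) := by
        rw [show 2 * (n + 1) = 2 * n + 1 + 1 by ring, Function.iterate_succ_apply',
          Function.iterate_succ_apply', hg, eval_comp]
      rw [e]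
      have := hball (y := P.eval^[2 * n] y) (by simpa using ih)
      have h0 := abs_nonneg (P.eval^[2 * n] y)
      linarith
  refine h.not_eventually_mem (Or.inl rfl) (n := 0) ?_
  filter_upwards [Metric.ball_mem_nhds (0 : ℝ) hδ] with y hy
  show y ∈ Icc (0 : ℝ) 1
  rw [← h.filledJulia_eq]
  have hb : Bornology.IsBounded (Icc (-δ) δ ∪ P.eval '' Icc (-δ) δ) :=
    isCompact_Icc.isBounded.union (isCompact_Icc.image P.continuous).isBounded
  refine hb.subset ?_
  rintro _ ⟨n, rfl⟩
  have hy' : |y| < δ := by simpa using hy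
  have h1 := abs_lt.1 (horb y hy' (n / 2))
  rcases Nat.even_or_odd n with hn | hn
  · left
    have : n = 2 * (n / 2) := (Nat.two_mul_div_two_of_even hn).symm
    show P.eval^[n] y ∈ _
    rw [this]
    exact ⟨h1.1.le, h1.2.le⟩
  · right
    have : n = 2 * (n / 2) + 1 := (Nat.two_mul_div_two_add_one_of_odd hn).symm
    show P.eval^[n] y ∈ _
    rw [this, Function.iterate_succ_apply']
    exact mem_image_of_mem _ ⟨h1.1.le, h1.2.le⟩

include hd hμ hμd in
theorem critical_mem_Ioo (i : Fin (m + 1)) : c i ∈ Ioo (0 : ℝ) 1 := by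
  refine ⟨lt_of_le_of_ne (h.critical_mem hμ i).1 fun h0 => ?_,
    (h.strictMono.monotone (Fin.le_last i)).trans_lt h.dominant_mem.1.2⟩
  have h1 := h.critical.derivative_eval_eq_zero (hμ i)
  rw [← h0] at h1
  exact h.derivative_zero_ne hd hμd h1

/-- The cycle of the dominant turning point lies in `(0, 1)`. -/
theorem cycle_bounds : 0 < P.eval (P.eval (c (Fin.last m))) ∧ P.eval (c (Fin.last m)) < 1 := by
  have hc := h.dominant_mem.1
  have hp3 : P.eval (P.eval (P.eval (c (Fin.last m)))) = c (Fin.last m) := h.period_three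
  have hb := (h.mem_Icc_iff _).2 (Ioo_subset_Icc_self hc)
  have ha := (h.mem_Icc_iff _).2 hb
  have hne : ∀ x, x = 0 ∨ x = 1 → P.eval x = c (Fin.last m) → False := by
    intro x hx hPx
    rcases h.eval_endpoint hx with h1 | h1
    · rw [← hPx, h1] at hc; exact lt_irrefl _ hc.1
    · rw [← hPx, h1] at hc; exact lt_irrefl _ hc.2
  have hane : P.eval (P.eval (c (Fin.last m))) ≠ 0 := fun h0 => hne _ (Or.inl h0) hp3
  have hane1 : P.eval (P.eval (c (Fin.last m))) ≠ 1 := fun h0 => hne _ (Or.inr h0) hp3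
  refine ⟨lt_of_le_of_ne ha.1 hane.symm, lt_of_le_of_ne hb.2 fun hb1 => ?_⟩
  rcases h.eval_endpoint (Or.inr hb1) with h1 | h1
  · exact hane h1
  · exact hane1 h1

theorem uIcc_eq : uIcc (P.eval^[2] (c (Fin.last m))) (P.eval (c (Fin.last m))) =
    Icc (P.eval (P.eval (c (Fin.last m)))) (P.eval (c (Fin.last m))) :=
  uIcc_of_le (h.lt_dominant.trans h.dominant_lt).le

/-- The orbits of the turning points enter the interior of the dynamical interval. -/
theorem exists_iterate_mem {x : ℝ} (hx : x ∈ turningPoints P.eval) :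
    ∃ k, P.eval^[k] x ∈ Ioo (P.eval (P.eval (c (Fin.last m)))) (P.eval (c (Fin.last m))) := by
  have hp3 : P.eval (P.eval (P.eval (c (Fin.last m)))) = c (Fin.last m) := h.period_three
  have hc : c (Fin.last m) ∈ Ioo (P.eval (P.eval (c (Fin.last m)))) (P.eval (c (Fin.last m))) :=
    ⟨h.lt_dominant, h.dominant_lt⟩
  obtain ⟨k, hk⟩ := h.virtuallyUnimodal.eventually_inside
  have h1 := hk x hx
  rw [h.uIcc_eq] at h1
  rcases eq_or_lt_of_le h1.1 with h2 | h2
  -- An orbit hitting an end point of the dynamical interval is on the cycle of the turning point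
  -- and reaches that point one or two steps later.
  · refine ⟨k + 1, ?_⟩
    rw [Function.iterate_succ_apply', ← h2, hp3]
    exact hc
  rcases eq_or_lt_of_le h1.2 with h3 | h3
  · refine ⟨k + 1 + 1, ?_⟩
    rw [Function.iterate_succ_apply', Function.iterate_succ_apply', h3, hp3]
    exact hc
  · exact ⟨k, h2, h3⟩

include hd hμ hμd in
-- A critical value 0 or 1 is extremal, so `c i` would be a turning point and its orbit would enter
-- the open dynamical interval. But end points are only mapped to end points. Being strict, the
-- bounds survive perturbation and keep `[0, 1]` invariant.
theorem critValue_mem (i : Fin (m + 1)) : P.eval (c i) ∈ Ioo (0 : ℝ) 1 := by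
  have hci := h.critical_mem_Ioo hd hμ hμd i
  obtain ⟨h0, h1⟩ := (h.mem_Icc_iff _).2 (Ioo_subset_Icc_self hci)
  have hcyc := h.cycle_bounds
  by_contra hcon
  have hv : P.eval (c i) = 0 ∨ P.eval (c i) = 1 := by
    rcases eq_or_lt_of_le h0 with h2 | h2
    · exact Or.inl h2.symm
    · rcases eq_or_lt_of_le h1 with h3 | h3
      · exact Or.inr h3
      · exact absurd ⟨h2, h3⟩ hcon
  have hnhds : ∀ᶠ y in 𝓝 (c i), P.eval y ∈ Icc (0 : ℝ) 1 := by
    filter_upwards [isOpen_Ioo.mem_nhds hci] with y hy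
    exact (h.mem_Icc_iff y).2 (Ioo_subset_Icc_self hy)
  have hturn : c i ∈ turningPoints P.eval := by
    refine ⟨hci, ?_⟩
    rcases hv with hv | hv
    · left; filter_upwards [hnhds] with y hy; rw [hv]; exact hy.1
    · right; filter_upwards [hnhds] with y hy; rw [hv]; exact hy.2
  obtain ⟨k, hk⟩ := h.exists_iterate_mem hturn
  have hk' : P.eval^[k] (c i) ∈ Ioo (0 : ℝ) 1 := ⟨hcyc.1.trans hk.1, hk.2.trans hcyc.2⟩
  rcases k with _ | k
  · have h2 := h.single_critical (c i) (Ioo_subset_Icc_self hk)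
      (h.critical.derivative_eval_eq_zero (hμ i))
    have h3 := h.dominant_lt
    have h4 := h.dominant_mem.1
    rw [h2] at hv
    rcases hv with hv | hv
    · linarith [h4.1]
    · linarith [hcyc.2]
  · rw [Function.iterate_succ_apply] at hk'
    have hend : ∀ n, P.eval^[n] (P.eval (c i)) = 0 ∨ P.eval^[n] (P.eval (c i)) = 1 := by
      intro n
      induction n with
      | zero => exact hv
      | succ n ih => rw [Function.iterate_succ_apply']; exact h.eval_endpoint ih
    rcases hend k with h2 | h2 <;> rw [h2] at hk'
    · exact lt_irrefl _ hk'.1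
    · exact lt_irrefl _ hk'.2

include hμ in
theorem critical_lt {i : Fin (m + 1)} (hi : i ≠ Fin.last m) :
    c i < P.eval (P.eval (c (Fin.last m))) := by
  by_contra hcon
  rw [not_lt] at hcon
  have h1 : c i < c (Fin.last m) := h.strictMono (lt_of_le_of_ne (Fin.le_last i) hi)
  have h2 := h.single_critical (c i) ⟨hcon, (h1.trans h.dominant_lt).le⟩
    (h.critical.derivative_eval_eq_zero (hμ i))
  linarith

include hd hμd in
theorem odd_dominant : Odd (μ (Fin.last m)) :=
  (isLocalExtr_iff_odd (h.derivative_eq hd hμd) (h.leadingCoeff_ne hd) h.critical.injective _).1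
    h.dominant_mem.2

include hμ in
theorem lowPoint_lt : lowPoint c < P.eval (P.eval (c (Fin.last m))) := by
  rcases lowPoint_eq c with ⟨-, h0⟩ | ⟨i, hi, h0⟩
  · rw [h0]; exact h.cycle_bounds.1
  · rw [h0]
    refine h.critical_lt hμ fun e => ?_
    rw [e] at hi
    simp at hi

end IsBaseMap

/-! ### The hyperbolic coordinates of two adjacent intervals -/

/-- The coordinate `log ((x - α) / (β - x))` on the intervals `(a, c)` and `(c, b)`. -/
def crossCoord (a c b x : ℝ) : ℝ :=
  if x < c then Real.log (x - a) - Real.log (c - x) else Real.log (x - c) - Real.log (b - x)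

/-- The derivative of `crossCoord`. -/
def crossDensity (a c b x : ℝ) : ℝ :=
  if x < c then 1 / (x - a) + 1 / (c - x) else 1 / (x - c) + 1 / (b - x)

section CrossCoord

variable {a c b x : ℝ}

theorem hasDerivAt_log_sub_log {α β : ℝ} (h1 : α < x) (h2 : x < β) :
    HasDerivAt (fun x => Real.log (x - α) - Real.log (β - x)) (1 / (x - α) + 1 / (β - x)) x := by
  have e1 := ((hasDerivAt_id x).sub_const α).log (sub_pos.2 h1).ne'
  have e2 := ((hasDerivAt_id x).const_sub β).log (sub_pos.2 h2).ne'
  convert! e1.sub e2 using 1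
  simp only [id]
  ring

theorem hasDerivAt_crossCoord (hx : x ∈ Ioo a c ∪ Ioo c b) :
    HasDerivAt (crossCoord a c b) (crossDensity a c b x) x := by
  rcases hx with hx | hx
  · rw [crossDensity, if_pos hx.2]
    refine (hasDerivAt_log_sub_log hx.1 hx.2).congr_of_eventuallyEq ?_
    filter_upwards [Iio_mem_nhds hx.2] with y hy
    exact if_pos hy
  · rw [crossDensity, if_neg hx.1.le.not_gt]
    refine (hasDerivAt_log_sub_log hx.1 hx.2).congr_of_eventuallyEq ?_
    filter_upwards [Ioi_mem_nhds hx.1] with y hy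
    exact if_neg (not_lt.2 (le_of_lt hy))

theorem continuousAt_crossDensity (hx : x ∈ Ioo a c ∪ Ioo c b) :
    ContinuousAt (crossDensity a c b) x := by
  have key : ∀ α β : ℝ, α < x → x < β → ContinuousAt (fun x => 1 / (x - α) + 1 / (β - x)) x := by
    intro α β h1 h2
    have e1 := (sub_pos.2 h1).ne'
    have e2 := (sub_pos.2 h2).ne'
    fun_prop (disch := assumption)
  rcases hx with hx | hx
  · refine (key _ _ hx.1 hx.2).congr ?_
    filter_upwards [Iio_mem_nhds hx.2] with y hy
    exact (if_pos hy).symm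
  · refine (key _ _ hx.1 hx.2).congr ?_
    filter_upwards [Ioi_mem_nhds hx.1] with y hy
    exact (if_neg (not_lt.2 (le_of_lt hy))).symm

theorem crossDensity_pos (hx : x ∈ Ioo a c ∪ Ioo c b) : 0 < crossDensity a c b x := by
  rcases hx with hx | hx
  · rw [crossDensity, if_pos hx.2]
    exact add_pos (one_div_pos.2 (sub_pos.2 hx.1)) (one_div_pos.2 (sub_pos.2 hx.2))
  · rw [crossDensity, if_neg hx.1.le.not_gt]
    exact add_pos (one_div_pos.2 (sub_pos.2 hx.1)) (one_div_pos.2 (sub_pos.2 hx.2))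

/-- A monotone map that expands the density expands the coordinate. -/
theorem expand_crossCoord {P : ℝ[X]} {κ x y : ℝ} {S S' : Set ℝ} (hS : S.OrdConnected)
    (hS' : S'.OrdConnected) (hSs : S ⊆ Ioo a c ∪ Ioo c b) (hSs' : S' ⊆ Ioo a c ∪ Ioo c b)
    (hmono : MonotoneOn P.eval S ∨ AntitoneOn P.eval S)
    (hexp : ∀ t ∈ S, P.eval t ∈ S' →
      κ * crossDensity a c b t ≤ |P.derivative.eval t| * crossDensity a c b (P.eval t))
    (hx : x ∈ S) (hy : y ∈ S) (hPx : P.eval x ∈ S') (hPy : P.eval y ∈ S') :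
    κ * |crossCoord a c b x - crossCoord a c b y| ≤
      |crossCoord a c b (P.eval x) - crossCoord a c b (P.eval y)| := by
  wlog hxy : x ≤ y generalizing x y
  · have := this hy hx hPy hPx (le_of_not_ge hxy)
    rwa [abs_sub_comm, abs_sub_comm (crossCoord a c b (P.eval x))]
  rcases hxy.eq_or_lt with rfl | hlt
  · simp
  have hsub : Icc x y ⊆ S := hS.out hx hy
  have hsub' : ∀ t ∈ Icc x y, P.eval t ∈ S' := by
    intro t ht
    rcases hmono with hm | hm
    · exact hS'.out hPx hPy ⟨hm hx (hsub ht) ht.1, hm (hsub ht) hy ht.2⟩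
    · exact hS'.out hPy hPx ⟨hm (hsub ht) hy ht.2, hm hx (hsub ht) ht.1⟩
  have d1 : ∀ t ∈ Icc x y, HasDerivAt (crossCoord a c b) (crossDensity a c b t) t := fun t ht =>
    hasDerivAt_crossCoord (hSs (hsub ht))
  have d2 : ∀ t ∈ Icc x y, HasDerivAt (fun t => crossCoord a c b (P.eval t))
      (crossDensity a c b (P.eval t) * P.derivative.eval t) t := fun t ht =>
    HasDerivAt.comp (h₂ := crossCoord a c b) t (hasDerivAt_crossCoord (hSs' (hsub' t ht)))
      (P.hasDerivAt t)
  -- Cauchy's mean value theorem, for the coordinate and its composition with `P`, reduces the claim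
  -- to the density inequality at one point.
  obtain ⟨t, ht, heq⟩ := exists_ratio_hasDerivAt_eq_ratio_slope
    (crossCoord a c b) (crossDensity a c b) hlt
    (fun t ht => (d1 t ht).continuousAt.continuousWithinAt)
    (fun t ht => d1 t (Ioo_subset_Icc_self ht))
    (fun t => crossCoord a c b (P.eval t)) _
    (fun t ht => (d2 t ht).continuousAt.continuousWithinAt)
    (fun t ht => d2 t (Ioo_subset_Icc_self ht))
  have htI := Ioo_subset_Icc_self ht
  have hpos := crossDensity_pos (hSs (hsub htI))
  have hpos' := crossDensity_pos (hSs' (hsub' t htI))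
  have habs := congrArg abs heq
  rw [abs_mul, abs_mul, abs_mul, abs_of_pos hpos, abs_of_pos hpos'] at habs
  have h1 := hexp t (hsub htI) (hsub' t htI)
  rw [abs_sub_comm, abs_sub_comm (crossCoord a c b (P.eval x))]
  refine le_of_mul_le_mul_right ?_ hpos
  rw [habs]
  calc κ * |crossCoord a c b y - crossCoord a c b x| * crossDensity a c b t
      = |crossCoord a c b y - crossCoord a c b x| * (κ * crossDensity a c b t) := by ring
    _ ≤ |crossCoord a c b y - crossCoord a c b x| *
        (|P.derivative.eval t| * crossDensity a c b (P.eval t)) := by gcongr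
    _ = _ := by ring

end CrossCoord

/-- The conditions on a trap that make it robust under perturbations of the base map `P`. -/
structure Trap.IsBase {m : ℕ} (T : Trap) (P : ℝ[X]) (c : Fin (m + 1) → ℝ) (M : ℝ) : Prop where
  c_eq : T.c = c (Fin.last m)
  ra_pos : 0 < T.ra
  rc_pos : 0 < T.rc
  rb_pos : 0 < T.rb
  low_lt : lowPoint c < T.a - T.ra
  pos_a : 0 < T.a - T.ra
  lt_one : T.b + T.rb < 1
  a_lt_c : T.a + T.ra < T.c - T.rc
  c_lt_b : T.c + T.rc < T.b - T.rb
  one_le : 1 ≤ M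
  maps_a : ∀ x ∈ Icc (T.a - T.ra) (T.a + T.ra), |P.eval x - T.c| < T.rc / 2
  maps_c : ∀ x ∈ Icc (T.c - T.rc) (T.c + T.rc), |P.eval x - T.b| < T.rb / 2
  maps_b : ∀ x ∈ Icc (T.b - T.rb) (T.b + T.rb), |P.eval x - T.a| < T.ra / 2
  deriv_a : ∀ x ∈ Icc (T.a - T.ra) (T.a + T.ra), |P.derivative.eval x| < M
  -- Small enough to outweigh the two factors at most `M` met near `T.b` and `T.a`.
  deriv_c : ∀ x ∈ Icc (T.c - T.rc) (T.c + T.rc), |P.derivative.eval x| < 1 / (64 * M ^ 2)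
  deriv_b : ∀ x ∈ Icc (T.b - T.rb) (T.b + T.rb), |P.derivative.eval x| < M
  H_eq : T.H = crossCoord T.a T.c T.b
  one_lt : 1 < T.κ
  expand : ∀ x ∈ T.core, P.eval x ∈ T.core →
    T.κ * crossDensity T.a T.c T.b x <
      |P.derivative.eval x| * crossDensity T.a T.c T.b (P.eval x)

theorem Trap.core_subset_Ioo (T : Trap) (ha : 0 < T.ra) (hc : 0 < T.rc) (hb : 0 < T.rb) :
    T.core ⊆ Ioo T.a T.c ∪ Ioo T.c T.b := by
  rintro x (hx | hx)
  · exact Or.inl ⟨by linarith [hx.1], by linarith [hx.2]⟩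
  · exact Or.inr ⟨by linarith [hx.1], by linarith [hx.2]⟩

theorem abs_eval_sub_le {P : ℝ[X]} {z r K : ℝ}
    (hK : ∀ x ∈ Icc (z - r) (z + r), |P.derivative.eval x| ≤ K) {x y : ℝ}
    (hx : x ∈ Icc (z - r) (z + r)) (hy : y ∈ Icc (z - r) (z + r)) :
    |P.eval x - P.eval y| ≤ K * |x - y| :=
  (convex_Icc (z - r) (z + r)).norm_image_sub_le_of_norm_hasDerivWithin_le
    (fun t _ => (P.hasDerivAt t).hasDerivWithinAt) hK hy hx

/-! ### Expansion of the base map and the choice of the trap -/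

namespace IsBaseMap

variable {d m : ℕ} {μ : Fin (m + 1) → ℕ} {P : ℝ[X]} {c : Fin (m + 1) → ℝ}
  (h : IsBaseMap d μ P c) (hd : 3 ≤ d) (hμ : ∀ i, 1 ≤ μ i) (hμd : ∑ i, μ i = d - 1)
include h hd hμ hμd

/-- The base map expands the hyperbolic densities of the two intervals. -/
theorem crossDensity_lt {x : ℝ}
    (hx : x ∈ Ioo (P.eval (P.eval (c (Fin.last m)))) (P.eval (c (Fin.last m))))
    (hxc : x ≠ c (Fin.last m)) (hPx : P.eval x ≠ c (Fin.last m)) :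
    crossDensity (P.eval (P.eval (c (Fin.last m)))) (c (Fin.last m)) (P.eval (c (Fin.last m))) x <
      |P.derivative.eval x| * crossDensity (P.eval (P.eval (c (Fin.last m)))) (c (Fin.last m))
        (P.eval (c (Fin.last m))) (P.eval x) := by
  have hder := h.derivative_eq hd hμd
  have hl := h.leadingCoeff_neg hd hμd
  have hne : ∀ i, c i ∉ Ioo (P.eval (P.eval (c (Fin.last m)))) (c (Fin.last m)) := by
    intro i hi
    exact (h.critical_lt hμ fun e => (e ▸ hi.2).ne rfl).not_gt hi.1
  have hne' : ∀ i, ∀ β, c i ∉ Ioo (c (Fin.last m)) β := fun i β hi =>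
    (h.strictMono.monotone (Fin.le_last i)).not_gt hi.1
  have hac : P.eval (P.eval (c (Fin.last m))) < c (Fin.last m) := h.lt_dominant
  have hcb := h.dominant_lt
  have hp3 : P.eval (P.eval (P.eval (c (Fin.last m)))) = c (Fin.last m) := h.period_three
  have hanti := h.strictAntiOn hd hμd
  have hmono : StrictMonoOn P.eval (Icc (P.eval (P.eval (c (Fin.last m)))) (c (Fin.last m))) :=
    strictMonoOn_Icc hder hl (h.odd_dominant hd hμd) fun i hi => (h.critical_lt hμ hi).le
  have hneg : ∀ y, c (Fin.last m) < y → P.derivative.eval y < 0 := by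
    intro y hy
    rw [eval_derivative_eq hder]
    exact mul_neg_of_neg_of_pos hl (Finset.prod_pos fun i _ => pow_pos
      (sub_pos.2 ((h.strictMono.monotone (Fin.le_last i)).trans_lt hy)) _)
  set C := c (Fin.last m) with hC
  set B := P.eval C with hB
  set A := P.eval B with hA
  rcases lt_or_gt_of_ne hxc with hlt | hgt
  -- Here `(A, C)` is mapped increasingly onto `(C, B)`, and the cross ratio inequality is the
  -- claim.
  · have hpos : ∀ y ∈ Ioo A C, 0 < P.derivative.eval y := fun y hy =>
      eval_derivative_pos hder hl (h.odd_dominant hd hμd)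
        (fun i hi => (h.critical_lt hμ hi).trans hy.1) hy.2
    have key := cross_ratio_lt_of_pos hμ m.succ_pos hder hl.ne hne hpos ⟨hx.1, hlt⟩
    rw [hp3, ← hB] at key
    have h1 : C < P.eval x := by
      rw [← hp3]; exact hmono (left_mem_Icc.2 hac.le) ⟨hx.1.le, hlt.le⟩ hx.1
    rw [crossDensity, crossDensity, if_pos hlt, if_neg h1.le.not_gt,
      abs_of_pos (hpos x ⟨hx.1, hlt⟩)]
    exact key
  -- The preimage `s` of `C` splits `(C, B)` into one branch onto `(C, B)` and one onto `(A, C)`.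
  -- The density of either piece exceeds that of `(C, B)`, which only helps.
  · obtain ⟨s, hs, hPs⟩ : ∃ s ∈ Ioo C B, P.eval s = C :=
      intermediate_value_Ioo' hcb.le P.continuous.continuousOn ⟨hac, hcb⟩
    rcases lt_or_gt_of_ne hPx with hPlt | hPgt
    · have hsx : s < x := by
        by_contra hn
        have := hanti.antitoneOn hgt.le hs.1.le (not_lt.1 hn)
        simp only [hPs] at this
        linarith
      have key := cross_ratio_lt_of_neg hμ m.succ_pos hder hl.ne
        (fun i hi => hne' i B ⟨hs.1.trans hi.1, hi.2⟩)
        (fun y hy => hneg y (hs.1.trans hy.1)) ⟨hsx, hx.2⟩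
      rw [hPs, ← hA] at key
      rw [crossDensity, crossDensity, if_neg hgt.not_gt, if_pos hPlt]
      have h2 : 1 / (x - C) < 1 / (x - s) :=
        one_div_lt_one_div_of_lt (by linarith) (by linarith [hs.1])
      rw [add_comm (1 / (P.eval x - A))]
      linarith
    · have hsx : x < s := by
        by_contra hn
        have := hanti.antitoneOn hs.1.le hgt.le (not_lt.1 hn)
        simp only [hPs] at this
        linarith
      have key := cross_ratio_lt_of_neg hμ m.succ_pos hder hl.ne
        (fun i hi => hne' i s hi) (fun y hy => hneg y hy.1) ⟨hgt, hsx⟩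
      rw [hPs, ← hB] at key
      rw [crossDensity, crossDensity, if_neg hgt.not_gt, if_neg hPgt.not_gt]
      have h2 : 1 / (B - x) < 1 / (s - x) :=
        one_div_lt_one_div_of_lt (by linarith) (by linarith [hs.2])
      rw [add_comm (1 / (P.eval x - C))]
      linarith

theorem exists_trap : ∃ T M, Trap.IsBase T P c M := by
  have hac : P.eval (P.eval (c (Fin.last m))) < c (Fin.last m) := h.lt_dominant
  have hcb := h.dominant_lt
  have hp3 : P.eval (P.eval (P.eval (c (Fin.last m)))) = c (Fin.last m) := h.period_three
  have hdens := fun x => @crossDensity_lt _ _ _ _ _ h hd hμ hμd x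
  have hlow := h.lowPoint_lt hμ
  obtain ⟨h0a, hb1⟩ := h.cycle_bounds
  have hPc : P.derivative.eval (c (Fin.last m)) = 0 :=
    h.critical.derivative_eval_eq_zero (hμ _)
  set C := c (Fin.last m) with hC
  set B := P.eval C with hB
  set A := P.eval B with hA
  obtain ⟨M₀, hM₀⟩ := (isCompact_Icc (a := A - 1) (b := B + 1)).exists_bound_of_continuousOn
    P.derivative.continuous.continuousOn
  set M := max M₀ 0 + 1 with hM
  have hM1 : 1 ≤ M := by have := le_max_right M₀ 0; linarith
  have hMb : ∀ x ∈ Icc (A - 1) (B + 1), |P.derivative.eval x| < M := fun x hx => by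
    have := hM₀ x hx
    have := le_max_left M₀ 0
    rw [Real.norm_eq_abs] at *
    linarith
  have hsmall : ∀ᶠ x in 𝓝 C, |P.derivative.eval x| < 1 / (64 * M ^ 2) := by
    have h1 : Tendsto (fun x => |P.derivative.eval x|) (𝓝 C) (𝓝 |P.derivative.eval C|) :=
      P.derivative.continuous.abs.tendsto C
    rw [hPc, abs_zero] at h1
    exact h1.eventually (gt_mem_nhds (by positivity))
  obtain ⟨δ, hδ, hball⟩ := Metric.eventually_nhds_iff.1 hsmall
  obtain ⟨r, hr0, hrδ, hr1, hrac, hrcb, hrlow, hrb, hra⟩ : ∃ r > 0, r < δ ∧ r ≤ 1 ∧ 2 * r < C - A ∧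
      2 * r < B - C ∧ r < A - lowPoint c ∧ r < 1 - B ∧ r < A := by
    have key : ∀ᶠ r in 𝓝[>] (0 : ℝ), 0 < r ∧ r < δ ∧ r < 1 ∧ r < (C - A) / 2 ∧
        r < (B - C) / 2 ∧ r < A - lowPoint c ∧ r < 1 - B ∧ r < A := by
      have : ∀ t : ℝ, 0 < t → ∀ᶠ r in 𝓝[>] (0 : ℝ), r < t := fun t ht =>
        (gt_mem_nhds ht).filter_mono nhdsWithin_le_nhds
      filter_upwards [self_mem_nhdsWithin, this δ hδ, this 1 one_pos, this ((C - A) / 2) (by linarith),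
        this ((B - C) / 2) (by linarith), this (A - lowPoint c) (by linarith),
        this (1 - B) (by linarith), this A h0a]
        with r h1 h2 h3 h4 h5 h6 h7 h8
      exact ⟨h1, h2, h3, h4, h5, h6, h7, h8⟩
    obtain ⟨r, h1, h2, h3, h4, h5, h6, h7, h8⟩ := key.exists
    exact ⟨r, h1, h2, h3.le, by linarith, by linarith, h6, h7, h8⟩
  -- With these radii, `M * ra = r / 4`, `M * rb = ra / 4` and `r / (64 * M ^ 2) = rb / 4`, so each
  -- part is mapped strictly inside half of the next.
  set ra := r / (4 * M) with hrae
  set rb := ra / (4 * M) with hrbe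
  have hra0 : 0 < ra := by positivity
  have hrb0 : 0 < rb := by positivity
  have hMra : M * ra = r / 4 := by rw [hrae]; field_simp
  have hMrb : M * rb = ra / 4 := by rw [hrbe]; field_simp
  have hra4 : ra ≤ r / 4 := by nlinarith
  have hrb4 : rb ≤ ra / 4 := by nlinarith
  have hrbr : 1 / (64 * M ^ 2) * r = rb / 4 := by
    rw [hrbe, hrae]; field_simp; norm_num
  -- The values 0 of `l` and `κ` are placeholders, as the Markov intervals depend on neither. The
  -- factor `κ` is found below, and `l` is reset for each map.
  let T₀ : Trap := ⟨0, A, C, B, ra, r, rb, 0, crossCoord A C B⟩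
  have hcore := T₀.core_subset_Ioo hra0 hr0 hrb0
  have hexp : ∀ x ∈ T₀.core, P.eval x ∈ T₀.core →
      crossDensity A C B x < |P.derivative.eval x| * crossDensity A C B (P.eval x) := by
    intro x hx hPx
    have hne : ∀ y ∈ T₀.core, y ≠ C := by
      intro y hy
      rcases hcore hy with h1 | h1
      · exact h1.2.ne
      · exact h1.1.ne'
    refine hdens x ?_ (hne _ hx) (hne _ hPx)
    rcases hcore hx with h1 | h1
    · exact ⟨h1.1, h1.2.trans hcb⟩
    · exact ⟨hac.trans h1.1, h1.2⟩
  -- The expansion ratio is continuous and greater than 1 on a compact set, so any number strictly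
  -- between 1 and its minimum serves.
  obtain ⟨κ, hκ1, hκ⟩ : ∃ κ > 1, ∀ x ∈ T₀.core, P.eval x ∈ T₀.core →
      κ * crossDensity A C B x < |P.derivative.eval x| * crossDensity A C B (P.eval x) := by
    have hcomp : IsCompact (T₀.core ∩ P.eval ⁻¹' T₀.core) :=
      T₀.isCompact_core.inter_right (T₀.isCompact_core.isClosed.preimage P.continuous)
    have hcont : ContinuousOn (fun x => |P.derivative.eval x| * crossDensity A C B (P.eval x) /
        crossDensity A C B x) (T₀.core ∩ P.eval ⁻¹' T₀.core) := by
      intro x hx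
      have h1 : ContinuousAt (crossDensity A C B) x := continuousAt_crossDensity (hcore hx.1)
      have h2 : ContinuousAt (crossDensity A C B) (P.eval x) :=
        continuousAt_crossDensity (hcore hx.2)
      have h3 : ContinuousAt (fun x => crossDensity A C B (P.eval x)) x :=
        ContinuousAt.comp (f := P.eval) h2 P.continuous.continuousAt
      exact ((P.derivative.continuous.abs.continuousAt.mul h3).div h1
        (crossDensity_pos (hcore hx.1)).ne').continuousWithinAt
    rcases (T₀.core ∩ P.eval ⁻¹' T₀.core).eq_empty_or_nonempty with he | hne
    · refine ⟨2, by norm_num, fun x hx hPx => ?_⟩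
      have : x ∈ T₀.core ∩ P.eval ⁻¹' T₀.core := ⟨hx, hPx⟩
      rw [he] at this
      exact this.elim
    · obtain ⟨x₀, hx₀, hmin⟩ := hcomp.exists_isMinOn hne hcont
      set q := |P.derivative.eval x₀| * crossDensity A C B (P.eval x₀) / crossDensity A C B x₀
      have hq : 1 < q := (one_lt_div (crossDensity_pos (hcore hx₀.1))).2 (hexp x₀ hx₀.1 hx₀.2)
      refine ⟨(1 + q) / 2, by linarith, fun x hx hPx => ?_⟩
      have h1 : q ≤ _ := hmin (show x ∈ T₀.core ∩ P.eval ⁻¹' T₀.core from ⟨hx, hPx⟩)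
      have h2 := crossDensity_pos (hcore hx)
      refine (lt_div_iff₀ h2).1 (lt_of_lt_of_le ?_ h1)
      linarith
  have dA : ∀ x ∈ Icc (A - ra) (A + ra), |P.derivative.eval x| < M := fun x hx =>
    hMb x ⟨by linarith [hx.1], by linarith [hx.2]⟩
  have dB : ∀ x ∈ Icc (B - rb) (B + rb), |P.derivative.eval x| < M := fun x hx =>
    hMb x ⟨by linarith [hx.1], by linarith [hx.2]⟩
  have dC : ∀ x ∈ Icc (C - r) (C + r), |P.derivative.eval x| < 1 / (64 * M ^ 2) := fun x hx =>
    hball (by rw [Real.dist_eq]; exact (abs_le.2 ⟨by linarith [hx.1], by linarith [hx.2]⟩).trans_lt hrδ)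
  have move : ∀ {z t K : ℝ}, 0 < t → 0 ≤ K →
      (∀ x ∈ Icc (z - t) (z + t), |P.derivative.eval x| < K) →
      ∀ x ∈ Icc (z - t) (z + t), |P.eval x - P.eval z| ≤ K * t := by
    intro z t K ht hK hb x hx
    refine (abs_eval_sub_le (fun y hy => (hb y hy).le) hx ⟨by linarith, by linarith⟩).trans ?_
    gcongr
    exact abs_le.2 ⟨by linarith [hx.1], by linarith [hx.2]⟩
  refine ⟨⟨0, A, C, B, ra, r, rb, κ, crossCoord A C B⟩, M, ?_⟩
  refine ⟨rfl, hra0, hr0, hrb0, ?_, ?_, ?_, ?_, ?_, hM1, fun x hx => ?_, fun x hx => ?_,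
    fun x hx => ?_, dA, dC, dB, rfl, hκ1, hκ⟩
  · show lowPoint c < A - ra; linarith
  · show 0 < A - ra; linarith
  · show B + rb < 1; linarith
  · show A + ra < C - r; linarith
  · show C + r < B - rb; linarith
  · show |P.eval x - C| < r / 2
    have := move hra0 (by linarith) dA x hx
    rw [hp3] at this
    linarith
  · show |P.eval x - B| < rb / 2
    have := move hr0 (by positivity) dC x hx
    rw [← hB] at this
    linarith
  · show |P.eval x - A| < ra / 2
    have := move hrb0 (by linarith) dB x hx
    rw [← hA] at this
    linarith

end IsBaseMap

/-! ### Small perturbations of the base map -/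

theorem polydisk_mem_nhds {ν : ℕ} (v : Fin ν → ℝ) {ε : ℝ} (hε : 0 < ε) :
    polydisk v ε ∈ 𝓝 (toComplex v) :=
  Metric.ball_mem_nhds _ hε

namespace IsCriticalValueChart

variable {d ν : ℕ} {μ : Fin ν → ℕ} {P₀ : ℝ[X]} {c₀ : Fin ν → ℝ} {ε : ℝ}
  {F : (Fin ν → ℂ) → ℂ[X]} {c : (Fin ν → ℂ) → Fin ν → ℂ}
  (ch : IsCriticalValueChart d μ P₀ c₀ ε F c) (hε : 0 < ε)
include ch hε

theorem tendsto_coeff (k : ℕ) : Tendsto (fun w => (F w).coeff k)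
    (𝓝 (toComplex (critValues P₀ c₀))) (𝓝 ((F (toComplex (critValues P₀ c₀))).coeff k)) :=
  ((ch.holomorphic k).differentiableAt (polydisk_mem_nhds _ hε)).continuousAt

theorem tendsto_critical (i : Fin ν) : Tendsto (fun w => c w i)
    (𝓝 (toComplex (critValues P₀ c₀))) (𝓝 (c₀ i : ℂ)) := by
  have := ((ch.critical_holomorphic i).differentiableAt (polydisk_mem_nhds _ hε)).continuousAt
  rwa [ContinuousAt, ch.base_critical] at this

theorem tendsto_eval {ι : Type*} {l : Filter ι} {w : ι → Fin ν → ℂ} {z : ι → ℂ} {z₀ : ℂ}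
    (hw : Tendsto w l (𝓝 (toComplex (critValues P₀ c₀)))) (hz : Tendsto z l (𝓝 z₀)) :
    Tendsto (fun n => (F (w n)).eval (z n)) l (𝓝 ((P₀.map Complex.ofRealHom).eval z₀)) := by
  rw [← ch.base]
  refine tendsto_eval_of_coeff (d := d) ?_ ?_ (fun k => (ch.tendsto_coeff hε k).comp hw) hz
  · filter_upwards [hw.eventually (polydisk_mem_nhds _ hε)] with n hn
    exact (ch.mem _ hn).critical.natDegree_eq.le
  · exact (ch.mem _ (mem_of_mem_nhds (polydisk_mem_nhds _ hε))).critical.natDegree_eq.le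

theorem tendsto_eval_derivative {ι : Type*} {l : Filter ι} {w : ι → Fin ν → ℂ} {z : ι → ℂ} {z₀ : ℂ}
    (hw : Tendsto w l (𝓝 (toComplex (critValues P₀ c₀)))) (hz : Tendsto z l (𝓝 z₀)) :
    Tendsto (fun n => (F (w n)).derivative.eval (z n)) l
      (𝓝 ((P₀.derivative.map Complex.ofRealHom).eval z₀)) := by
  rw [← derivative_map, ← ch.base]
  refine tendsto_eval_of_coeff (d := d) ?_ ?_ (fun k => ?_) hz
  · filter_upwards [hw.eventually (polydisk_mem_nhds _ hε)] with n hn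
    exact (natDegree_derivative_le _).trans
      (by rw [(ch.mem _ hn).critical.natDegree_eq]; omega)
  · exact (natDegree_derivative_le _).trans (by
      rw [(ch.mem _ (mem_of_mem_nhds (polydisk_mem_nhds _ hε))).critical.natDegree_eq]; omega)
  · simp only [coeff_derivative]
    exact ((ch.tendsto_coeff hε _).comp hw).mul_const _

theorem tendsto_iterate (k : ℕ) {z : (Fin ν → ℂ) → ℂ} {x : ℝ}
    (hz : Tendsto z (𝓝 (toComplex (critValues P₀ c₀))) (𝓝 (x : ℂ))) :
    Tendsto (fun w => (F w).eval^[k] (z w)) (𝓝 (toComplex (critValues P₀ c₀)))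
      (𝓝 ((P₀.eval^[k] x : ℝ) : ℂ)) := by
  induction k with
  | zero => exact hz
  | succ k ih =>
    simp only [Function.iterate_succ_apply']
    rw [← eval_map_ofReal]
    exact ch.tendsto_eval hε tendsto_id ih

/-- Joint continuity in the parameter and the point, together with compactness of `K`, makes the
strict inequality persist uniformly. -/
theorem eventually_forall_norm_sub_lt {K : Set ℝ} (hK : IsCompact K) {y r : ℝ}
    (h : ∀ x ∈ K, |P₀.eval x - y| < r) : ∀ᶠ w in 𝓝 (toComplex (critValues P₀ c₀)), ∀ x ∈ K,
      ‖(F w).eval (x : ℂ) - y‖ < r := by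
  refine hK.eventually_forall_of_forall_eventually fun x hx => ?_
  have h1 := ch.tendsto_eval hε (l := 𝓝 (toComplex (critValues P₀ c₀), x)) (w := Prod.fst)
    (z := fun p => (p.2 : ℂ)) (continuous_fst.tendsto _)
    ((Complex.continuous_ofReal.comp continuous_snd).tendsto _)
  have h2 := (h1.sub_const (y : ℂ)).norm
  refine h2.eventually (gt_mem_nhds ?_)
  show ‖(P₀.map Complex.ofRealHom).eval (x : ℂ) - y‖ < r
  rw [eval_map_ofReal, ← Complex.ofReal_sub, Complex.norm_real]
  exact h x hx

theorem eventually_forall_norm_derivative_lt {K : Set ℝ} (hK : IsCompact K) {r : ℝ}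
    (h : ∀ x ∈ K, |P₀.derivative.eval x| < r) : ∀ᶠ w in 𝓝 (toComplex (critValues P₀ c₀)), ∀ x ∈ K,
      ‖(F w).derivative.eval (x : ℂ)‖ < r := by
  refine hK.eventually_forall_of_forall_eventually fun x hx => ?_
  have h1 := ch.tendsto_eval_derivative hε (l := 𝓝 (toComplex (critValues P₀ c₀), x))
    (w := Prod.fst) (z := fun p => (p.2 : ℂ)) (continuous_fst.tendsto _)
    ((Complex.continuous_ofReal.comp continuous_snd).tendsto _)
  refine h1.norm.eventually (gt_mem_nhds ?_)
  show ‖(P₀.derivative.map Complex.ofRealHom).eval (x : ℂ)‖ < r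
  rw [eval_map_ofReal, Complex.norm_real]
  exact h x hx

end IsCriticalValueChart

/-- The parameter `w` is so close to the base point that the trap `T` of the base map is a trap of
`F w`. -/
structure IsNear {m : ℕ} (d : ℕ) (μ : Fin (m + 1) → ℕ) (T : Trap) (M : ℝ)
    (F : (Fin (m + 1) → ℂ) → ℂ[X]) (c : (Fin (m + 1) → ℂ) → Fin (m + 1) → ℂ)
    (w : Fin (m + 1) → ℂ) : Prop where
  maps_a : ∀ x ∈ Icc (T.a - T.ra) (T.a + T.ra), ‖(F w).eval (x : ℂ) - T.c‖ < T.rc / 2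
  maps_c : ∀ x ∈ Icc (T.c - T.rc) (T.c + T.rc), ‖(F w).eval (x : ℂ) - T.b‖ < T.rb / 2
  maps_b : ∀ x ∈ Icc (T.b - T.rb) (T.b + T.rb), ‖(F w).eval (x : ℂ) - T.a‖ < T.ra / 2
  deriv_a : ∀ x ∈ Icc (T.a - T.ra) (T.a + T.ra), ‖(F w).derivative.eval (x : ℂ)‖ < M
  deriv_c : ∀ x ∈ Icc (T.c - T.rc) (T.c + T.rc),
    ‖(F w).derivative.eval (x : ℂ)‖ < 1 / (64 * M ^ 2)
  deriv_b : ∀ x ∈ Icc (T.b - T.rb) (T.b + T.rb), ‖(F w).derivative.eval (x : ℂ)‖ < M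
  -- For complex `w` the value need not be real. Taking real parts keeps the condition meaningful
  -- and changes nothing for real parameters.
  expand : ∀ x ∈ T.core, ((F w).eval (x : ℂ)).re ∈ T.core →
    T.κ * crossDensity T.a T.c T.b x <
      ‖(F w).derivative.eval (x : ℂ)‖ * crossDensity T.a T.c T.b ((F w).eval (x : ℂ)).re
  re_lt : ∀ i j, i < j → (c w i).re < (c w j).re
  re_mem : ∀ i, (c w i).re ∈ Ioo (0 : ℝ) 1
  re_low : ∀ i, i ≠ Fin.last m → (c w i).re < T.a - T.ra
  re_near : |(c w (Fin.last m)).re - T.c| < T.rc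
  lead : ((d : ℂ) * (F w).coeff d).re < 0
  value_mem : ∀ i, (w i).re ∈ Ioo (0 : ℝ) 1
  orbit : ∀ i, Odd (μ i) → ∃ k, ((F w).eval^[k] (c w i)).re ∈
    Ioo ((F w).eval^[2] (c w (Fin.last m))).re ((F w).eval^[1] (c w (Fin.last m))).re

/-! ### Persistence of the trap conditions -/

section Near

variable {d m : ℕ} {μ : Fin (m + 1) → ℕ} {P₀ : ℝ[X]} {c₀ : Fin (m + 1) → ℝ} {ε : ℝ}
  {F : (Fin (m + 1) → ℂ) → ℂ[X]} {c : (Fin (m + 1) → ℂ) → Fin (m + 1) → ℂ} {T : Trap} {M : ℝ}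

theorem IsBaseMap.eventually_isNear (h : IsBaseMap d μ P₀ c₀) (hd : 3 ≤ d) (hμ : ∀ i, 1 ≤ μ i)
    (hμd : ∑ i, μ i = d - 1) (ch : IsCriticalValueChart d μ P₀ c₀ ε F c) (hε : 0 < ε)
    (hT : T.IsBase P₀ c₀ M) :
    ∀ᶠ w in 𝓝 (toComplex (critValues P₀ c₀)), IsNear d μ T M F c w := by
  have hre : ∀ i, Tendsto (fun w => (c w i).re) (𝓝 (toComplex (critValues P₀ c₀))) (𝓝 (c₀ i)) :=
    fun i => (Complex.continuous_re.tendsto _).comp (ch.tendsto_critical hε i)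
  have hcore := T.core_subset_Ioo hT.ra_pos hT.rc_pos hT.rb_pos
  have e1 := ch.eventually_forall_norm_sub_lt hε isCompact_Icc hT.maps_a
  have e2 := ch.eventually_forall_norm_sub_lt hε isCompact_Icc hT.maps_c
  have e3 := ch.eventually_forall_norm_sub_lt hε isCompact_Icc hT.maps_b
  have e4 := ch.eventually_forall_norm_derivative_lt hε isCompact_Icc hT.deriv_a
  have e5 := ch.eventually_forall_norm_derivative_lt hε isCompact_Icc hT.deriv_c
  have e6 := ch.eventually_forall_norm_derivative_lt hε isCompact_Icc hT.deriv_b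
  have e7 : ∀ᶠ w in 𝓝 (toComplex (critValues P₀ c₀)), ∀ x ∈ T.core,
      ((F w).eval (x : ℂ)).re ∈ T.core → T.κ * crossDensity T.a T.c T.b x <
        ‖(F w).derivative.eval (x : ℂ)‖ * crossDensity T.a T.c T.b ((F w).eval (x : ℂ)).re := by
    refine T.isCompact_core.eventually_forall_of_forall_eventually fun x hx => ?_
    have t1 := ch.tendsto_eval hε (l := 𝓝 (toComplex (critValues P₀ c₀), x)) (w := Prod.fst)
      (z := fun p => (p.2 : ℂ)) (continuous_fst.tendsto _)
      ((Complex.continuous_ofReal.comp continuous_snd).tendsto _)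
    have t2 := ch.tendsto_eval_derivative hε (l := 𝓝 (toComplex (critValues P₀ c₀), x))
      (w := Prod.fst) (z := fun p => (p.2 : ℂ)) (continuous_fst.tendsto _)
      ((Complex.continuous_ofReal.comp continuous_snd).tendsto _)
    have t3 := (Complex.continuous_re.tendsto _).comp t1
    have r1 : ((P₀.map Complex.ofRealHom).eval (x : ℂ)).re = P₀.eval x := by
      rw [eval_map_ofReal, Complex.ofReal_re]
    have r2 : ‖(P₀.derivative.map Complex.ofRealHom).eval (x : ℂ)‖ = |P₀.derivative.eval x| := by
      rw [eval_map_ofReal, Complex.norm_real, Real.norm_eq_abs]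
    replace t3 : Tendsto (fun p : (Fin (m + 1) → ℂ) × ℝ => ((F p.1).eval (p.2 : ℂ)).re)
      (𝓝 (toComplex (critValues P₀ c₀), x)) (𝓝 (P₀.eval x)) := r1 ▸ t3
    replace t2 : Tendsto (fun p : (Fin (m + 1) → ℂ) × ℝ => ‖(F p.1).derivative.eval (p.2 : ℂ)‖)
      (𝓝 (toComplex (critValues P₀ c₀), x)) (𝓝 |P₀.derivative.eval x|) := r2 ▸ t2.norm
    -- If the image is outside the closed Markov intervals, it stays outside nearby and the
    -- condition is vacuous.
    by_cases hPx : P₀.eval x ∈ T.core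
    · have t4 : Tendsto (fun p : (Fin (m + 1) → ℂ) × ℝ =>
          crossDensity T.a T.c T.b ((F p.1).eval (p.2 : ℂ)).re)
          (𝓝 (toComplex (critValues P₀ c₀), x)) (𝓝 (crossDensity T.a T.c T.b (P₀.eval x))) :=
        (continuousAt_crossDensity (hcore hPx)).tendsto.comp t3
      have t5 : Tendsto (fun p : (Fin (m + 1) → ℂ) × ℝ => T.κ * crossDensity T.a T.c T.b p.2)
          (𝓝 (toComplex (critValues P₀ c₀), x)) (𝓝 (T.κ * crossDensity T.a T.c T.b x)) :=
        ((continuousAt_crossDensity (hcore hx)).tendsto.comp (continuous_snd.tendsto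
          (toComplex (critValues P₀ c₀), x))).const_mul _
      filter_upwards [t5.eventually_lt (t2.mul t4) (hT.expand x hx hPx)] with p hp _ using hp
    · filter_upwards [t3.eventually (T.isCompact_core.isClosed.isOpen_compl.mem_nhds hPx)]
        with p hp hp' using absurd hp' hp
  have e8 : ∀ᶠ w in 𝓝 (toComplex (critValues P₀ c₀)), ∀ i j, i < j →
      (c w i).re < (c w j).re := eventually_all.2 fun i => eventually_all.2 fun j => by
    by_cases hij : i < j
    · filter_upwards [(hre i).eventually_lt (hre j) (h.strictMono hij)] with w hw _ using hw
    · exact Eventually.of_forall fun w h => absurd h hij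
  have e9 : ∀ᶠ w in 𝓝 (toComplex (critValues P₀ c₀)), ∀ i, (c w i).re ∈ Ioo (0 : ℝ) 1 :=
    eventually_all.2 fun i => (hre i).eventually
      (isOpen_Ioo.mem_nhds (h.critical_mem_Ioo hd hμ hμd i))
  have e10 : ∀ᶠ w in 𝓝 (toComplex (critValues P₀ c₀)), ∀ i, i ≠ Fin.last m →
      (c w i).re < T.a - T.ra := eventually_all.2 fun i => by
    by_cases hi : i = Fin.last m
    · exact Eventually.of_forall fun w h => absurd hi h
    · filter_upwards [(hre i).eventually (gt_mem_nhds
        ((le_lowPoint h.strictMono hi).trans_lt hT.low_lt))] with w hw _ using hw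
  have e11 : ∀ᶠ w in 𝓝 (toComplex (critValues P₀ c₀)), |(c w (Fin.last m)).re - T.c| < T.rc := by
    have t := ((hre (Fin.last m)).sub_const T.c).abs
    rw [← hT.c_eq, sub_self, abs_zero] at t
    exact t.eventually (gt_mem_nhds hT.rc_pos)
  have e12 : ∀ᶠ w in 𝓝 (toComplex (critValues P₀ c₀)), ((d : ℂ) * (F w).coeff d).re < 0 := by
    have t := (Complex.continuous_re.tendsto _).comp ((ch.tendsto_coeff hε d).const_mul (d : ℂ))
    refine t.eventually (gt_mem_nhds ?_)
    rw [ch.base, coeff_map]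
    have := h.leadingCoeff_neg hd hμd
    have e : (d : ℂ) * Complex.ofRealHom (P₀.coeff d) = ((d * P₀.coeff d : ℝ) : ℂ) := by
      push_cast; rfl
    rw [e, Complex.ofReal_re]
    exact this
  have e13 : ∀ᶠ w in 𝓝 (toComplex (critValues P₀ c₀)), ∀ i, (w i).re ∈ Ioo (0 : ℝ) 1 :=
    eventually_all.2 fun i => by
      have t : Tendsto (fun w : Fin (m + 1) → ℂ => (w i).re) (𝓝 (toComplex (critValues P₀ c₀)))
          (𝓝 (P₀.eval (c₀ i))) :=
        (Complex.continuous_re.comp (continuous_apply i)).tendsto _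
      exact t.eventually (isOpen_Ioo.mem_nhds (h.critValue_mem hd hμ hμd i))
  have e14 : ∀ᶠ w in 𝓝 (toComplex (critValues P₀ c₀)), ∀ i, Odd (μ i) →
      ∃ k, ((F w).eval^[k] (c w i)).re ∈
        Ioo ((F w).eval^[2] (c w (Fin.last m))).re ((F w).eval^[1] (c w (Fin.last m))).re := by
    refine eventually_all.2 fun i => ?_
    by_cases hi : Odd (μ i)
    · have hturn : c₀ i ∈ turningPoints P₀.eval := ⟨h.critical_mem_Ioo hd hμ hμd i,
        (isLocalExtr_iff_odd (h.derivative_eq hd hμd) (h.leadingCoeff_ne hd)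
          h.critical.injective i).2 hi⟩
      obtain ⟨k, hk⟩ := h.exists_iterate_mem hturn
      have t : ∀ k i, Tendsto (fun w => ((F w).eval^[k] (c w i)).re)
          (𝓝 (toComplex (critValues P₀ c₀))) (𝓝 (P₀.eval^[k] (c₀ i))) := fun k i =>
        (Complex.continuous_re.tendsto _).comp
          (ch.tendsto_iterate hε k (ch.tendsto_critical hε i))
      filter_upwards [(t 2 (Fin.last m)).eventually_lt (t k i) hk.1,
        (t k i).eventually_lt (t 1 (Fin.last m)) hk.2] with w h1 h2 _
      exact ⟨k, h1, h2⟩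
    · exact Eventually.of_forall fun w h => absurd h hi
  filter_upwards [e1, e2, e3, e4, e5, e6, e7, e8, e9, e10, e11, e12, e13, e14] with w
    h1 h2 h3 h4 h5 h6 h7 h8 h9 h10 h11 h12 h13 h14
  exact ⟨h1, h2, h3, h4, h5, h6, h7, h8, h9, h10, h11, h12, h13, h14⟩

end Near

/-! ### Real parameters: critical points, traps and virtual unimodality -/

section Real

variable {d m : ℕ} {μ : Fin (m + 1) → ℕ} {P₀ : ℝ[X]} {c₀ : Fin (m + 1) → ℝ} {ε : ℝ}
  {F : (Fin (m + 1) → ℂ) → ℂ[X]} {c : (Fin (m + 1) → ℂ) → Fin (m + 1) → ℂ} {T : Trap} {M : ℝ}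

theorem iterate_eval_map_ofReal (P : ℝ[X]) (k : ℕ) (x : ℝ) :
    (P.map Complex.ofRealHom).eval^[k] (x : ℂ) = ((P.eval^[k] x : ℝ) : ℂ) := by
  induction k with
  | zero => rfl
  | succ k ih => rw [Function.iterate_succ_apply', ih, eval_map_ofReal, Function.iterate_succ_apply']

theorem IsRealParameter.mem_polydisk {ν : ℕ} {v : Fin ν → ℝ} {ε : ℝ} (hε : 0 < ε)
    {F : (Fin ν → ℂ) → ℂ[X]} {w : Fin ν → ℝ} {P : ℝ[X]} (h : IsRealParameter v ε F w P) :
    toComplex w ∈ polydisk v ε := by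
  rw [polydisk, Metric.mem_ball, dist_pi_lt_iff hε]
  intro i
  rw [toComplex, toComplex, Complex.dist_eq, ← Complex.ofReal_sub, Complex.norm_real]
  exact h.1 i

/-- The critical points of a nearby real polynomial of the family are real. -/
theorem exists_real_critical (ch : IsCriticalValueChart d μ P₀ c₀ ε F c) (hε : 0 < ε)
    (hd : 3 ≤ d) (hμ : ∀ i, 1 ≤ μ i) (hμd : ∑ i, μ i = d - 1) {w : Fin (m + 1) → ℝ} {P : ℝ[X]}
    (hw : IsRealParameter (critValues P₀ c₀) ε F w P) (hn : IsNear d μ T M F c (toComplex w)) :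
    ∃ γ : Fin (m + 1) → ℝ, StrictMono γ ∧ c (toComplex w) = toComplex γ ∧
      P.derivative = C (d * P.coeff d) * ∏ i, (X - C (γ i)) ^ μ i := by
  have hmem := (ch.mem _ (hw.mem_polydisk hε)).critical
  have hder := hmem.derivative_eq (by omega) hμd
  rw [← hw.2] at hder
  have hzero : ∀ z : ℂ, (P.derivative.map Complex.ofRealHom).eval z = 0 ↔
      ∃ i, z = c (toComplex w) i := by
    intro z
    have hlead : (d : ℂ) * (P.map Complex.ofRealHom).coeff d ≠ 0 := by
      rw [hw.2]
      exact mul_ne_zero (by exact_mod_cast (by omega : d ≠ 0)) (hmem.coeff_ne_zero (by omega))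
    rw [← derivative_map, hder, eval_mul, eval_C, mul_eq_zero, or_iff_right hlead, eval_prod,
      Finset.prod_eq_zero_iff]
    simp only [eval_pow, eval_sub, eval_X, eval_C]
    constructor
    · rintro ⟨i, -, hi⟩
      exact ⟨i, sub_eq_zero.1 (eq_zero_of_pow_eq_zero hi)⟩
    · rintro ⟨i, rfl⟩
      exact ⟨i, Finset.mem_univ i, by rw [sub_self, zero_pow]; have := hμ i; omega⟩
  have hreal : ∀ i, ((c (toComplex w) i).re : ℂ) = c (toComplex w) i := by
    intro i
    have h1 : (P.derivative.map Complex.ofRealHom).eval (c (toComplex w) i) = 0 :=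
      (hzero _).2 ⟨i, rfl⟩
    have h2 : (P.derivative.map Complex.ofRealHom).eval (starRingEnd ℂ (c (toComplex w) i)) = 0 := by
      have := congrArg (starRingEnd ℂ) h1
      rw [map_zero, eval_map, hom_eval₂] at this
      rw [eval_map]
      convert this using 2
      ext x
      simp
    obtain ⟨j, hj⟩ := (hzero _).1 h2
    -- The conjugate of a critical point is a critical point with the same real part, and the real
    -- parts are distinct.
    have hij : i = j := by
      have hre := congrArg Complex.re hj
      rw [Complex.conj_re] at hre
      rcases lt_trichotomy i j with h | h | h
      · exact absurd hre (hn.re_lt i j h).ne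
      · exact h
      · exact absurd hre (hn.re_lt j i h).ne'
    rw [← hij] at hj
    exact (Complex.conj_eq_iff_re.1 hj)
  refine ⟨fun i => (c (toComplex w) i).re, fun i j hij => hn.re_lt i j hij,
    funext fun i => (hreal i).symm, ?_⟩
  apply Polynomial.map_injective Complex.ofRealHom Complex.ofReal_injective
  rw [← derivative_map, hder]
  simp only [Polynomial.map_mul, Polynomial.map_prod, Polynomial.map_pow, Polynomial.map_sub,
    map_X, map_C, coeff_map]
  congr 1
  · simp
  · refine Finset.prod_congr rfl fun i _ => ?_
    congr 3
    exact (hreal i).symm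

variable {w : Fin (m + 1) → ℝ} {P : ℝ[X]} {γ : Fin (m + 1) → ℝ}

theorem IsNear.lead_neg (hn : IsNear d μ T M F c (toComplex w))
    (hP : P.map Complex.ofRealHom = F (toComplex w)) : (d : ℝ) * P.coeff d < 0 := by
  have h := hn.lead
  rw [← hP, coeff_map] at h
  have e : (d : ℂ) * Complex.ofRealHom (P.coeff d) = ((d * P.coeff d : ℝ) : ℂ) := by
    push_cast; rfl
  rwa [e, Complex.ofReal_re] at h

/-- The trap of the base map is a trap of nearby real polynomials of the family. -/
theorem IsNear.isFor (hn : IsNear d μ T M F c (toComplex w)) (hT : T.IsBase P₀ c₀ M)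
    (hd : 3 ≤ d) (hodd : Odd (μ (Fin.last m)))
    (hP : P.map Complex.ofRealHom = F (toComplex w)) (hγ : StrictMono γ)
    (hc : c (toComplex w) = toComplex γ)
    (hder : P.derivative = C (d * P.coeff d) * ∏ i, (X - C (γ i)) ^ μ i) :
    Trap.IsFor { T with l := lowPoint γ } P.eval (γ (Fin.last m)) := by
  have hev : ∀ x : ℝ, (F (toComplex w)).eval (x : ℂ) = ((P.eval x : ℝ) : ℂ) := fun x => by
    rw [← hP, eval_map_ofReal]
  have hevd : ∀ x : ℝ, (F (toComplex w)).derivative.eval (x : ℂ) =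
      ((P.derivative.eval x : ℝ) : ℂ) := fun x => by
    rw [← hP, derivative_map, eval_map_ofReal]
  have hγc : ∀ i, (c (toComplex w) i).re = γ i := fun i => by rw [hc]; rfl
  have hsub : ∀ x y : ℝ, ‖(x : ℂ) - y‖ = |x - y| := fun x y => by
    rw [← Complex.ofReal_sub, Complex.norm_real, Real.norm_eq_abs]
  have habs : ∀ {x z r : ℝ}, |x - z| ≤ r → x ∈ Icc (z - r) (z + r) := fun h =>
    ⟨by linarith [(abs_le.1 h).1], by linarith [(abs_le.1 h).2]⟩
  have hl := hn.lead_neg hP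
  have hra := hT.ra_pos; have hrc := hT.rc_pos; have hrb := hT.rb_pos
  have hcore := T.core_subset_Ioo hra hrc hrb
  have hlow : lowPoint γ ≤ T.a - T.ra := by
    rcases lowPoint_eq γ with ⟨-, h0⟩ | ⟨i, hi, h0⟩
    · rw [h0]; exact hT.pos_a.le
    · rw [h0, ← hγc]
      refine (hn.re_low i fun e => ?_).le
      rw [e] at hi
      simp at hi
  have hnear : |γ (Fin.last m) - T.c| ≤ T.rc := by
    have := hn.re_near.le
    rwa [hγc] at this
  have hnear' := abs_le.1 hnear
  have maps_a : ∀ x, |x - T.a| ≤ T.ra → |P.eval x - T.c| ≤ T.rc / 2 := fun x hx => by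
    have := hn.maps_a x (habs hx)
    rw [hev, hsub] at this
    exact this.le
  have maps_c : ∀ x, |x - T.c| ≤ T.rc → |P.eval x - T.b| ≤ T.rb / 2 := fun x hx => by
    have := hn.maps_c x (habs hx)
    rw [hev, hsub] at this
    exact this.le
  have maps_b : ∀ x, |x - T.b| ≤ T.rb → |P.eval x - T.a| ≤ T.ra / 2 := fun x hx => by
    have := hn.maps_b x (habs hx)
    rw [hev, hsub] at this
    exact this.le
  have da : ∀ x ∈ Icc (T.a - T.ra) (T.a + T.ra), |P.derivative.eval x| ≤ M := fun x hx => by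
    have := hn.deriv_a x hx
    rw [hevd, Complex.norm_real] at this
    exact this.le
  have db : ∀ x ∈ Icc (T.b - T.rb) (T.b + T.rb), |P.derivative.eval x| ≤ M := fun x hx => by
    have := hn.deriv_b x hx
    rw [hevd, Complex.norm_real] at this
    exact this.le
  have dc : ∀ x ∈ Icc (T.c - T.rc) (T.c + T.rc), |P.derivative.eval x| ≤ 1 / (64 * M ^ 2) :=
    fun x hx => by
      have := hn.deriv_c x hx
      rw [hevd, Complex.norm_real] at this
      exact this.le
  have hmono : StrictMonoOn P.eval (Icc (lowPoint γ) (γ (Fin.last m))) :=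
    strictMonoOn_Icc hder hl hodd fun i hi => le_lowPoint hγ hi
  have hanti : StrictAntiOn P.eval (Icc (γ (Fin.last m)) 1) :=
    (strictAntiOn_Ici hder hl fun i => hγ.monotone (Fin.le_last i)).mono Icc_subset_Ici_self
  have hdeg : 1 ≤ P.natDegree := by
    have : P.coeff d ≠ 0 := right_ne_zero_of_mul hl.ne
    have := le_natDegree_of_ne_zero this
    omega
  refine ⟨hra, hrc, hrb, hlow, hT.lt_one.le, hT.a_lt_c, hT.c_lt_b, P.continuous,
    finite_fiber_eval hdeg, maps_a, maps_c, maps_b, ?_, hnear, hmono, hanti, hT.one_lt, ?_, ?_, ?_⟩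
  · intro x y hx hy
    show |P.eval (P.eval (P.eval x)) - P.eval (P.eval (P.eval y))| ≤ |x - y| / 2
    have hM := hT.one_le
    have half : ∀ {x z r : ℝ}, 0 < r → |x - z| ≤ r / 2 → |x - z| ≤ r := fun hr h => by linarith
    have b1 := half hrb (maps_c x hx)
    have b2 := half hrb (maps_c y hy)
    have a1 := half hra (maps_b _ b1)
    have a2 := half hra (maps_b _ b2)
    have l1 := abs_eval_sub_le dc (habs hx) (habs hy)
    have l2 := abs_eval_sub_le db (habs b1) (habs b2)
    have l3 := abs_eval_sub_le da (habs a1) (habs a2)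
    -- The third iterate contracts by the product of the three derivative bounds, which is 1/64.
    calc |P.eval (P.eval (P.eval x)) - P.eval (P.eval (P.eval y))|
        ≤ M * (M * (1 / (64 * M ^ 2) * |x - y|)) :=
          l3.trans (by gcongr; exact l2.trans (by gcongr))
      _ = |x - y| / 64 := by field_simp
      _ ≤ |x - y| / 2 := by have := abs_nonneg (x - y); linarith
  · intro S hS S' hS' x hx y hy hPx hPy
    show T.κ * |T.H x - T.H y| ≤ |T.H (P.eval x) - T.H (P.eval y)|
    have hord : ∀ S ∈ ({T.left, T.right} : Set (Set ℝ)), S.OrdConnected ∧ S ⊆ T.core := by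
      rintro S (rfl | rfl)
      · exact ⟨ordConnected_Icc, subset_union_left⟩
      · exact ⟨ordConnected_Icc, subset_union_right⟩
    rw [hT.H_eq]
    refine expand_crossCoord (hord S hS).1 (hord S' hS').1 ((hord S hS).2.trans hcore)
      ((hord S' hS').2.trans hcore) ?_ (fun t ht hPt => ?_) hx hy hPx hPy
    · rcases hS with rfl | rfl
      · left
        refine hmono.monotoneOn.mono fun t ht => ⟨?_, ?_⟩
        · have := ht.1; simp only at this; linarith
        · have := ht.2; simp only at this; linarith
      · right
        refine hanti.antitoneOn.mono fun t ht => ⟨?_, ?_⟩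
        · have := ht.1; simp only at this; linarith
        · have h1 := ht.2; have h2 := hT.lt_one; simp only at h1; linarith
    · have := hn.expand t ((hord S hS).2 ht)
      rw [hev, hevd, Complex.ofReal_re, Complex.norm_real] at this
      exact (this ((hord S' hS').2 hPt)).le
  · obtain ⟨B, hB⟩ := T.isCompact_core.exists_bound_of_continuousOn (f := T.H) (by
      rw [hT.H_eq]
      exact fun x hx => (hasDerivAt_crossCoord (hcore hx)).continuousAt.continuousWithinAt)
    exact ⟨B, hB⟩
  · have hinj : ∀ u v, Icc u v ⊆ T.core → InjOn T.H (Icc u v) := by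
      intro u v huv
      rw [hT.H_eq]
      refine (strictMonoOn_of_deriv_pos (convex_Icc u v) (fun x hx =>
        (hasDerivAt_crossCoord (hcore (huv hx))).continuousAt.continuousWithinAt)
        fun x hx => ?_).injOn
      rw [(hasDerivAt_crossCoord (hcore (huv (interior_subset hx)))).deriv]
      exact crossDensity_pos (hcore (huv (interior_subset hx)))
    rintro S (rfl | rfl)
    · exact hinj _ _ subset_union_left
    · exact hinj _ _ subset_union_right

/-- Nearby real polynomials of the family are virtually unimodal. -/
theorem IsNear.isVirtuallyUnimodal (hn : IsNear d μ T M F c (toComplex w))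
    (hμ : ∀ i, 1 ≤ μ i) (hodd : Odd (μ (Fin.last m)))
    (hP : P.map Complex.ofRealHom = F (toComplex w)) (hγ : StrictMono γ)
    (hc : c (toComplex w) = toComplex γ)
    (hder : P.derivative = C (d * P.coeff d) * ∏ i, (X - C (γ i)) ^ μ i)
    (hval : ∀ i, P.eval (γ i) = w i) (hP0 : P.eval 0 ∈ Icc (0 : ℝ) 1)
    (hP1 : P.eval 1 ∈ Icc (0 : ℝ) 1)
    (hfor : Trap.IsFor { T with l := lowPoint γ } P.eval (γ (Fin.last m))) :
    IsVirtuallyUnimodal P (γ (Fin.last m)) := by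
  have hl := hn.lead_neg hP
  have hγc : ∀ i, (c (toComplex w) i).re = γ i := fun i => by rw [hc]; rfl
  have hγmem : ∀ i, γ i ∈ Ioo (0 : ℝ) 1 := fun i => by rw [← hγc]; exact hn.re_mem i
  have hcrit : ∀ x ∈ Icc (0 : ℝ) 1, IsLocalExtr P.eval x → ∃ i, x = γ i := by
    intro x _ hx
    have := hx.deriv_eq_zero
    rw [P.deriv] at this
    exact (eval_derivative_eq_zero_iff hμ hder hl.ne).1 this
  have hturn := hfor.turning_lt
  have huIcc : uIcc (P.eval^[2] (γ (Fin.last m))) (P.eval (γ (Fin.last m))) =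
      Icc (P.eval (P.eval (γ (Fin.last m)))) (P.eval (γ (Fin.last m))) :=
    uIcc_of_le (hturn.1.trans hturn.2).le
  have hextr : ∀ i, IsLocalExtr P.eval (γ i) ↔ Odd (μ i) :=
    isLocalExtr_iff_odd hder hl.ne hγ.injective
  refine ⟨?_, ?_, ?_, ?_⟩
  · have hne : (Icc (0 : ℝ) 1).Nonempty := ⟨0, by simp⟩
    -- Extreme values on `[0, 1]` occur at end points, where `P` agrees with `P₀`, or at critical
    -- points, whose values are the coordinates of `w`.
    have key : ∀ x ∈ Icc (0 : ℝ) 1, (IsMinOn P.eval (Icc 0 1) x ∨ IsMaxOn P.eval (Icc 0 1) x) →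
        P.eval x ∈ Icc (0 : ℝ) 1 := by
      intro x hx hext
      rcases eq_or_lt_of_le hx.1 with h0 | h0
      · rw [← h0]; exact hP0
      rcases eq_or_lt_of_le hx.2 with h1 | h1
      · rw [h1]; exact hP1
      have hloc : IsLocalExtr P.eval x := by
        rcases hext with h | h
        · exact Or.inl (h.isLocalMin (Icc_mem_nhds h0 h1))
        · exact Or.inr (h.isLocalMax (Icc_mem_nhds h0 h1))
      obtain ⟨i, rfl⟩ := hcrit x hx hloc
      rw [hval]
      exact Ioo_subset_Icc_self (hn.value_mem i)
    obtain ⟨x₁, hx₁, hmin⟩ := isCompact_Icc.exists_isMinOn hne P.continuous.continuousOn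
    obtain ⟨x₂, hx₂, hmax⟩ := isCompact_Icc.exists_isMaxOn hne P.continuous.continuousOn
    intro x hx
    exact ⟨(key x₁ hx₁ (Or.inl hmin)).1.trans (hmin hx),
      (hmax hx).trans (key x₂ hx₂ (Or.inr hmax)).2⟩
  · rw [huIcc, interior_Icc]
    apply Subset.antisymm
    · rintro x ⟨⟨hx, hext⟩, hxJ⟩
      obtain ⟨i, rfl⟩ := hcrit x (Ioo_subset_Icc_self hx) hext
      by_cases hi : i = Fin.last m
      · rw [hi]; rfl
      · have h1 := hn.re_low i hi
        rw [hγc] at h1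
        have h2 : T.a - T.ra ≤ P.eval (P.eval (γ (Fin.last m))) := hfor.bounds.2.2.1
        exact absurd hxJ.1 (by linarith)
    · rintro x rfl
      exact ⟨⟨hγmem _, (hextr _).2 hodd⟩, hturn⟩
  · intro n
    rw [huIcc]
    exact hfor.iterate_mem ⟨hturn.1.le, hturn.2.le⟩ n
  · have hev : ∀ k x, ((F (toComplex w)).eval^[k] ((x : ℝ) : ℂ)).re = P.eval^[k] x := fun k x => by
      rw [← hP, iterate_eval_map_ofReal, Complex.ofReal_re]
    have hk : ∀ i, ∃ k, Odd (μ i) → P.eval^[k] (γ i) ∈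
        Icc (P.eval (P.eval (γ (Fin.last m)))) (P.eval (γ (Fin.last m))) := by
      intro i
      by_cases hi : Odd (μ i)
      · obtain ⟨k, hk⟩ := hn.orbit i hi
        rw [hc] at hk
        simp only [toComplex, hev] at hk
        exact ⟨k, fun _ => Ioo_subset_Icc_self hk⟩
      · exact ⟨0, fun h => absurd h hi⟩
    choose k hk using hk
    -- The dynamical interval is forward invariant, so any common upper bound of the entry times
    -- works.
    refine ⟨∑ i, k i, ?_⟩
    rintro t ⟨ht, hext⟩
    obtain ⟨i, rfl⟩ := hcrit t (Ioo_subset_Icc_self ht) hext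
    have hle : k i ≤ ∑ j, k j := Finset.single_le_sum (fun _ _ => Nat.zero_le _) (Finset.mem_univ i)
    rw [huIcc, ← Nat.sub_add_cancel hle, Function.iterate_add_apply]
    exact hfor.iterate_mem (hk i ((hextr i).1 hext)) _

end Real

/-! ### Series of holomorphic functions of several variables -/

section Holomorphic

variable {E : Type*} [NormedAddCommGroup E] [NormedSpace ℂ E]

/-- The Cauchy estimate for the derivative in several variables. -/
theorem norm_fderiv_le_of_closedBall_subset {f : E → ℂ} {s : Set E} (hs : IsOpen s)
    (hf : DifferentiableOn ℂ f s) {x : E} {t C : ℝ} (ht : 0 < t) (hx : Metric.closedBall x t ⊆ s)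
    (hC : ∀ y ∈ s, ‖f y‖ ≤ C) : ‖fderiv ℂ f x‖ ≤ C / t := by
  have hxs : x ∈ s := hx (Metric.mem_closedBall_self ht.le)
  have hC0 : 0 ≤ C := (norm_nonneg _).trans (hC x hxs)
  refine ContinuousLinearMap.opNorm_le_bound _ (by positivity) fun v => ?_
  rcases eq_or_ne v 0 with rfl | hv
  · simp
  have hv' : 0 < ‖v‖ := norm_pos_iff.2 hv
  have hline : ∀ u ∈ Metric.closedBall (0 : ℂ) (t / ‖v‖), x + u • v ∈ s := fun u hu => by
    refine hx ?_
    rw [mem_closedBall_iff_norm, add_sub_cancel_left, norm_smul]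
    rw [mem_closedBall_zero_iff] at hu
    exact (le_div_iff₀ hv').1 hu
  have hd : ∀ u : ℂ, HasDerivAt (fun u : ℂ => x + u • v) v u := fun u => by
    simpa using ((hasDerivAt_id u).smul_const v).const_add x
  have hdiff : DifferentiableOn ℂ (fun u : ℂ => f (x + u • v))
      (Metric.closedBall (0 : ℂ) (t / ‖v‖)) := fun u hu =>
    (((hf.differentiableAt (hs.mem_nhds (hline u hu))).hasFDerivAt.comp_hasDerivAt u
      (hd u)).differentiableAt).differentiableWithinAt
  have hder : HasDerivAt (fun u : ℂ => f (x + u • v)) (fderiv ℂ f x v) 0 := by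
    have h0 : HasFDerivAt f (fderiv ℂ f x) (x + (0 : ℂ) • v) := by
      rw [zero_smul, add_zero]
      exact (hf.differentiableAt (hs.mem_nhds hxs)).hasFDerivAt
    exact h0.comp_hasDerivAt 0 (hd 0)
  have key := Complex.norm_deriv_le_of_forall_mem_sphere_norm_le (C := C) (div_pos ht hv')
    (hdiff.mono Metric.closure_ball_subset_closedBall).diffContOnCl
    fun u hu => hC _ (hline u (Metric.sphere_subset_closedBall hu))
  rw [hder.deriv] at key
  calc ‖fderiv ℂ f x v‖ ≤ C / (t / ‖v‖) := key
    _ = C / t * ‖v‖ := by field_simp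

/-- On a ball of half the available radius, the Cauchy estimate bounds the derivatives by a multiple
of `u k`, so the series may be differentiated term by term. -/
theorem differentiableOn_tsum_of_open {f : ℕ → E → ℂ} {s : Set E} {u : ℕ → ℝ} (hs : IsOpen s)
    (hu : Summable u) (hf : ∀ k, DifferentiableOn ℂ (f k) s)
    (hb : ∀ k, ∀ x ∈ s, ‖f k x‖ ≤ u k) : DifferentiableOn ℂ (fun x => ∑' k, f k x) s := by
  intro x hx
  obtain ⟨t, ht, hts⟩ := Metric.isOpen_iff.1 hs x hx
  have hsub : Metric.ball x (t / 2) ⊆ s := (Metric.ball_subset_ball (by linarith)).trans hts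
  refine (hasFDerivAt_tsum_of_isPreconnected (𝕜 := ℂ) (f' := fun k => fderiv ℂ (f k))
    (u := fun k => u k / (t / 2)) (hu.div_const _) Metric.isOpen_ball
    (convex_ball x (t / 2)).isPreconnected
    (fun k y hy => ((hf k).differentiableAt (hs.mem_nhds (hsub hy))).hasFDerivAt)
    (fun k y hy => norm_fderiv_le_of_closedBall_subset hs (hf k) (half_pos ht) ?_ (hb k))
    (Metric.mem_ball_self (half_pos ht)) ?_
    (Metric.mem_ball_self (half_pos ht))).differentiableAt.differentiableWithinAt
  · refine (Metric.closedBall_subset_ball' ?_).trans hts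
    have := Metric.mem_ball.1 hy
    linarith
  · exact Summable.of_norm_bounded hu fun k => hb k x hx

end Holomorphic

/-! ### Shadowing of expanding orbits -/

/-- The iterates of the Newton-like scheme that improves the orbit `x`, with multipliers `D`, to an
orbit of `f`. -/
def shadowSeq (f : ℂ → ℂ) (D x : ℕ → ℂ) : ℕ → ℕ → ℂ
  | 0, n => x n
  | k + 1, n => shadowSeq f D x k n - (f (shadowSeq f D x k n) - shadowSeq f D x k (n + 1)) / D n

/-- The orbit of `f` that shadows `x`. -/
def shadow (f : ℂ → ℂ) (D x : ℕ → ℂ) (n : ℕ) : ℂ :=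
  x n + ∑' k, (shadowSeq f D x (k + 1) n - shadowSeq f D x k n)

/-- In the weights `ρ`, the sequence `x` is expanded by the multipliers `D`, which are close to the
derivatives of `f`, and is almost an orbit of `f`. -/
structure IsShadowable (f : ℂ → ℂ) (D x : ℕ → ℂ) (ρ : ℕ → ℝ) (q δ r : ℝ) : Prop where
  ne_zero : ∀ n, D n ≠ 0
  pos : ∀ n, 0 < ρ n
  q_nonneg : 0 ≤ q
  δ_nonneg : 0 ≤ δ
  r_nonneg : 0 ≤ r
  lt_one : q + δ < 1
  expand : ∀ n, ρ n ≤ q * (‖D n‖ * ρ (n + 1))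
  -- The first correction has weighted size at most `r * (1 - (q + δ))`, so the geometric series of
  -- all corrections stays within `r`.
  close : ∀ n, ‖f (x n) - x (n + 1)‖ * ρ n ≤ r * (1 - (q + δ)) * ‖D n‖
  contract : ∀ n z z', ‖z - x n‖ * ρ n ≤ r → ‖z' - x n‖ * ρ n ≤ r →
    ‖(z - f z / D n) - (z' - f z' / D n)‖ ≤ δ * ‖z - z'‖

theorem shadowSeq_eq_self {f : ℂ → ℂ} {D x : ℕ → ℂ} (h : ∀ n, f (x n) = x (n + 1)) (k n : ℕ) :
    shadowSeq f D x k n = x n := by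
  induction k generalizing n with
  | zero => rfl
  | succ k ih => simp only [shadowSeq, ih, h, sub_self, zero_div, sub_zero]

theorem shadow_eq_self {f : ℂ → ℂ} {D x : ℕ → ℂ} (h : ∀ n, f (x n) = x (n + 1)) (n : ℕ) :
    shadow f D x n = x n := by
  simp [shadow, shadowSeq_eq_self h]

namespace IsShadowable

variable {f : ℂ → ℂ} {D x : ℕ → ℂ} {ρ : ℕ → ℝ} {q δ r : ℝ} (h : IsShadowable f D x ρ q δ r)
include h

/-- A new correction at time `n` has two parts: the old one at `n`, contracted by `δ`, and the old
one at `n + 1` divided by `D n`, contracted by `q` in the weights. The second clause keeps the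
iterates where the contraction is valid, so both are proved together. -/
theorem norm_shadowSeq_sub (k : ℕ) :
    (∀ n, ‖shadowSeq f D x (k + 1) n - shadowSeq f D x k n‖ * ρ n ≤
      (q + δ) ^ k * (r * (1 - (q + δ)))) ∧
    ∀ n, ‖shadowSeq f D x k n - x n‖ * ρ n ≤ r * (1 - (q + δ) ^ k) := by
  have hq := h.q_nonneg
  have hδ := h.δ_nonneg
  have hr := h.r_nonneg
  have hlt := h.lt_one
  induction k with
  | zero =>
    refine ⟨fun n => ?_, fun n => by simp [shadowSeq]⟩
    have hD := norm_pos_iff.2 (h.ne_zero n)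
    have e : shadowSeq f D x 1 n - shadowSeq f D x 0 n = -((f (x n) - x (n + 1)) / D n) := by
      simp only [shadowSeq]; ring
    rw [e, norm_neg, norm_div, div_mul_eq_mul_div, div_le_iff₀ hD, pow_zero, one_mul]
    exact h.close n
  | succ k ih =>
    have h2 : ∀ n, ‖shadowSeq f D x (k + 1) n - x n‖ * ρ n ≤ r * (1 - (q + δ) ^ (k + 1)) := by
      intro n
      have hρ := h.pos n
      calc ‖shadowSeq f D x (k + 1) n - x n‖ * ρ n
          ≤ (‖shadowSeq f D x (k + 1) n - shadowSeq f D x k n‖ +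
              ‖shadowSeq f D x k n - x n‖) * ρ n := by
            gcongr
            exact norm_sub_le_norm_sub_add_norm_sub _ _ _
        _ ≤ (q + δ) ^ k * (r * (1 - (q + δ))) + r * (1 - (q + δ) ^ k) := by
            rw [add_mul]; exact add_le_add (ih.1 n) (ih.2 n)
        _ = r * (1 - (q + δ) ^ (k + 1)) := by ring
    refine ⟨fun n => ?_, h2⟩
    have hρ := h.pos n
    have hρ' := h.pos (n + 1)
    have hD := norm_pos_iff.2 (h.ne_zero n)
    have hle : ∀ j, r * (1 - (q + δ) ^ j) ≤ r := fun j => by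
      have : 0 ≤ r * (q + δ) ^ j := by positivity
      linarith
    have hc := h.contract n _ _ ((h2 n).trans (hle _)) ((ih.2 n).trans (hle _))
    have e : shadowSeq f D x (k + 1 + 1) n - shadowSeq f D x (k + 1) n =
        ((shadowSeq f D x (k + 1) n - f (shadowSeq f D x (k + 1) n) / D n) -
          (shadowSeq f D x k n - f (shadowSeq f D x k n) / D n)) +
        (shadowSeq f D x (k + 1) (n + 1) - shadowSeq f D x k (n + 1)) / D n := by
      have e1 : shadowSeq f D x (k + 1 + 1) n = shadowSeq f D x (k + 1) n -
        (f (shadowSeq f D x (k + 1) n) - shadowSeq f D x (k + 1) (n + 1)) / D n := rfl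
      have e2 : shadowSeq f D x (k + 1) n = shadowSeq f D x k n -
        (f (shadowSeq f D x k n) - shadowSeq f D x k (n + 1)) / D n := rfl
      rw [e1]
      nth_rewrite 3 [e2]
      ring
    have h3 : ‖(shadowSeq f D x (k + 1) (n + 1) - shadowSeq f D x k (n + 1)) / D n‖ * ρ n ≤
        q * ((q + δ) ^ k * (r * (1 - (q + δ)))) := by
      rw [norm_div, div_mul_eq_mul_div, div_le_iff₀ hD]
      calc ‖shadowSeq f D x (k + 1) (n + 1) - shadowSeq f D x k (n + 1)‖ * ρ n
          ≤ ‖shadowSeq f D x (k + 1) (n + 1) - shadowSeq f D x k (n + 1)‖ *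
            (q * (‖D n‖ * ρ (n + 1))) := by gcongr; exact h.expand n
        _ = q * ‖D n‖ * (‖shadowSeq f D x (k + 1) (n + 1) - shadowSeq f D x k (n + 1)‖ *
            ρ (n + 1)) := by ring
        _ ≤ q * ‖D n‖ * ((q + δ) ^ k * (r * (1 - (q + δ)))) := 
            mul_le_mul_of_nonneg_left (ih.1 (n + 1)) (by positivity)
        _ = _ := by ring
    calc ‖shadowSeq f D x (k + 1 + 1) n - shadowSeq f D x (k + 1) n‖ * ρ n
        ≤ (δ * ‖shadowSeq f D x (k + 1) n - shadowSeq f D x k n‖ +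
          ‖(shadowSeq f D x (k + 1) (n + 1) - shadowSeq f D x k (n + 1)) / D n‖) * ρ n := by
          gcongr
          rw [e]
          exact (norm_add_le _ _).trans (add_le_add hc le_rfl)
      _ = δ * (‖shadowSeq f D x (k + 1) n - shadowSeq f D x k n‖ * ρ n) +
          ‖(shadowSeq f D x (k + 1) (n + 1) - shadowSeq f D x k (n + 1)) / D n‖ * ρ n := by ring
      _ ≤ δ * ((q + δ) ^ k * (r * (1 - (q + δ)))) + q * ((q + δ) ^ k * (r * (1 - (q + δ)))) :=
          add_le_add (mul_le_mul_of_nonneg_left (ih.1 n) hδ) h3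
      _ = (q + δ) ^ (k + 1) * (r * (1 - (q + δ))) := by ring

theorem norm_shadowSeq_succ_sub_le (k n : ℕ) :
    ‖shadowSeq f D x (k + 1) n - shadowSeq f D x k n‖ ≤
      (q + δ) ^ k * (r * (1 - (q + δ)) / ρ n) := by
  rw [← mul_div_assoc, le_div_iff₀ (h.pos n)]
  exact (h.norm_shadowSeq_sub k).1 n

theorem summable_bound (n : ℕ) : Summable fun k => (q + δ) ^ k * (r * (1 - (q + δ)) / ρ n) :=
  (summable_geometric_of_lt_one (add_nonneg h.q_nonneg h.δ_nonneg) h.lt_one).mul_right _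

theorem tendsto_shadowSeq (n : ℕ) :
    Tendsto (fun k => shadowSeq f D x k n) atTop (𝓝 (shadow f D x n)) := by
  have hs : Summable fun k => shadowSeq f D x (k + 1) n - shadowSeq f D x k n :=
    Summable.of_norm_bounded (h.summable_bound n) fun k => h.norm_shadowSeq_succ_sub_le k n
  have ht := (hs.hasSum.tendsto_sum_nat).const_add (x n)
  refine ht.congr fun k => ?_
  rw [Finset.sum_range_sub fun k => shadowSeq f D x k n]
  simp [shadowSeq]

theorem norm_shadow_sub (n : ℕ) : ‖shadow f D x n - x n‖ * ρ n ≤ r := by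
  refine le_of_tendsto (((h.tendsto_shadowSeq n).sub_const (x n)).norm.mul_const (ρ n))
    (Eventually.of_forall fun k => ((h.norm_shadowSeq_sub k).2 n).trans ?_)
  have : 0 ≤ r * (q + δ) ^ k :=
    mul_nonneg h.r_nonneg (pow_nonneg (add_nonneg h.q_nonneg h.δ_nonneg) k)
  linarith

/-- The limit is a fixed point of the scheme, so its correction term vanishes. -/
theorem map_shadow (hf : Continuous f) (n : ℕ) : f (shadow f D x n) = shadow f D x (n + 1) := by
  have t1 := h.tendsto_shadowSeq n
  have t2 := (hf.tendsto _).comp t1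
  have t3 := t1.sub ((t2.sub (h.tendsto_shadowSeq (n + 1))).div_const (D n))
  have t4 := tendsto_nhds_unique ((tendsto_add_atTop_iff_nat 1).2 t1)
    (t3 : Tendsto (fun k => shadowSeq f D x (k + 1) n) atTop _)
  have h1 : (f (shadow f D x n) - shadow f D x (n + 1)) / D n = 0 := by
    linear_combination t4
  rcases div_eq_zero_iff.1 h1 with h2 | h2
  · exact sub_eq_zero.1 h2
  · exact absurd h2 (h.ne_zero n)

theorem iterate_shadow (hf : Continuous f) (n : ℕ) : f^[n] (shadow f D x 0) = shadow f D x n := by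
  induction n with
  | zero => rfl
  | succ n ih => rw [Function.iterate_succ_apply', ih, h.map_shadow hf]

/-- The shadowing orbit of a real orbit is real. -/
theorem shadow_im (hf : ∀ z : ℂ, z.im = 0 → (f z).im = 0) (hx : ∀ n, (x n).im = 0)
    (hD : ∀ n, (D n).im = 0) (n : ℕ) : (shadow f D x n).im = 0 := by
  have hk : ∀ k n, (shadowSeq f D x k n).im = 0 := by
    intro k
    induction k with
    | zero => exact hx
    | succ k ih =>
      intro n
      simp [shadowSeq, Complex.div_im, ih, hf _ (ih n), hD]
  refine tendsto_nhds_unique ((Complex.continuous_im.tendsto _).comp (h.tendsto_shadowSeq n)) ?_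
  simp [Function.comp_def, hk]

end IsShadowable

/-- The shadowing orbits depend holomorphically on parameters. -/
theorem differentiableOn_shadow {E : Type*} [NormedAddCommGroup E] [NormedSpace ℂ E] {s : Set E}
    (hs : IsOpen s) {F : E → ℂ → ℂ} {D x : ℕ → ℂ} {ρ : ℕ → ℝ} {q δ r : ℝ}
    (hF : ∀ z : E → ℂ, DifferentiableOn ℂ z s → DifferentiableOn ℂ (fun w => F w (z w)) s)
    (h : ∀ w ∈ s, IsShadowable (F w) D x ρ q δ r) (n : ℕ) :
    DifferentiableOn ℂ (fun w => shadow (F w) D x n) s := by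
  rcases s.eq_empty_or_nonempty with rfl | ⟨w₀, hw₀⟩
  · exact differentiableOn_empty
  have hk : ∀ k n, DifferentiableOn ℂ (fun w => shadowSeq (F w) D x k n) s := by
    intro k
    induction k with
    | zero => exact fun n => differentiableOn_const _
    | succ k ih =>
      intro n
      simp only [shadowSeq, div_eq_mul_inv]
      exact (ih n).sub (((hF _ (ih n)).sub (ih (n + 1))).mul_const (D n)⁻¹)
  -- The bounds involve only the unperturbed orbit, so the convergence is uniform in the parameter.
  exact (differentiableOn_const _).add (differentiableOn_tsum_of_open hs
    ((h w₀ hw₀).summable_bound n) (fun k => (hk (k + 1) n).sub (hk k n))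
    fun k w hw => (h w hw).norm_shadowSeq_succ_sub_le k n)

/-! ### The holomorphic motion of the invariant set -/

/-- The gap between the two Markov intervals has length `2 * T.rc`. -/
theorem Trap.code_eq_of_abs_sub_lt {T : Trap} (hrc : 0 < T.rc) {x y : ℝ} (hx : x ∈ T.core)
    (hy : y ∈ T.core) (hxy : |x - y| < 2 * T.rc) : T.code x = T.code y := by
  have h := abs_lt.1 hxy
  unfold Trap.code
  rcases hx with hx | hx <;> rcases hy with hy | hy
  · rw [if_pos (by linarith [hx.2]), if_pos (by linarith [hy.2])]
  · exfalso; linarith [hx.2, hy.1]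
  · exfalso; linarith [hx.1, hy.2]
  · rw [if_neg (by linarith [hx.1]), if_neg (by linarith [hy.1])]

/-- An orbit close to a sequence in the Markov intervals stays in the Markov intervals. -/
theorem Trap.IsFor.mem_core_of_shadows {T : Trap} {f : ℝ → ℝ} {γ η : ℝ} (h : T.IsFor f γ)
    (ha : 2 * η < T.ra) (hc : 2 * η < T.rc) (hb : 2 * η < T.rb) {x : ℕ → ℝ} {y : ℝ}
    (hx : ∀ n, x n ∈ T.core) (hxy : ∀ n, |f^[n] y - x n| ≤ η) (n : ℕ) : f^[n] y ∈ T.core := by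
  have hrc := h.rc_pos
  have hac := h.a_lt_c
  have hcb := h.c_lt_b
  have hra := h.ra_pos
  have hrb := h.rb_pos
  have h1 := abs_le.1 (hxy n)
  have h2 := abs_le.1 (hxy (n + 1))
  have hη : 0 ≤ η := (abs_nonneg _).trans (hxy n)
  have hbd : T.a + T.ra ≤ x n ∧ x n ≤ T.b - T.rb := by
    rcases hx n with e | e
    · exact ⟨e.1, by linarith [e.2]⟩
    · exact ⟨by linarith [e.1], e.2⟩
  -- A point of the trap is mapped within half a radius of the next center, hence farther than `η`
  -- from the Markov intervals, but its image is `η`-close to a point there.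
  refine (h.near_or_core (by linarith) (by linarith)).resolve_left fun hnear => ?_
  have h3 := h.map_near hnear
  rw [Function.iterate_succ_apply'] at h2
  simp only [abs_le] at h3
  rcases hx (n + 1) with e | e <;> have e1 := e.1 <;> have e2 := e.2 <;>
    rcases h3 with ⟨h4, h5⟩ | ⟨h4, h5⟩ | ⟨h4, h5⟩ <;> linarith

/-- The multipliers along the orbit of a real point. -/
def orbitMult (P : ℝ[X]) (x : ℝ) (n : ℕ) : ℂ := ((P.derivative.eval (P.eval^[n] x) : ℝ) : ℂ)

/-- The orbit of a real point as a sequence of complex numbers. -/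
def complexOrbit (P : ℝ[X]) (x : ℝ) (n : ℕ) : ℂ := ((P.eval^[n] x : ℝ) : ℂ)

/-- The points of the Markov intervals that are mapped into the Markov intervals. -/
def Trap.core₂ (T : Trap) (P : ℝ[X]) : Set ℝ := T.core ∩ P.eval ⁻¹' T.core

/-- The polynomial `Q` is so close to `P` that the orbits of `P` in the Markov intervals are
shadowed by orbits of `Q`. -/
structure Trap.Shadows (T : Trap) (P : ℝ[X]) (δ r : ℝ) (Q : ℂ[X]) : Prop where
  close : ∀ x ∈ T.core₂ P, ‖Q.eval (x : ℂ) - (P.eval x : ℝ)‖ * crossDensity T.a T.c T.b x ≤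
    r * (1 - (T.κ⁻¹ + δ)) * |P.derivative.eval x|
  contract : ∀ x ∈ T.core₂ P, ∀ z z' : ℂ, ‖z - x‖ * crossDensity T.a T.c T.b x ≤ r →
    ‖z' - x‖ * crossDensity T.a T.c T.b x ≤ r →
    ‖(z - Q.eval z / (P.derivative.eval x : ℝ)) - (z' - Q.eval z' / (P.derivative.eval x : ℝ))‖ ≤
      δ * ‖z - z'‖

/-! ### Shadowing the orbits of the base map in the family -/

section Shadow

variable {d m : ℕ} {μ : Fin (m + 1) → ℕ} {P₀ : ℝ[X]} {c₀ : Fin (m + 1) → ℝ} {ε : ℝ}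
  {F : (Fin (m + 1) → ℂ) → ℂ[X]} {c : (Fin (m + 1) → ℂ) → Fin (m + 1) → ℂ} {T : Trap} {M : ℝ}

theorem Trap.IsBase.derivative_ne_zero (hT : T.IsBase P₀ c₀ M) {x : ℝ} (hx : x ∈ T.core₂ P₀) :
    P₀.derivative.eval x ≠ 0 := by
  intro h0
  have h1 := hT.expand x hx.1 hx.2
  rw [h0, abs_zero, zero_mul] at h1
  have h2 := crossDensity_pos (T.core_subset_Ioo hT.ra_pos hT.rc_pos hT.rb_pos hx.1)
  have := hT.one_lt
  have : 0 < T.κ * crossDensity T.a T.c T.b x := by positivity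
  linarith

/-- Polynomials close to the base map shadow its orbits. -/
theorem Trap.IsBase.eventually_shadows (hT : T.IsBase P₀ c₀ M)
    (ch : IsCriticalValueChart d μ P₀ c₀ ε F c) (hε : 0 < ε) {η : ℝ} (hη : 0 < η) :
    ∃ δ r, 0 ≤ δ ∧ T.κ⁻¹ + δ < 1 ∧ 0 < r ∧ (∀ x ∈ T.core, r ≤ η * crossDensity T.a T.c T.b x) ∧
      ∀ᶠ w in 𝓝 (toComplex (critValues P₀ c₀)), T.Shadows P₀ δ r (F w) := by
  have hκ := hT.one_lt
  have hκ' : T.κ⁻¹ < 1 := inv_lt_one_of_one_lt₀ hκ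
  have hcore := T.core_subset_Ioo hT.ra_pos hT.rc_pos hT.rb_pos
  have hcomp : IsCompact (T.core₂ P₀) :=
    T.isCompact_core.inter_right (T.isCompact_core.isClosed.preimage P₀.continuous)
  obtain ⟨ρ₀, hρ₀, hρ⟩ := T.isCompact_core.exists_forall_le' (a := 0)
    (f := crossDensity T.a T.c T.b)
    (fun x hx => (continuousAt_crossDensity (hcore hx)).continuousWithinAt)
    fun x hx => crossDensity_pos (hcore hx)
  obtain ⟨δ, hδ0, hδ⟩ : ∃ δ, 0 < δ ∧ T.κ⁻¹ + δ < 1 := ⟨(1 - T.κ⁻¹) / 2, by linarith, by linarith⟩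
  -- This is the derivative of the Newton map `z - Q(z) / P₀'(x)`; it vanishes at `z = x` for the
  -- base map.
  have e1 : ∀ᶠ p : (Fin (m + 1) → ℂ) × ℂ in 𝓝 (toComplex (critValues P₀ c₀), 0),
      ∀ x ∈ T.core₂ P₀,
        ‖1 - (F p.1).derivative.eval (x + p.2) / (P₀.derivative.eval x : ℝ)‖ < δ := by
    refine hcomp.eventually_forall_of_forall_eventually fun x hx => ?_
    have hx0 := hT.derivative_ne_zero hx
    have t1 := ch.tendsto_eval_derivative hε
      (l := 𝓝 ((toComplex (critValues P₀ c₀), (0 : ℂ)), x)) (w := fun p => p.1.1)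
      (z := fun p => (p.2 : ℂ) + p.1.2) (z₀ := (x : ℂ) + 0)
      ((continuous_fst.comp continuous_fst).tendsto _)
      (((Complex.continuous_ofReal.comp continuous_snd).add
        (continuous_snd.comp continuous_fst)).tendsto _)
    have t2 : Tendsto (fun p : ((Fin (m + 1) → ℂ) × ℂ) × ℝ => ((P₀.derivative.eval p.2 : ℝ) : ℂ))
        (𝓝 ((toComplex (critValues P₀ c₀), (0 : ℂ)), x))
        (𝓝 ((P₀.derivative.eval x : ℝ) : ℂ)) :=
      (Complex.continuous_ofReal.comp (P₀.derivative.continuous.comp continuous_snd)).tendsto _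
    have hne : ((P₀.derivative.eval x : ℝ) : ℂ) ≠ 0 := Complex.ofReal_ne_zero.2 hx0
    have t3 := ((t1.div t2 hne).const_sub 1).norm
    rw [add_zero, eval_map_ofReal, div_self hne, sub_self, norm_zero] at t3
    exact t3.eventually (gt_mem_nhds hδ0)
  rw [nhds_prod_eq, eventually_prod_iff] at e1
  obtain ⟨pa, hpa, pb, hpb, hpab⟩ := e1
  obtain ⟨s, hs, hsb⟩ := Metric.eventually_nhds_iff_ball.1 hpb
  have hmin : 0 < min (s / 2) η := lt_min (half_pos hs) hη
  -- As `ρ₀` bounds the density below, weighted distance at most this product means Euclidean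
  -- distance at most `s / 2` and at most `η`.
  have hr : 0 < min (s / 2) η * ρ₀ := mul_pos hmin hρ₀
  have e2 : ∀ᶠ w in 𝓝 (toComplex (critValues P₀ c₀)), ∀ x ∈ T.core₂ P₀,
      ‖(F w).eval (x : ℂ) - (P₀.eval x : ℝ)‖ * crossDensity T.a T.c T.b x <
        min (s / 2) η * ρ₀ * (1 - (T.κ⁻¹ + δ)) * |P₀.derivative.eval x| := by
    refine hcomp.eventually_forall_of_forall_eventually fun x hx => ?_
    have t1 := ch.tendsto_eval hε (l := 𝓝 (toComplex (critValues P₀ c₀), x)) (w := Prod.fst)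
      (z := fun p => (p.2 : ℂ)) (z₀ := (x : ℂ)) (continuous_fst.tendsto _)
      ((Complex.continuous_ofReal.comp continuous_snd).tendsto _)
    have t2 : Tendsto (fun p : (Fin (m + 1) → ℂ) × ℝ => ((P₀.eval p.2 : ℝ) : ℂ))
        (𝓝 (toComplex (critValues P₀ c₀), x)) (𝓝 ((P₀.eval x : ℝ) : ℂ)) :=
      (Complex.continuous_ofReal.comp (P₀.continuous.comp continuous_snd)).tendsto _
    have t3 : Tendsto (fun p : (Fin (m + 1) → ℂ) × ℝ => crossDensity T.a T.c T.b p.2)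
        (𝓝 (toComplex (critValues P₀ c₀), x)) (𝓝 (crossDensity T.a T.c T.b x)) :=
      (continuousAt_crossDensity (hcore hx.1)).tendsto.comp
        (continuous_snd.tendsto (toComplex (critValues P₀ c₀), x))
    have t4 : Tendsto (fun p : (Fin (m + 1) → ℂ) × ℝ =>
        min (s / 2) η * ρ₀ * (1 - (T.κ⁻¹ + δ)) * |P₀.derivative.eval p.2|)
        (𝓝 (toComplex (critValues P₀ c₀), x))
        (𝓝 (min (s / 2) η * ρ₀ * (1 - (T.κ⁻¹ + δ)) * |P₀.derivative.eval x|)) :=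
      ((P₀.derivative.continuous.comp continuous_snd).abs.tendsto
        (toComplex (critValues P₀ c₀), x)).const_mul _
    refine ((t1.sub t2).norm.mul t3).eventually_lt t4 ?_
    rw [eval_map_ofReal, sub_self, norm_zero, zero_mul]
    have : 0 < 1 - (T.κ⁻¹ + δ) := by linarith
    have := abs_pos.2 (hT.derivative_ne_zero hx)
    positivity
  refine ⟨δ, min (s / 2) η * ρ₀, hδ0.le, hδ, hr, fun x hx => ?_, ?_⟩
  · exact mul_le_mul (min_le_right _ _) (hρ x hx) hρ₀.le hη.le
  · filter_upwards [e2, hpa] with w h2 hw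
    refine ⟨fun x hx => (h2 x hx).le, fun x hx z z' hz hz' => ?_⟩
    have hball : ∀ z : ℂ, ‖z - x‖ * crossDensity T.a T.c T.b x ≤ min (s / 2) η * ρ₀ →
        z ∈ Metric.ball (x : ℂ) s := by
      intro z hz
      rw [mem_ball_iff_norm]
      have h3 : ‖z - x‖ * ρ₀ ≤ min (s / 2) η * ρ₀ :=
        (mul_le_mul_of_nonneg_left (hρ x hx.1) (norm_nonneg _)).trans hz
      have h4 := (le_of_mul_le_mul_right h3 hρ₀).trans (min_le_left _ _)
      linarith
    refine (convex_ball (x : ℂ) s).norm_image_sub_le_of_norm_hasDerivWithin_le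
      (f := fun z => z - (F w).eval z / (P₀.derivative.eval x : ℝ))
      (f' := fun z => 1 - (F w).derivative.eval z / (P₀.derivative.eval x : ℝ))
      (fun y _ => ((hasDerivAt_id y).sub (((F w).hasDerivAt y).div_const _)).hasDerivWithinAt)
      (fun y hy => ?_) (hball z' hz') (hball z hz)
    have h5 := hpab hw (hsb (y - x) (by
      rw [mem_ball_zero_iff]; exact mem_ball_iff_norm.1 hy)) x hx
    simp only [add_sub_cancel] at h5
    exact h5.le

theorem Trap.iterate_mem_core₂ {f : ℝ[X]} {x : ℝ} (hx : x ∈ T.invSet f.eval) (n : ℕ) :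
    f.eval^[n] x ∈ T.core₂ f :=
  ⟨hx n, by
    have := hx (n + 1)
    rwa [Function.iterate_succ_apply'] at this⟩

theorem Trap.IsBase.isShadowable (hT : T.IsBase P₀ c₀ M) {δ r : ℝ} {Q : ℂ[X]} (hδ : 0 ≤ δ)
    (hδ' : T.κ⁻¹ + δ < 1) (hr : 0 < r) (hQ : T.Shadows P₀ δ r Q) {x : ℝ}
    (hx : x ∈ T.invSet P₀.eval) : IsShadowable Q.eval (orbitMult P₀ x) (complexOrbit P₀ x)
      (fun n => crossDensity T.a T.c T.b (P₀.eval^[n] x)) T.κ⁻¹ δ r := by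
  have hκ : 0 < T.κ := one_pos.trans hT.one_lt
  have hcore := T.core_subset_Ioo hT.ra_pos hT.rc_pos hT.rb_pos
  have hx2 := T.iterate_mem_core₂ hx
  refine ⟨fun n => Complex.ofReal_ne_zero.2 (hT.derivative_ne_zero (hx2 n)),
    fun n => crossDensity_pos (hcore (hx n)), (inv_pos.2 hκ).le, hδ, hr.le, hδ', fun n => ?_,
    fun n => ?_, fun n z z' hz hz' => hQ.contract _ (hx2 n) z z' hz hz'⟩
  · have h1 := hT.expand _ (hx2 n).1 (hx2 n).2
    rw [Function.iterate_succ_apply', orbitMult, Complex.norm_real, Real.norm_eq_abs,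
      le_inv_mul_iff₀ hκ]
    exact h1.le
  · have h1 := hQ.close _ (hx2 n)
    rw [complexOrbit, complexOrbit, Function.iterate_succ_apply', orbitMult, Complex.norm_real,
      Real.norm_eq_abs]
    exact h1

/-- The holomorphic motion: a point is moved with its itinerary. -/
def motion (P₀ : ℝ[X]) (Q : ℂ[X]) (z : ℂ) : ℂ :=
  shadow Q.eval (orbitMult P₀ z.re) (complexOrbit P₀ z.re) 0

theorem motion_base (P₀ : ℝ[X]) (x : ℝ) : motion P₀ (P₀.map Complex.ofRealHom) (x : ℂ) = x := by
  refine shadow_eq_self (fun n => ?_) 0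
  rw [complexOrbit, complexOrbit, eval_map_ofReal, Function.iterate_succ_apply']

section Motion

variable {δ r η : ℝ} (hT : T.IsBase P₀ c₀ M) (hδ : 0 ≤ δ) (hδ' : T.κ⁻¹ + δ < 1) (hr : 0 < r)
  (hrη : ∀ x ∈ T.core, r ≤ η * crossDensity T.a T.c T.b x)
include hT hδ hδ' hr hrη

theorem norm_iterate_motion_sub_le {Q : ℂ[X]} (hQ : T.Shadows P₀ δ r Q) {x : ℝ}
    (hx : x ∈ T.invSet P₀.eval) (n : ℕ) :
    ‖Q.eval^[n] (motion P₀ Q x) - (P₀.eval^[n] x : ℝ)‖ ≤ η := by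
  have hs := hT.isShadowable hδ hδ' hr hQ hx
  have h1 := (hs.norm_shadow_sub n).trans (hrη _ (hx n))
  rw [motion, Complex.ofReal_re, hs.iterate_shadow Q.continuous]
  exact le_of_mul_le_mul_right h1 (hs.pos n)

/-- Two points with the same image have orbits within `2 * η` of each other at all times. This is
less than the gap between the Markov intervals, so the itineraries agree. -/
theorem motion_injOn {L γ₀ : ℝ} (h0 : Trap.IsFor { T with l := L } P₀.eval γ₀) (hc : η < T.rc)
    {Q : ℂ[X]} (hQ : T.Shadows P₀ δ r Q) :
    InjOn (motion P₀ Q) (Complex.ofReal '' T.invSet P₀.eval) := by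
  rintro _ ⟨x, hx, rfl⟩ _ ⟨y, hy, rfl⟩ hxy
  refine congrArg _ (h0.itin_injOn hx hy (funext fun n => ?_))
  refine T.code_eq_of_abs_sub_lt hT.rc_pos (hx n) (hy n) ?_
  have h1 := norm_iterate_motion_sub_le hT hδ hδ' hr hrη hQ hx n
  have h2 := norm_iterate_motion_sub_le hT hδ hδ' hr hrη hQ hy n
  rw [hxy, norm_sub_rev] at h1
  have h3 := norm_add_le_of_le h1 h2
  rw [sub_add_sub_cancel, ← Complex.ofReal_sub, Complex.norm_real, Real.norm_eq_abs] at h3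
  linarith

/-- The motion maps the invariant set of the base map onto that of a nearby real polynomial. -/
theorem motion_image {L γ₀ L' γ : ℝ} (h0 : Trap.IsFor { T with l := L } P₀.eval γ₀)
    (ha : 2 * η < T.ra) (hc : 2 * η < T.rc) (hb : 2 * η < T.rb) {P : ℝ[X]}
    (hP : Trap.IsFor { T with l := L' } P.eval γ)
    (hQ : T.Shadows P₀ δ r (P.map Complex.ofRealHom)) :
    motion P₀ (P.map Complex.ofRealHom) '' (Complex.ofReal '' T.invSet P₀.eval) =
      Complex.ofReal '' T.invSet P.eval := by
  have key : ∀ x ∈ T.invSet P₀.eval, ∃ y ∈ T.invSet P.eval,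
      T.itin P.eval y = T.itin P₀.eval x ∧ motion P₀ (P.map Complex.ofRealHom) x = y := by
    intro x hx
    have hs := hT.isShadowable hδ hδ' hr hQ hx
    have him : (motion P₀ (P.map Complex.ofRealHom) x).im = 0 := by
      rw [motion, Complex.ofReal_re]
      refine hs.shadow_im (fun z hz => ?_) (fun n => Complex.ofReal_im _)
        (fun n => Complex.ofReal_im _) 0
      rw [← Complex.re_add_im z, hz, Complex.ofReal_zero, zero_mul, add_zero, eval_map_ofReal,
        Complex.ofReal_im]
    obtain ⟨y, hy⟩ : ∃ y : ℝ, motion P₀ (P.map Complex.ofRealHom) x = y :=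
      ⟨_, (Complex.ext (Complex.ofReal_re _) (by rw [him, Complex.ofReal_im])).symm⟩
    have hclose : ∀ n, |P.eval^[n] y - P₀.eval^[n] x| ≤ η := fun n => by
      have h1 := norm_iterate_motion_sub_le hT hδ hδ' hr hrη hQ hx n
      rwa [hy, iterate_eval_map_ofReal, ← Complex.ofReal_sub, Complex.norm_real,
        Real.norm_eq_abs] at h1
    have hyinv : y ∈ T.invSet P.eval := hP.mem_core_of_shadows ha hc hb hx hclose
    refine ⟨y, hyinv, funext fun n => T.code_eq_of_abs_sub_lt hT.rc_pos (hyinv n) (hx n) ?_, hy⟩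
    have := hclose n
    have := hT.rc_pos
    linarith
  refine Subset.antisymm ?_ ?_
  · rintro _ ⟨_, ⟨x, hx, rfl⟩, rfl⟩
    obtain ⟨y, hy, -, hxy⟩ := key x hx
    exact ⟨y, hy, hxy.symm⟩
  -- The itinerary of `y` is realized by a point of the base map, whose image under the motion has
  -- the same itinerary and thus equals `y`.
  · rintro _ ⟨y, hy, rfl⟩
    obtain ⟨x, hx, hxy⟩ := h0.exists_itin (hP.itin_mem hy)
    obtain ⟨y', hy', h1, h2⟩ := key x hx
    refine ⟨x, mem_image_of_mem _ hx, ?_⟩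
    rw [h2]
    exact congrArg _ (hP.itin_injOn hy' hy (h1.trans hxy))

end Motion

/-- The moved point depends holomorphically on the parameter. -/
theorem differentiableOn_motion (ch : IsCriticalValueChart d μ P₀ c₀ ε F c)
    (hT : T.IsBase P₀ c₀ M) {δ r : ℝ} (hδ : 0 ≤ δ) (hδ' : T.κ⁻¹ + δ < 1) (hr : 0 < r)
    (hF : ∀ w ∈ polydisk (critValues P₀ c₀) ε, T.Shadows P₀ δ r (F w)) {x : ℝ}
    (hx : x ∈ T.invSet P₀.eval) :
    DifferentiableOn ℂ (fun w => motion P₀ (F w) x) (polydisk (critValues P₀ c₀) ε) := by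
  refine differentiableOn_shadow (F := fun w => (F w).eval) Metric.isOpen_ball (fun z hz => ?_)
    (fun w hw => hT.isShadowable hδ hδ' hr (hF w hw) (x := (x : ℂ).re)
      (by rwa [Complex.ofReal_re])) 0
  refine DifferentiableOn.congr (f := fun w => ∑ k ∈ Finset.range (d + 1), (F w).coeff k * z w ^ k)
    (DifferentiableOn.fun_sum fun k _ => (ch.holomorphic k).mul (hz.pow k)) fun w hw => ?_
  rw [eval_eq_sum_range, (ch.mem w hw).critical.natDegree_eq]

end Shadow

/-! ### The interval spanned by the attracting cycle -/

theorem convexHull_triple {s p q : ℝ} (h1 : s < p) (h2 : p < q) :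
    convexHull ℝ {p, q, s} = Icc s q := by
  refine Subset.antisymm (convexHull_min ?_ (convex_Icc s q)) ?_
  · rintro x (rfl | rfl | rfl)
    · exact ⟨h1.le, h2.le⟩
    · exact ⟨(h1.trans h2).le, le_rfl⟩
    · exact ⟨le_rfl, (h1.trans h2).le⟩
  · rw [← segment_eq_Icc (h1.trans h2).le]
    exact segment_subset_convexHull (by simp) (by simp)

section Hull

variable {d m : ℕ} {μ : Fin (m + 1) → ℕ} {T : Trap} {P : ℝ[X]} {γ : Fin (m + 1) → ℝ}
  (h : Trap.IsFor { T with l := lowPoint γ } P.eval (γ (Fin.last m)))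
include h

theorem exists_cycleHull : ∃ p, |p - T.c| ≤ T.rc / 2 ∧
    |P.eval p - T.b| ≤ T.rb / 2 ∧ |P.eval (P.eval p) - T.a| ≤ T.ra / 2 ∧
    attractingThreeCycles P.eval (lastLaps γ) = {p, P.eval p, P.eval (P.eval p)} ∧
    cycleHull P γ = Icc (P.eval (P.eval p)) (P.eval p) ∧
    repeller P.eval ∩ cycleHull P γ = T.invSet P.eval := by
  obtain ⟨p, h1, h2, h3, h4, h5⟩ := h.exists_attracting_cycle
  have hra : 0 < T.ra := h.ra_pos
  have hrc : 0 < T.rc := h.rc_pos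
  have hrb : 0 < T.rb := h.rb_pos
  have hac : T.a + T.ra < T.c - T.rc := h.a_lt_c
  have hcb : T.c + T.rc < T.b - T.rb := h.c_lt_b
  have b1 := abs_le.1 h1
  have b2 := abs_le.1 h2
  have b3 := abs_le.1 h3
  simp only at b1 b2 b3
  have h4' : attractingThreeCycles P.eval (lastLaps γ) = {p, P.eval p, P.eval (P.eval p)} := by
    rw [lastLaps_eq]; exact h4
  have h6 : cycleHull P γ = Icc (P.eval (P.eval p)) (P.eval p) := by
    rw [cycleHull, h4', convexHull_triple (by linarith) (by linarith)]
  exact ⟨p, h1, h2, h3, h4', h6, by rw [h6]; exact h5⟩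

theorem critical_interior_cycleHull (hμ : ∀ i, 1 ≤ μ i)
    (hder : P.derivative = C (d * P.coeff d) * ∏ i, (X - C (γ i)) ^ μ i)
    (hl : (d : ℝ) * P.coeff d ≠ 0) (hlow : ∀ i, i ≠ Fin.last m → γ i < T.a - T.ra) :
    {x ∈ interior (cycleHull P γ) | P.derivative.eval x = 0} = {γ (Fin.last m)} := by
  obtain ⟨p, h1, h2, h3, -, h5, -⟩ := exists_cycleHull h
  have hra : 0 < T.ra := h.ra_pos
  have hrb : 0 < T.rb := h.rb_pos
  have hac : T.a + T.ra < T.c - T.rc := h.a_lt_c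
  have hcb : T.c + T.rc < T.b - T.rb := h.c_lt_b
  have b2 := abs_le.1 h2
  have b3 := abs_le.1 h3
  have b4 : |γ (Fin.last m) - T.c| ≤ T.rc := h.near_c
  rw [abs_le] at b4
  rw [h5, interior_Icc]
  ext x
  rw [mem_sep_iff, mem_singleton_iff, eval_derivative_eq_zero_iff hμ hder hl]
  constructor
  · rintro ⟨hx, i, rfl⟩
    by_contra hne
    have := hlow i fun e => hne (by rw [e])
    linarith [hx.1]
  · rintro rfl
    exact ⟨⟨by linarith, by linarith⟩, _, rfl⟩

/-- If the turning point is periodic, then its orbit is the attracting cycle. -/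
theorem repeller_inter_Ioo (hper : P.eval^[3] (γ (Fin.last m)) = γ (Fin.last m)) :
    repeller P.eval ∩ Ioo (P.eval^[2] (γ (Fin.last m))) (P.eval (γ (Fin.last m))) =
      T.invSet P.eval := by
  obtain ⟨p, h1, -, -, h4, h5, h6⟩ := exists_cycleHull h
  have hrc : 0 < T.rc := h.rc_pos
  have hp : P.eval^[3] p = p := by
    have : p ∈ attractingThreeCycles P.eval (lastLaps γ) := by rw [h4]; simp
    rw [← this.2.1]
    exact Function.iterate_minimalPeriod
  have hc := h.contr p (γ (Fin.last m)) (h1.trans (by show T.rc / 2 ≤ T.rc; linarith)) h.near_c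
  change |P.eval^[3] p - P.eval^[3] (γ (Fin.last m))| ≤ _ at hc
  rw [hp, hper] at hc
  -- Both points are fixed by the third iterate, which halves their distance.
  have hpc : p = γ (Fin.last m) := by
    have := abs_nonneg (p - γ (Fin.last m))
    exact sub_eq_zero.1 (abs_eq_zero.1 (by linarith))
  subst hpc
  rw [h5] at h6
  refine Subset.antisymm (fun x hx => ?_) fun x hx => ⟨?_, h.core_subset (hx 0)⟩
  · rw [← h6]
    exact ⟨hx.1, Ioo_subset_Icc_self hx.2⟩
  · rw [← h6] at hx
    exact hx.1

end Hull

end FibRepeller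

end

/-! ### The main theorem -/

theorem mainTheorem6 {d m : ℕ} (hd : 3 ≤ d) (μ : Fin (m + 1) → ℕ) (hμ : ∀ i, 1 ≤ μ i)
    (hμd : ∑ i, μ i = d - 1) (P₀ : ℝ[X]) (c₀ : Fin (m + 1) → ℝ)
    (hP₀ : FibRepeller.IsBaseMap d μ P₀ c₀) :
    ∃ ε > 0, ∃ (F : (Fin (m + 1) → ℂ) → ℂ[X]) (c : (Fin (m + 1) → ℂ) → Fin (m + 1) → ℂ),
      FibRepeller.IsCriticalValueChart d μ P₀ c₀ ε F c ∧
      -- for `w ∈ 𝒰`: the critical points of `P = P_w` are the real numbers `γ i`, `P` is virtually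
      -- unimodal, and it has exactly one attracting cycle of period three in the last two laps
      (∀ (w : Fin (m + 1) → ℝ) (P : ℝ[X]),
        FibRepeller.IsRealParameter (FibRepeller.critValues P₀ c₀) ε F w P →
        ∃ γ : Fin (m + 1) → ℝ, StrictMono γ ∧
          c (FibRepeller.toComplex w) = FibRepeller.toComplex γ ∧
          FibRepeller.IsVirtuallyUnimodal P (γ (Fin.last m)) ∧
          (∃ p : ℝ, FibRepeller.attractingThreeCycles P.eval (FibRepeller.lastLaps γ) =
            {p, P.eval p, P.eval (P.eval p)}) ∧
          {x ∈ interior (FibRepeller.cycleHull P γ) | P.derivative.eval x = 0} =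
            {γ (Fin.last m)} ∧
          -- `Λ(P_w) ∩ I_w` is a Cantor set, conjugate to the Fibonacci shift
          FibRepeller.IsCantorSet
            (FibRepeller.repeller P.eval ∩ FibRepeller.cycleHull P γ) ∧
          FibRepeller.IsTopConjugate P.eval
            (FibRepeller.repeller P.eval ∩ FibRepeller.cycleHull P γ)
            FibRepeller.shift FibRepeller.fibShift) ∧
      -- the holomorphic motion of `Λ(P₀) ∩ (P₀²(c_ν), P₀(c_ν))` over `W`
      ∃ h : (Fin (m + 1) → ℂ) → ℂ → ℂ,
        FibRepeller.IsHolomorphicMotion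
          (FibRepeller.polydisk (FibRepeller.critValues P₀ c₀) ε)
          (FibRepeller.toComplex (FibRepeller.critValues P₀ c₀))
          (Complex.ofReal '' (FibRepeller.repeller P₀.eval ∩
            Ioo (P₀.eval^[2] (c₀ (Fin.last m))) (P₀.eval (c₀ (Fin.last m))))) h ∧
        ∀ (w γ : Fin (m + 1) → ℝ) (P : ℝ[X]),
          FibRepeller.IsRealParameter (FibRepeller.critValues P₀ c₀) ε F w P →
          c (FibRepeller.toComplex w) = FibRepeller.toComplex γ →
          h (FibRepeller.toComplex w) ''
            (Complex.ofReal '' (FibRepeller.repeller P₀.eval ∩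
              Ioo (P₀.eval^[2] (c₀ (Fin.last m))) (P₀.eval (c₀ (Fin.last m))))) =
            Complex.ofReal '' (FibRepeller.repeller P.eval ∩ FibRepeller.cycleHull P γ) := by
  obtain ⟨T, M, hT⟩ := hP₀.exists_trap hd hμ hμd
  have hmem := hP₀.critical_mem_Ioo hd hμ hμd
  obtain ⟨ε₀, hε₀, F, c, hch⟩ := FibRepeller.exists_chart (by omega) hμ hμd hP₀.critical
    (fun i => (hmem i).1.ne') (fun i => (hmem i).2.ne)
  have hch₀ := hch ε₀ hε₀ le_rfl
  have hra := hT.ra_pos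
  have hrc := hT.rc_pos
  have hrb := hT.rb_pos
  obtain ⟨η, hη, ha, hc, hb⟩ : ∃ η, 0 < η ∧ 2 * η < T.ra ∧ 2 * η < T.rc ∧ 2 * η < T.rb := by
    have h1 := min_le_left T.ra (min T.rc T.rb)
    have h2 := (min_le_right T.ra (min T.rc T.rb)).trans (min_le_left _ _)
    have h3 := (min_le_right T.ra (min T.rc T.rb)).trans (min_le_right _ _)
    have h4 := lt_min hra (lt_min hrc hrb)
    exact ⟨min T.ra (min T.rc T.rb) / 3, by linarith, by linarith, by linarith, by linarith⟩
  obtain ⟨δ, r, hδ, hδ', hr, hrη, hshadow⟩ := hT.eventually_shadows hch₀ hε₀ hη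
  obtain ⟨ε₁, hε₁, hball⟩ := Metric.eventually_nhds_iff_ball.1
    ((hP₀.eventually_isNear hd hμ hμd hch₀ hε₀ hT).and hshadow)
  -- The same `F` and `c` form a chart on every smaller polydisk, so the radius may be reduced until
  -- all trap and shadowing conditions hold.
  have hε : 0 < min ε₀ ε₁ := lt_min hε₀ hε₁
  have ch := hch _ hε (min_le_left _ _)
  have hnear : ∀ w ∈ FibRepeller.polydisk (FibRepeller.critValues P₀ c₀) (min ε₀ ε₁),
      FibRepeller.IsNear d μ T M F c w ∧ T.Shadows P₀ δ r (F w) := fun w hw =>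
    hball w (Metric.ball_subset_ball (min_le_right _ _) hw)
  have hodd := hP₀.odd_dominant hd hμd
  have hfor : ∀ (w : Fin (m + 1) → ℝ) (P : ℝ[X]),
      FibRepeller.IsRealParameter (FibRepeller.critValues P₀ c₀) (min ε₀ ε₁) F w P →
      ∃ γ : Fin (m + 1) → ℝ, StrictMono γ ∧
        c (FibRepeller.toComplex w) = FibRepeller.toComplex γ ∧
        P.derivative = C (d * P.coeff d) * ∏ i, (X - C (γ i)) ^ μ i ∧
        FibRepeller.Trap.IsFor { T with l := FibRepeller.lowPoint γ } P.eval
          (γ (Fin.last m)) := by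
    intro w P hw
    have hn := (hnear _ (hw.mem_polydisk hε)).1
    obtain ⟨γ, hγ, hcγ, hder⟩ := FibRepeller.exists_real_critical ch hε hd hμ hμd hw hn
    exact ⟨γ, hγ, hcγ, hder, hn.isFor hT hd hodd hw.2 hγ hcγ hder⟩
  have hinj : ∀ γ γ' : Fin (m + 1) → ℝ,
      FibRepeller.toComplex γ = FibRepeller.toComplex γ' → γ = γ' := fun γ γ' h =>
    funext fun i => Complex.ofReal_injective (congrFun h i)
  -- The base map is itself a real parameter, so the trap results apply to it as well.
  have hbase : FibRepeller.IsRealParameter (FibRepeller.critValues P₀ c₀) (min ε₀ ε₁) F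
      (FibRepeller.critValues P₀ c₀) P₀ := ⟨fun i => by rwa [sub_self, abs_zero], ch.base.symm⟩
  obtain ⟨γ₀, -, hcγ₀, -, hfor₀⟩ := hfor _ _ hbase
  obtain rfl : c₀ = γ₀ := hinj _ _ (ch.base_critical.symm.trans hcγ₀)
  have hE := FibRepeller.repeller_inter_Ioo hfor₀ hP₀.period_three
  refine ⟨min ε₀ ε₁, hε, F, c, ch, ?_, fun w z => FibRepeller.motion P₀ (F w) z, ⟨?_, ?_, ?_⟩, ?_⟩
  · intro w P hw
    have hwW := hw.mem_polydisk hε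
    have hn := (hnear _ hwW).1
    obtain ⟨γ, hγ, hcγ, hder, hforw⟩ := hfor w P hw
    obtain ⟨p, -, -, -, hp, -, hrep⟩ := FibRepeller.exists_cycleHull hforw
    have hev : ∀ x : ℝ, (F (FibRepeller.toComplex w)).eval (x : ℂ) = ((P.eval x : ℝ) : ℂ) :=
      fun x => by rw [← hw.2, FibRepeller.eval_map_ofReal]
    have hval : ∀ i, P.eval (γ i) = w i := fun i => by
      have h1 := ch.value _ hwW i
      rw [hcγ] at h1
      exact Complex.ofReal_injective ((hev _).symm.trans h1)
    have h0 : P.eval 0 = P₀.eval 0 := by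
      have h1 := (ch.mem _ hwW).eval_zero
      rw [← Complex.ofReal_zero, hev] at h1
      exact Complex.ofReal_injective h1
    have h1 : P.eval 1 = P₀.eval 1 := by
      have h1 := (ch.mem _ hwW).eval_one
      rw [← Complex.ofReal_one, hev] at h1
      exact Complex.ofReal_injective h1
    have hend : ∀ x : ℝ, x = 0 ∨ x = 1 → P₀.eval x ∈ Icc (0 : ℝ) 1 := fun x hx => by
      rcases hP₀.eval_endpoint hx with e | e <;> rw [e] <;> simp
    refine ⟨γ, hγ, hcγ, hn.isVirtuallyUnimodal hμ hodd hw.2 hγ hcγ hder hval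
      (h0 ▸ hend 0 (Or.inl rfl)) (h1 ▸ hend 1 (Or.inr rfl)) hforw, ⟨p, hp⟩,
      FibRepeller.critical_interior_cycleHull hforw hμ hder (hn.lead_neg hw.2).ne fun i hi => ?_,
      ?_, ?_⟩
    · have h2 := hn.re_low i hi
      rw [hcγ] at h2
      exact h2
    · rw [hrep]
      exact hforw.isCantorSet_invSet
    · rw [hrep]
      exact hforw.isTopConjugate
  · rintro _ ⟨x, -, rfl⟩
    simp only [ch.base, FibRepeller.motion_base]
  · intro w hw
    rw [hE]
    exact FibRepeller.motion_injOn hT hδ hδ' hr hrη hfor₀ (by linarith) (hnear w hw).2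
  · rw [hE]
    rintro _ ⟨x, hx, rfl⟩
    exact FibRepeller.differentiableOn_motion ch hT hδ hδ' hr (fun w hw => (hnear w hw).2) hx
  · intro w γ P hw hcγ
    obtain ⟨γ', -, hcγ', -, hforw⟩ := hfor w P hw
    obtain rfl : γ = γ' := hinj _ _ (hcγ.symm.trans hcγ')
    obtain ⟨-, -, -, -, -, -, hrep⟩ := FibRepeller.exists_cycleHull hforw
    rw [hE, hrep]
    show FibRepeller.motion P₀ (F (FibRepeller.toComplex w)) '' _ = _
    rw [← hw.2]
    refine FibRepeller.motion_image hT hδ hδ' hr hrη hfor₀ ha hc hb hforw ?_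
    rw [hw.2]
    exact (hnear _ (hw.mem_polydisk hε)).2
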